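/- **Theorem (Handle sliding lemma).** Let $(M,\omega)$ be a symplectic manifold, $L\subset M$ a compact Lagrangian submanifold, and $V\subset\overline V\subset U$ a pair of (open) Darboux neighborhoods of $L$, with $\overline V$ compact: $U$ is identified by a diffeomorphism $x\mapsto(q(x),p(x))$ with an open neighborhood of the zero section of $T^*L$, where $L$ corresponds to the zero section and $\omega=-d\Theta$, $\Theta=p\,dq$. Let $g$ be a Riemannian metric on $L$ and let $J_0$ be an $\omega$-compatible almost complex structure on $M$ which on $V$ equals the canonical (Sasakian) almost complex structure $J_g$ of $T^*L$. All distances on $M$ are those of the metric $\omega(\cdot,J_0\cdot)$ (equal to $\infty$ between different components); $D_\delta(L)=\{x: d(x,L)<\delta\}$, $$\overline d(\phi,\psi)=\max\Big\{\sup_x d(\phi(x),\psi(x)),\ \sup_x d(\phi^{-1}(x),\psi^{-1}(x))\Big\},\qquad d(V,\Theta):=\min_{x\in\partial V}|p(x)|_g ,$$ with $d(V,\Theta)=\infty$ if $\partial V=\emptyset$, so that $d(V,\Theta)=r$ for a disc bundle $V=\{|p|<r\}$ with closure in $U$ (when $L\neq\emptyset$ and $\dim L\ge1$). Then $d(V,\Theta)>0$,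 and for every finite $\delta<d(V,\Theta)$ there is a constant $C=C(J_0,V)>0$, depending only on $\delta$ and the data $(M,\omega,L,U,V,g,J_0)$, with the following property. Let $\mathcal H=\{H(s)\}_{s\in[0,1]}$ be any smooth family of Hamiltonians $H(s):[0,1]\times M\to\mathbb R$ generating flows $\phi_{H(s)}^t$ by diffeomorphisms of $M$, $t\in[0,1]$, which is $V$-engulfable, i.e. $\phi_{H(s)}^t(L)\subset V$ for all $s,t\in[0,1]$, and satisfies $$\max_{s\in[0,1]}\overline d(\phi_{H(s)}^1,\mathrm{id})<\delta .$$ Let $\rho:\mathbb R\to[0,1]$ be any elongation function, i.e. $\rho$ is smooth, $\rho(\tau)=0$ for $\tau\le0$, $\rho(\tau)=1$ for $\tau\ge1$ and $\rho'\ge0$. Let $v:\mathbb R\times[0,1]\to M$ be any smooth finite-energy solution of $$\frac{\partial v}{\partial\tau}+J_0\frac{\partial v}{\partial t}=0,\qquad v(\tau,0)\in\phi^1_{H(\rho(\tau))}(L),\quad v(\tau,1)\in L .$$ Then one of the following holds: 1. $\operatorname{Image}v\subset D_\delta(L)\subset V$, and moreover $d(v(z),L)\le\max_{s\in[0,1]}\overline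 d(\phi^1_{H(s)},\mathrm{id})$ for all $z\in\mathbb R\times[0,1]$; or 2. $\operatorname{Image}v\not\subset V$ and $\int v^*\omega\ge C$. -/

import Mathlib

open Set MeasureTheory Manifold Bundle
open scoped ContDiff ENNReal NNReal

noncomputable section

namespace HandleSliding

/-- Model vector space of an `m`-dimensional manifold. -/
abbrev Eucl (m : ℕ) : Type := EuclideanSpace ℝ (Fin m)

/-! ### Symplectic forms and compatible almost complex structures -/

section Symplectic

variable {m : ℕ} {M : Type*} [TopologicalSpace M] [ChartedSpace (Eucl m) M]
  [IsManifold 𝓘(ℝ, Eucl m) ∞ M]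

/-- The derivative at `y` of `c⁻¹`, where `c` is the preferred chart at `x₀`, as a map into
`T_z M`, `z = c⁻¹ y`. The tangent space `T_z M` is the model space, identified through the
preferred chart `c_z` at `z`, so that this is the derivative of `c_z ∘ c⁻¹`. -/
def chartSymmDeriv (x₀ : M) (y : Eucl m) : Eucl m →L[ℝ] Eucl m :=
  tangentCoordChange 𝓘(ℝ, Eucl m) x₀ ((chartAt (Eucl m) x₀).symm y)
    ((chartAt (Eucl m) x₀).symm y)

/-- The representation, in the preferred chart `c` at `x₀`, of a field `β` of bilinear forms:
`y ↦ ((c⁻¹)^* β)_y`. -/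
def bilinInChart (β : ∀ x : M, TangentSpace 𝓘(ℝ, Eucl m) x →L[ℝ] TangentSpace 𝓘(ℝ, Eucl m) x →L[ℝ] ℝ)
    (x₀ : M) (y : Eucl m) : Eucl m →L[ℝ] Eucl m →L[ℝ] ℝ :=
  let B : Eucl m →L[ℝ] Eucl m →L[ℝ] ℝ := β ((chartAt (Eucl m) x₀).symm y)
  B.bilinearComp (chartSymmDeriv x₀ y) (chartSymmDeriv x₀ y)

/-- The representation, in the preferred chart `c` at `x₀`, of a field `θ` of covectors:
`y ↦ ((c⁻¹)^* θ)_y`. -/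
def covectorInChart (θ : ∀ x : M, TangentSpace 𝓘(ℝ, Eucl m) x →L[ℝ] ℝ)
    (x₀ : M) (y : Eucl m) : Eucl m →L[ℝ] ℝ :=
  let T : Eucl m →L[ℝ] ℝ := θ ((chartAt (Eucl m) x₀).symm y)
  T.comp (chartSymmDeriv x₀ y)

/-- The exterior derivative `(dθ)_x (u, w)` of a 1-form, computed in the preferred chart at `x`;
the tangent space at `x` is identified with the model space through that very chart. -/
def dOneForm (θ : ∀ x : M, TangentSpace 𝓘(ℝ, Eucl m) x →L[ℝ] ℝ) (x : M)
    (u w : TangentSpace 𝓘(ℝ, Eucl m) x) : ℝ :=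
  let D : Eucl m →L[ℝ] Eucl m →L[ℝ] ℝ := fderiv ℝ (covectorInChart θ x) (chartAt (Eucl m) x x)
  D u w - D w u

variable (m M) in
/-- A symplectic form: a smooth, alternating, nondegenerate and closed 2-form. -/
structure SymplecticForm where
  form : ∀ x : M, TangentSpace 𝓘(ℝ, Eucl m) x →L[ℝ] TangentSpace 𝓘(ℝ, Eucl m) x →L[ℝ] ℝ
  contMDiff : ContMDiff 𝓘(ℝ, Eucl m) (𝓘(ℝ, Eucl m).prod 𝓘(ℝ, Eucl m →L[ℝ] Eucl m →L[ℝ] ℝ)) ∞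
    (fun x ↦ TotalSpace.mk' (Eucl m →L[ℝ] Eucl m →L[ℝ] ℝ) x (form x))
  alternating : ∀ x u, form x u u = 0
  nondegenerate : ∀ x u, (∀ w, form x u w = 0) → u = 0
  closed : ∀ x, ∀ u₁ u₂ u₃ : Eucl m,
    let D := fderiv ℝ (bilinInChart form x) (chartAt (Eucl m) x x)
    D u₁ u₂ u₃ + D u₂ u₃ u₁ + D u₃ u₁ u₂ = 0

/-- A smooth almost complex structure compatible with the symplectic form `Ω`. -/
structure CompatibleACS (Ω : SymplecticForm m M) where
  J : ∀ x : M, TangentSpace 𝓘(ℝ, Eucl m) x →L[ℝ] TangentSpace 𝓘(ℝ, Eucl m) x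
  contMDiff : ContMDiff 𝓘(ℝ, Eucl m) (𝓘(ℝ, Eucl m).prod 𝓘(ℝ, Eucl m →L[ℝ] Eucl m)) ∞
    (fun x ↦ TotalSpace.mk' (Eucl m →L[ℝ] Eucl m)
      (E := fun x : M ↦ TangentSpace 𝓘(ℝ, Eucl m) x →L[ℝ] TangentSpace 𝓘(ℝ, Eucl m) x) x (J x))
  sq : ∀ x u, J x (J x u) = -u
  invariant : ∀ x u w, Ω.form x (J x u) (J x w) = Ω.form x u w
  pos : ∀ x u, u ≠ 0 → 0 < Ω.form x u (J x u)

variable {Ω : SymplecticForm m M}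

/-- The Riemannian distance (`∞` between different components) of the metric `Ω(·, J ·)`. -/
def distJ (J : CompatibleACS Ω) (x y : M) : ℝ≥0∞ :=
  letI : ∀ x : M, ENorm (TangentSpace 𝓘(ℝ, Eucl m) x) :=
    fun x ↦ ⟨fun u ↦ ENNReal.ofReal √(Ω.form x u (J.J x u))⟩
  riemannianEDist 𝓘(ℝ, Eucl m) x y

/-- Distance of a point to a set. -/
def distTo (J : CompatibleACS Ω) (A : Set M) (x : M) : ℝ≥0∞ := ⨅ y ∈ A, distJ J x y

/-- The open `δ`-neighbourhood `D_δ(A)` of a set. -/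
def nbhd (J : CompatibleACS Ω) (δ : ℝ≥0∞) (A : Set M) : Set M := {x | distTo J A x < δ}

/-- The `C⁰`-distance of two maps. -/
def dC0 (J : CompatibleACS Ω) (f h : M → M) : ℝ≥0∞ := ⨆ x, distJ J (f x) (h x)

/-- `d̄(φ, ψ) = max (d_{C⁰}(φ, ψ), d_{C⁰}(φ⁻¹, ψ⁻¹))`. -/
def dBar (J : CompatibleACS Ω) (φ ψ : M ≃ₘ⟮𝓘(ℝ, Eucl m), 𝓘(ℝ, Eucl m)⟯ M) : ℝ≥0∞ :=
  max (dC0 J φ ψ) (dC0 J φ.symm ψ.symm)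

/-- `max_{s ∈ [0,1]} d̄(φ_{H(s)}^1, id)`, for the two-parameter family `φ s t = φ_{H(s)}^t`. -/
def maxDBar (J : CompatibleACS Ω) (φ : ℝ → ℝ → M ≃ₘ⟮𝓘(ℝ, Eucl m), 𝓘(ℝ, Eucl m)⟯ M) : ℝ≥0∞ :=
  ⨆ s ∈ Icc (0 : ℝ) 1, dBar J (φ s 1) (Diffeomorph.refl 𝓘(ℝ, Eucl m) M ∞)

/-! ### Hamiltonian flows -/

/-- `φ` is the flow, for times in `[0,1]`, of the time-dependent Hamiltonian `H`:
`φ^0 = id` and `∂φ^t/∂t = X_{H_t}(φ^t)`, where `Ω(X_{H_t}, ·) = dH_t`. -/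
structure IsHamiltonianFlow (Ω : SymplecticForm m M) (H : ℝ → M → ℝ)
    (φ : ℝ → M ≃ₘ⟮𝓘(ℝ, Eucl m), 𝓘(ℝ, Eucl m)⟯ M) : Prop where
  zero : ∀ x, φ 0 x = x
  deriv : ∀ t ∈ Icc (0 : ℝ) 1, ∀ x, ∃ X : TangentSpace 𝓘(ℝ, Eucl m) (φ t x),
    HasMFDerivWithinAt 𝓘(ℝ, ℝ) 𝓘(ℝ, Eucl m) (fun t' ↦ φ t' x) (Icc 0 1) t
      (ContinuousLinearMap.toSpanSingleton ℝ X) ∧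
    ∀ w, Ω.form (φ t x) X w = mfderiv 𝓘(ℝ, Eucl m) 𝓘(ℝ, ℝ) (H t) (φ t x) w

/-- `H = {H(s)}_{s ∈ [0,1]}` is a smooth path of Hamiltonians `H(s) : [0,1] × M → ℝ`, written
`H s t x`, and `φ s t = φ_{H(s)}^t`. -/
structure IsHamiltonianFamily (Ω : SymplecticForm m M) (H : ℝ → ℝ → M → ℝ)
    (φ : ℝ → ℝ → M ≃ₘ⟮𝓘(ℝ, Eucl m), 𝓘(ℝ, Eucl m)⟯ M) : Prop where
  smooth : ContMDiffOn (𝓘(ℝ, ℝ × ℝ).prod 𝓘(ℝ, Eucl m)) 𝓘(ℝ, ℝ) ∞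
    (fun p : (ℝ × ℝ) × M ↦ H p.1.1 p.1.2 p.2) ((Icc 0 1 ×ˢ Icc 0 1) ×ˢ univ)
  flow : ∀ s ∈ Icc (0 : ℝ) 1, IsHamiltonianFlow Ω (H s) (φ s)

/-- Every `H(s)` is `V`-engulfable for the submanifold `A`: `φ_{H(s)}^t(A) ⊆ V` for all `t`. -/
def IsEngulfable (φ : ℝ → ℝ → M ≃ₘ⟮𝓘(ℝ, Eucl m), 𝓘(ℝ, Eucl m)⟯ M) (A V : Set M) : Prop :=
  ∀ s ∈ Icc (0 : ℝ) 1, ∀ t ∈ Icc (0 : ℝ) 1, φ s t '' A ⊆ V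

/-! ### Holomorphic strips -/

/-- The strip `ℝ × [0,1]`, with coordinates `(τ, t)`. -/
def strip : Set (ℝ × ℝ) := univ ×ˢ Icc 0 1

/-- `∂v/∂τ` on the strip. -/
def dTau (v : ℝ × ℝ → M) (z : ℝ × ℝ) : TangentSpace 𝓘(ℝ, Eucl m) (v z) :=
  mfderivWithin 𝓘(ℝ, ℝ × ℝ) 𝓘(ℝ, Eucl m) v strip z ((1, 0) : ℝ × ℝ)

/-- `∂v/∂t` on the strip. -/
def dT (v : ℝ × ℝ → M) (z : ℝ × ℝ) : TangentSpace 𝓘(ℝ, Eucl m) (v z) :=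
  mfderivWithin 𝓘(ℝ, ℝ × ℝ) 𝓘(ℝ, Eucl m) v strip z ((0, 1) : ℝ × ℝ)

/-- The energy `½ ∫ |∂v/∂τ|² + |∂v/∂t|²` with respect to the metric `Ω(·, J ·)`. -/
def energy (J : CompatibleACS Ω) (v : ℝ × ℝ → M) : ℝ≥0∞ :=
  (1 / 2) * ∫⁻ z in strip, ENNReal.ofReal
    (Ω.form (v z) (dTau v z) (J.J (v z) (dTau v z)) + Ω.form (v z) (dT v z) (J.J (v z) (dT v z)))

/-- The symplectic area `∫ v^*Ω`. -/
def area (Ω : SymplecticForm m M) (v : ℝ × ℝ → M) : ℝ :=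
  ∫ z in strip, Ω.form (v z) (dTau v z) (dT v z)

/-- Smooth finite-energy solutions of `∂v/∂τ + J ∂v/∂t = 0` on the strip with the moving boundary
condition `v(τ,0) ∈ φ_{H(ρ(τ))}^1(A)`, `v(τ,1) ∈ A`. -/
structure IsMovingStrip (J : CompatibleACS Ω) (A : Set M)
    (φ : ℝ → ℝ → M ≃ₘ⟮𝓘(ℝ, Eucl m), 𝓘(ℝ, Eucl m)⟯ M) (ρ : ℝ → ℝ) (v : ℝ × ℝ → M) : Prop where
  smooth : ContMDiffOn 𝓘(ℝ, ℝ × ℝ) 𝓘(ℝ, Eucl m) ∞ v strip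
  cauchyRiemann : ∀ z ∈ strip, dTau v z + J.J (v z) (dT v z) = 0
  boundary_zero : ∀ τ, v (τ, 0) ∈ φ (ρ τ) 1 '' A
  boundary_one : ∀ τ, v (τ, 1) ∈ A
  finite_energy : energy J v < ⊤

end Symplectic

/-- Elongation functions `ρ : ℝ → [0,1]`. -/
structure IsElongation (ρ : ℝ → ℝ) : Prop where
  smooth : ContDiff ℝ ∞ ρ
  mem_Icc : ∀ τ, ρ τ ∈ Icc (0 : ℝ) 1
  eq_zero : ∀ τ ≤ 0, ρ τ = 0
  eq_one : ∀ τ, 1 ≤ τ → ρ τ = 1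
  deriv_nonneg : ∀ τ, 0 ≤ deriv ρ τ

/-! ### Riemannian metrics on `L` and the cotangent bundle -/

section Cotangent

variable {n : ℕ} {L : Type*} [TopologicalSpace L] [ChartedSpace (Eucl n) L]
  [IsManifold 𝓘(ℝ, Eucl n) ∞ L]

variable (n L) in
/-- The total space of the cotangent bundle `T^*L`, with Mathlib's manifold structure. -/
abbrev Cotangent : Type _ :=
  TotalSpace (Eucl n →L[ℝ] ℝ) (fun q : L ↦ TangentSpace 𝓘(ℝ, Eucl n) q →L[ℝ] ℝ)

variable (n L) in
/-- Smooth Riemannian metrics on `L`. -/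
abbrev RMetric : Type _ :=
  ContMDiffRiemannianMetric 𝓘(ℝ, Eucl n) ∞ (Eucl n) (fun q : L ↦ TangentSpace 𝓘(ℝ, Eucl n) q)

theorem exists_sharp (g : RMetric n L) (q : L) (p : TangentSpace 𝓘(ℝ, Eucl n) q →L[ℝ] ℝ) :
    ∃ u : TangentSpace 𝓘(ℝ, Eucl n) q, g.inner q u = p := by
  have : FiniteDimensional ℝ (TangentSpace 𝓘(ℝ, Eucl n) q) :=
    inferInstanceAs (FiniteDimensional ℝ (Eucl n))
  let f : TangentSpace 𝓘(ℝ, Eucl n) q →ₗ[ℝ] Module.Dual ℝ (TangentSpace 𝓘(ℝ, Eucl n) q) :=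
    { toFun := fun u ↦ (g.inner q u).toLinearMap
      map_add' := by intro u w; ext a; simp
      map_smul' := by intro c u; ext a; simp }
  have hinj : Function.Injective f := by
    rw [injective_iff_map_eq_zero]
    intro u hu
    by_contra hne
    have h1 : f u u = 0 := by rw [hu]; rfl
    exact (g.pos q u hne).ne' h1
  have hsurj : Function.Surjective f :=
    (LinearMap.injective_iff_surjective_of_finrank_eq_finrank
      (Subspace.dual_finrank_eq).symm).1 hinj
  obtain ⟨u, hu⟩ := hsurj p.toLinearMap
  refine ⟨u, ?_⟩
  ext w
  exact LinearMap.congr_fun hu w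

/-- The vector `p^♯` with `g(p^♯, ·) = p`. -/
def sharp (g : RMetric n L) (q : L) (p : TangentSpace 𝓘(ℝ, Eucl n) q →L[ℝ] ℝ) :
    TangentSpace 𝓘(ℝ, Eucl n) q := (exists_sharp g q p).choose

/-- The norm `|p|_g` of a cotangent vector `(q, p)`. -/
def covNorm (g : RMetric n L) (ξ : Cotangent n L) : ℝ := √(ξ.2 (sharp g ξ.1 ξ.2))

/-- The Christoffel symbols of the first kind of `g` at `q`, in the preferred chart at `q`:
`g(∇_u w, a)` for the constant coordinate fields `u`, `w`, `a` and the Levi-Civita connection. -/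
def christoffel (g : RMetric n L) (q : L) (u w a : Eucl n) : ℝ :=
  let D := fderiv ℝ (bilinInChart g.inner q) (chartAt (Eucl n) q q)
  (1 / 2) * (D u w a + D w u a - D a u w)

/-- `ι : L → M` is a smooth Lagrangian embedding, where `dim M = 2 dim L`. -/
structure IsLagrangianEmbedding {M : Type*} [TopologicalSpace M] [ChartedSpace (Eucl (2 * n)) M]
    [IsManifold 𝓘(ℝ, Eucl (2 * n)) ∞ M] (Ω : SymplecticForm (2 * n) M) (ι : L → M) : Prop where
  embedding : IsSmoothEmbedding 𝓘(ℝ, Eucl n) 𝓘(ℝ, Eucl (2 * n)) ∞ ι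
  isotropic : ∀ q u w, Ω.form (ι q)
    (mfderiv 𝓘(ℝ, Eucl n) 𝓘(ℝ, Eucl (2 * n)) ι q u)
    (mfderiv 𝓘(ℝ, Eucl n) 𝓘(ℝ, Eucl (2 * n)) ι q w) = 0

variable {m : ℕ} {M : Type*} [TopologicalSpace M] [ChartedSpace (Eucl m) M]

/-! ### Darboux neighbourhoods

Below, `ψ` is an open partial homeomorphism from `M` to `T^*L`, written `ψ x = (q(x), p(x))`. -/

/-- The differential of `x ↦ q(x)` at `x`. -/
def dq (ψ : OpenPartialHomeomorph M (Cotangent n L)) (x : M) :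
    TangentSpace 𝓘(ℝ, Eucl m) x →L[ℝ] TangentSpace 𝓘(ℝ, Eucl n) (ψ x).1 :=
  mfderiv 𝓘(ℝ, Eucl m) 𝓘(ℝ, Eucl n) (fun y ↦ (ψ y).1) x

/-- The Liouville form `Θ_x = p(x) ∘ dq_x`, that is `p dq`. -/
def liouville (ψ : OpenPartialHomeomorph M (Cotangent n L)) (x : M) :
    TangentSpace 𝓘(ℝ, Eucl m) x →L[ℝ] ℝ :=
  (ψ x).2.comp (dq ψ x)

/-- The fibre coordinate `y ↦ p(y)`, expressed in the preferred chart of `L` at `q₀`. -/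
def fibreCoord (ψ : OpenPartialHomeomorph M (Cotangent n L)) (q₀ : L) (y : M) : Eucl n →L[ℝ] ℝ :=
  let p : Eucl n →L[ℝ] ℝ := (ψ y).2
  p.comp (chartSymmDeriv q₀ (chartAt (Eucl n) q₀ (ψ y).1))

/-- The differential of the fibre coordinate at `x`, in the preferred chart of `L` at `q(x)`. -/
def dFibre (ψ : OpenPartialHomeomorph M (Cotangent n L)) (x : M) :
    TangentSpace 𝓘(ℝ, Eucl m) x →L[ℝ] (Eucl n →L[ℝ] ℝ) :=
  mfderiv 𝓘(ℝ, Eucl m) 𝓘(ℝ, Eucl n →L[ℝ] ℝ) (fibreCoord ψ (ψ x).1) x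

/-- The connection map `T_x M → T^*_{q(x)} L` (the vertical part of a tangent vector with respect
to the Levi-Civita connection of `g`), evaluated at `w ∈ T_{q(x)} L`. In the preferred chart
of `L` at `q(x)` it is `(q̇, ṗ) ↦ ṗ_j - Γ^k_{ij} p_k q̇^i`. -/
def connectionMap (ψ : OpenPartialHomeomorph M (Cotangent n L)) (g : RMetric n L) (x : M)
    (a : TangentSpace 𝓘(ℝ, Eucl m) x) (w : TangentSpace 𝓘(ℝ, Eucl n) (ψ x).1) : ℝ :=
  dFibre ψ x a w - christoffel g (ψ x).1 (dq ψ x a) w (sharp g (ψ x).1 (ψ x).2)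

variable [IsManifold 𝓘(ℝ, Eucl m) ∞ M]

/-- `U = ψ.source` is a Darboux neighbourhood of `ι(L)`: `ψ` is a diffeomorphism of `U` onto
an open subset of `T^*L` which maps `ι(L)` to the zero section, and `Ω = -dΘ` on `U`. -/
structure IsDarbouxChart (Ω : SymplecticForm m M) (ι : L → M)
    (ψ : OpenPartialHomeomorph M (Cotangent n L)) : Prop where
  range_subset : range ι ⊆ ψ.source
  zero_section : ∀ q, ψ (ι q) = ⟨q, 0⟩
  smooth : ContMDiffOn 𝓘(ℝ, Eucl m) (𝓘(ℝ, Eucl n).prod 𝓘(ℝ, Eucl n →L[ℝ] ℝ)) ∞ ψ ψ.source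
  smooth_symm :
    ContMDiffOn (𝓘(ℝ, Eucl n).prod 𝓘(ℝ, Eucl n →L[ℝ] ℝ)) 𝓘(ℝ, Eucl m) ∞ ψ.symm ψ.target
  symplectic : ∀ x ∈ ψ.source, ∀ u w, Ω.form x u w = -dOneForm (liouville ψ) x u w

/-- `V ⊆ closure V ⊆ U = ψ.source`, where `V` is an open neighbourhood of `ι(L)` with compact
closure. -/
structure IsInnerNbhd (ι : L → M) (ψ : OpenPartialHomeomorph M (Cotangent n L)) (V : Set M) :
    Prop where
  isOpen : IsOpen V
  range_subset : range ι ⊆ V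
  isCompact_closure : IsCompact (closure V)
  closure_subset : closure V ⊆ ψ.source

/-- `J` coincides on `V` with the canonical (Sasakian) almost complex structure `J_g` of `T^*L`:
`J_g` maps the horizontal lift of `u ∈ T_q L` to the vertical lift of `g(u, ·)`, and the vertical
lift of `g(u, ·)` to minus the horizontal lift of `u`. Since `J² = -1`, this says that the vertical
part of `J a` is `g(dq a, ·)` for every tangent vector `a`. -/
def IsSasakianOn {Ω : SymplecticForm m M} (J : CompatibleACS Ω)
    (ψ : OpenPartialHomeomorph M (Cotangent n L)) (g : RMetric n L) (V : Set M) : Prop :=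
  ∀ x ∈ V, ∀ (a : TangentSpace 𝓘(ℝ, Eucl m) x) (w : TangentSpace 𝓘(ℝ, Eucl n) (ψ x).1),
    connectionMap ψ g x (J.J x a) w = g.inner (ψ x).1 (dq ψ x a) w

/-- The size `d(V, Θ) = min_{x ∈ ∂V} |p(x)|` of the Darboux neighbourhood `V`; it is the largest
`r` such that `V` contains the disc bundle `{|p| < r}`. For `V = {|p| < r}` it is the supremum
of `|p|` over `V`. -/
def size (ψ : OpenPartialHomeomorph M (Cotangent n L)) (g : RMetric n L) (V : Set M) : ℝ≥0∞ :=
  ⨅ x ∈ frontier V, ENNReal.ofReal (covNorm g (ψ x))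

end Cotangent

end HandleSliding

end

/-!
Let `f = ½ |p|²` be the kinetic energy on the Darboux neighbourhood (`fibreEnergy`). For the
Sasakian almost complex structure `df ∘ J = Θ` (`IsSasakianOn.dFibreEnergy_J`) and `|df| ≤ |p|`
(`IsSasakianOn.dFibreEnergy_sq_le`). Everything rests on two consequences.

*Distances.* As `|p|` is 1-Lipschitz along paths in `V`, every point whose distance to `L` is less
than `d(V, Θ)` lies in `V` and satisfies `|p| ≤ d(·, L)` (`IsSasakianOn.mem_and_covNorm_le`).
Conversely, the radial path in the fibre has length `|p|`, so that `d(·, L) ≤ |p|` if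
`|p| < d(V, Θ)` (`IsSasakianOn.distTo_le_covNorm`). Hence the estimate to be shown for `d(·, L)` is
one for `f`. The Hamiltonian family enters only here: a point of `φ^1_{H(s)}(L)` is at distance
at most `d̄(φ^1_{H(s)}, id)` from `L`, and `f` vanishes on the other boundary line of the strip.

*Subharmonicity.* As `ω = -dΘ`, the Laplacian of `f ∘ v` is the energy density of `v`, for a
holomorphic strip `v` in `V` (`IsMovingStrip.lap_fibreEnergy`).

If `v` stays in `V`, the maximum principle bounds `f ∘ v` by its boundary values
(`IsMovingStrip.fibreEnergy_le`). The strip is not compact; no asymptotics of `v` are used. Instead,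
for `k` above the boundary values, `Δ(f ∘ v)` is integrated against `max(0, f ∘ v - k)²` and a
cutoff in `τ`, whose contribution vanishes in the limit because the energy is finite
(`setIntegral_nonpos_of_le_lap`). So the energy density is zero where `f ∘ v > k`, and the vertical
segments, which end on `L`, cannot reach this set.

If `v` leaves `V`, a vertical segment crosses a compact shell `{s₁ ≤ |p| ≤ s₂}` of `V`, where
`δ < s₁ < s₂ < d(V, Θ)`, and `v` has nonzero derivative at some point over the shell
(`IsMovingStrip.exists_mem_shell`). The boundary of `v` stays in `{|p| ≤ δ}`, away from the shell,
and the monotonicity formula for holomorphic curves bounds the area of `v` from below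
(`energy_lower_bound`, `holomorphic_energy_lower_bound`, `exists_local_area_bound`). The constant is
uniform over the shell by compactness (`exists_area_bound`).
-/

open Set MeasureTheory Manifold Bundle
open scoped ContDiff ENNReal NNReal

noncomputable section

namespace HandleSliding

open Filter Topology

section Plane

variable {E : Type*} [NormedAddCommGroup E] [NormedSpace ℝ E]

/-- The partial derivative of `h` in the first variable `τ`. -/
def dx (h : ℝ × ℝ → E) (z : ℝ × ℝ) : E := fderiv ℝ h z (1, 0)

/-- The partial derivative of `h` in the second variable `t`. -/
def dy (h : ℝ × ℝ → E) (z : ℝ × ℝ) : E := fderiv ℝ h z (0, 1)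

/-- The Laplacian `∂²h/∂τ² + ∂²h/∂t²`. -/
def lap (h : ℝ × ℝ → E) (z : ℝ × ℝ) : E := dx (dx h) z + dy (dy h) z

/-- The `C¹` function `x ↦ max(0, x)²`, from which all cutoff functions are built. -/
def posSq (x : ℝ) : ℝ := max 0 x ^ 2

theorem posSq_nonneg (x : ℝ) : 0 ≤ posSq x := sq_nonneg _

theorem posSq_of_nonpos {x : ℝ} (hx : x ≤ 0) : posSq x = 0 := by simp [posSq, hx]

theorem posSq_of_nonneg {x : ℝ} (hx : 0 ≤ x) : posSq x = x ^ 2 := by simp [posSq, hx]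

theorem posSq_pos {x : ℝ} (hx : 0 < x) : 0 < posSq x := by
  rw [posSq_of_nonneg hx.le]; positivity

theorem posSq_mono : Monotone posSq := fun _ _ h ↦
  pow_le_pow_left₀ (le_max_left _ _) (max_le_max le_rfl h) 2

theorem posSq_le_one {x : ℝ} (hx : x ≤ 1) : posSq x ≤ 1 :=
  (posSq_mono hx).trans (by simp [posSq])

theorem hasDerivAt_posSq (x : ℝ) : HasDerivAt posSq (2 * max 0 x) x := by
  rcases lt_trichotomy x 0 with hx | rfl | hx
  · rw [max_eq_left hx.le, mul_zero]
    refine (hasDerivAt_const x (0 : ℝ)).congr_of_eventuallyEq ?_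
    filter_upwards [Iio_mem_nhds hx] with y hy using posSq_of_nonpos (le_of_lt hy)
  · simp only [max_self, mul_zero]
    rw [hasDerivAt_iff_isLittleO]
    simp only [sub_zero, posSq_of_nonpos le_rfl, smul_zero]
    refine Asymptotics.IsBigO.trans_isLittleO (g := fun x : ℝ ↦ x ^ 2) ?_ ?_
    · refine Asymptotics.IsBigO.of_bound 1 (Eventually.of_forall fun y ↦ ?_)
      rw [one_mul, Real.norm_of_nonneg (posSq_nonneg _), Real.norm_of_nonneg (sq_nonneg _)]
      rcases le_total y 0 with h | h
      · rw [posSq_of_nonpos h]; positivity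
      · rw [posSq_of_nonneg h]
    · exact Asymptotics.isLittleO_pow_id one_lt_two
  · rw [max_eq_right hx.le]
    have := (hasDerivAt_pow 2 x)
    simp only [Nat.cast_ofNat, Nat.add_one_sub_one, pow_one] at this
    refine this.congr_of_eventuallyEq ?_
    filter_upwards [Ioi_mem_nhds hx] with y hy using posSq_of_nonneg (le_of_lt hy)

theorem contDiff_of_hasDerivAt {Φ Φ' : ℝ → ℝ} (h : ∀ x, HasDerivAt Φ (Φ' x) x)
    (hc : Continuous Φ') : ContDiff ℝ 1 Φ := by
  rw [contDiff_one_iff_deriv]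
  refine ⟨fun x ↦ (h x).differentiableAt, ?_⟩
  convert hc using 1
  exact funext fun x ↦ (h x).deriv

theorem continuous_two_mul_max : Continuous fun x : ℝ ↦ 2 * max 0 x := by fun_prop

theorem contDiff_posSq : ContDiff ℝ 1 posSq :=
  contDiff_of_hasDerivAt hasDerivAt_posSq continuous_two_mul_max

/-- The integral over the plane of the divergence of a compactly supported field vanishes. -/
theorem integral_div_eq_zero {X Y : ℝ × ℝ → ℝ} (hX : ContDiff ℝ 1 X) (hY : ContDiff ℝ 1 Y)
    (sX : HasCompactSupport X) (sY : HasCompactSupport Y) :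
    Integrable (fun z ↦ dx X z + dy Y z) ∧ ∫ z, (dx X z + dy Y z) = 0 := by
  have key : ∀ (G : ℝ × ℝ → ℝ) (v : ℝ × ℝ), ContDiff ℝ 1 G → HasCompactSupport G →
      Integrable (fun z ↦ fderiv ℝ G z v) ∧ ∫ z, fderiv ℝ G z v = 0 := by
    intro G v hG sG
    have c1 : Continuous fun z ↦ fderiv ℝ G z v :=
      (hG.continuous_fderiv one_ne_zero).clm_apply continuous_const
    have i1 : Integrable (fun z ↦ fderiv ℝ G z v) :=
      c1.integrable_of_hasCompactSupport (sG.fderiv_apply ℝ v)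
    refine ⟨i1, ?_⟩
    have := integral_mul_fderiv_eq_neg_fderiv_mul_of_integrable (μ := (volume : Measure (ℝ × ℝ)))
      (f := fun _ ↦ (1 : ℝ)) (g := G) (v := v) (by simp) (by simpa using i1)
      (by simpa using hG.continuous.integrable_of_hasCompactSupport sG)
      (fun x _ ↦ differentiableAt_const _) (fun x _ ↦ (hG.differentiable one_ne_zero) x)
    simpa using this
  obtain ⟨i1, e1⟩ := key X (1, 0) hX sX
  obtain ⟨i2, e2⟩ := key Y (0, 1) hY sY
  refine ⟨i1.add i2, ?_⟩
  simp only [dx, dy]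
  rw [integral_add i1 i2, e1, e2, add_zero]

theorem contDiffOn_fderiv_apply {O : Set (ℝ × ℝ)} (hO : IsOpen O) {h : ℝ × ℝ → E}
    (hh : ContDiffOn ℝ 2 h O) (v : ℝ × ℝ) : ContDiffOn ℝ 1 (fun z ↦ fderiv ℝ h z v) O :=
  (hh.fderiv_of_isOpen hO (by norm_num)).clm_apply contDiffOn_const

/-- Green's identity for `η(τ) Φ(h) ∇h`, where `Φ(h)` vanishes off the closed set `Z ⊆ O`. -/
theorem integral_cutoff_lap {O Z : Set (ℝ × ℝ)} (hO : IsOpen O) (hZ : IsClosed Z) (hZO : Z ⊆ O)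
    (hZs : ∀ z ∈ Z, z.2 ∈ Icc (0 : ℝ) 1) {h : ℝ × ℝ → ℝ} (hh : ContDiffOn ℝ 2 h O)
    {Φ Φ' η η' : ℝ → ℝ} (hΦ : ∀ x, HasDerivAt Φ (Φ' x) x) (cΦ : Continuous Φ')
    (hη : ∀ x, HasDerivAt η (η' x) x) (cη : Continuous η') (R : ℝ)
    (sη : ∀ x, x ∉ Icc (-R) R → η x = 0)
    (z0 : ∀ z ∈ O, z ∉ Z → Φ (h z) = 0) :
    IntegrableOn (fun z ↦ η z.1 * (Φ (h z) * lap h z + Φ' (h z) * (dx h z ^ 2 + dy h z ^ 2))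
        + η' z.1 * (Φ (h z) * dx h z)) O ∧
    ∫ z in O, (η z.1 * (Φ (h z) * lap h z + Φ' (h z) * (dx h z ^ 2 + dy h z ^ 2))
        + η' z.1 * (Φ (h z) * dx h z)) = 0 := by
  classical
  have hΦc := contDiff_of_hasDerivAt hΦ cΦ
  have hηc := contDiff_of_hasDerivAt hη cη
  let X : (ℝ × ℝ) → ℝ × ℝ → ℝ := fun v ↦ O.indicator fun z ↦ η z.1 * (Φ (h z) * fderiv ℝ h z v)
  have hX0 : ∀ v z, z ∉ Z → X v z = 0 := by
    intro v z hz
    by_cases hzO : z ∈ O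
    · simp [X, hzO, z0 z hzO hz]
    · simp [X, hzO]
  have hXO : ∀ v z, z ∈ O → X v =ᶠ[𝓝 z] fun z ↦ η z.1 * (Φ (h z) * fderiv ℝ h z v) := by
    intro v z hz
    filter_upwards [hO.mem_nhds hz] with y hy
    simp [X, hy]
  have hXc : ∀ v, ContDiff ℝ 1 (X v) := by
    intro v
    rw [contDiff_iff_contDiffAt]
    intro z
    by_cases hz : z ∈ O
    · refine ContDiffAt.congr_of_eventuallyEq ?_ (hXO v z hz)
      have hhz : ContDiffAt ℝ 1 h z := (hh.contDiffAt (hO.mem_nhds hz)).of_le (by norm_num)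
      exact ((hηc.contDiffAt (x := z.1)).comp z contDiffAt_fst).mul
        (((hΦc.contDiffAt (x := h z)).comp z hhz).mul
        ((contDiffOn_fderiv_apply hO hh v).contDiffAt (hO.mem_nhds hz)))
    · have : X v =ᶠ[𝓝 z] fun _ ↦ 0 := by
        filter_upwards [hZ.isOpen_compl.mem_nhds (fun h' ↦ hz (hZO h'))] with y hy using hX0 v y hy
      exact contDiffAt_const.congr_of_eventuallyEq this
  have hXs : ∀ v, HasCompactSupport (X v) := by
    intro v
    refine HasCompactSupport.intro (K := Icc (-R) R ×ˢ Icc 0 1 ∩ Z)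
      ((isCompact_Icc.prod isCompact_Icc).inter_right hZ) fun z hz ↦ ?_
    by_cases hzZ : z ∈ Z
    · have : z.1 ∉ Icc (-R) R := fun h' ↦ hz ⟨⟨h', hZs z hzZ⟩, hzZ⟩
      by_cases hzO : z ∈ O <;> simp [X, hzO, sη _ this]
    · exact hX0 v z hzZ
  have hd : ∀ v z, z ∈ O → fderiv ℝ (X v) z v =
      η z.1 * (Φ (h z) * fderiv ℝ (fun z ↦ fderiv ℝ h z v) z v
        + Φ' (h z) * (fderiv ℝ h z v) ^ 2) + η' z.1 * v.1 * (Φ (h z) * fderiv ℝ h z v) := by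
    intro v z hz
    rw [(hXO v z hz).fderiv_eq]
    have hhz : HasFDerivAt h (fderiv ℝ h z) z :=
      ((hh.contDiffAt (hO.mem_nhds hz)).differentiableAt (by norm_num)).hasFDerivAt
    have h2 : HasFDerivAt (fun z ↦ fderiv ℝ h z v) (fderiv ℝ (fun z ↦ fderiv ℝ h z v) z) z :=
      (((contDiffOn_fderiv_apply hO hh v).contDiffAt (hO.mem_nhds hz)).differentiableAt
        (by norm_num)).hasFDerivAt
    have h3 : HasFDerivAt (fun z : ℝ × ℝ ↦ η z.1) (η' z.1 • ContinuousLinearMap.fst ℝ ℝ ℝ) z :=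
      (hη z.1).comp_hasFDerivAt z hasFDerivAt_fst
    have h4 : HasFDerivAt (fun z : ℝ × ℝ ↦ Φ (h z)) (Φ' (h z) • fderiv ℝ h z) z :=
      (hΦ (h z)).comp_hasFDerivAt z hhz
    have := (h3.mul (h4.mul h2)).fderiv
    erw [this]
    simp
    ring
  obtain ⟨i, e⟩ := integral_div_eq_zero (hXc (1, 0)) (hXc (0, 1)) (hXs (1, 0)) (hXs (0, 1))
  have heq : ∀ z ∈ O, dx (X (1, 0)) z + dy (X (0, 1)) z =
      η z.1 * (Φ (h z) * lap h z + Φ' (h z) * (dx h z ^ 2 + dy h z ^ 2))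
        + η' z.1 * (Φ (h z) * dx h z) := by
    intro z hz
    have e1 := hd (1, 0) z hz
    have e2 := hd (0, 1) z hz
    change fderiv ℝ (X (1, 0)) z (1, 0) + fderiv ℝ (X (0, 1)) z (0, 1) = _
    rw [e1, e2]
    change _ = η z.1 * (Φ (h z) * (fderiv ℝ (fun z ↦ fderiv ℝ h z (1, 0)) z (1, 0) +
      fderiv ℝ (fun z ↦ fderiv ℝ h z (0, 1)) z (0, 1)) + Φ' (h z) *
      (fderiv ℝ h z (1, 0) ^ 2 + fderiv ℝ h z (0, 1) ^ 2)) + η' z.1 * (Φ (h z) * fderiv ℝ h z (1, 0))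
    ring
  have hzero : ∀ z, z ∉ O → dx (X (1, 0)) z + dy (X (0, 1)) z = 0 := by
    intro z hz
    have : ∀ v, X v =ᶠ[𝓝 z] fun _ ↦ 0 := by
      intro v
      filter_upwards [hZ.isOpen_compl.mem_nhds (fun h' ↦ hz (hZO h'))] with y hy using hX0 v y hy
    simp [dx, dy, (this (1, 0)).fderiv_eq, (this (0, 1)).fderiv_eq]
  refine ⟨i.integrableOn.congr_fun heq hO.measurableSet, ?_⟩
  rw [← setIntegral_congr_fun hO.measurableSet heq, setIntegral_eq_integral_of_forall_compl_eq_zero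
    (fun z hz ↦ hzero z hz), e]

/-- A `C¹` cutoff function with support `[-R, R]`. -/
def cutoff (R x : ℝ) : ℝ := posSq (1 - (x / R) ^ 2)

theorem hasDerivAt_cutoff (R x : ℝ) : HasDerivAt (cutoff R)
    (2 * max 0 (1 - (x / R) ^ 2) * (-(2 * (x / R) / R))) x := by
  have h1 : HasDerivAt (fun x : ℝ ↦ 1 - (x / R) ^ 2) (-(2 * (x / R) / R)) x := by
    refine ((((hasDerivAt_id' x).div_const R).fun_pow 2).const_sub 1).congr_deriv ?_
    simp only [Nat.cast_ofNat, Nat.add_one_sub_one, pow_one]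
    ring
  exact (hasDerivAt_posSq _).comp x h1

theorem cutoff_nonneg (R x : ℝ) : 0 ≤ cutoff R x := posSq_nonneg _

theorem cutoff_le_one (R x : ℝ) : cutoff R x ≤ 1 := posSq_le_one (by nlinarith [sq_nonneg (x / R)])

theorem one_sub_div_sq_nonpos {R x : ℝ} (hR : 0 < R) (hx : x ∉ Icc (-R) R) :
    1 - (x / R) ^ 2 ≤ 0 := by
  have : R < |x| := by
    by_contra! h
    exact hx (abs_le.1 h)
  rw [div_pow, sub_nonpos, one_le_div (by positivity), ← sq_abs x]
  exact pow_le_pow_left₀ hR.le this.le 2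

theorem abs_deriv_cutoff_le {R : ℝ} (hR : 0 < R) (x : ℝ) :
    |2 * max 0 (1 - (x / R) ^ 2) * (-(2 * (x / R) / R))| ≤
      4 / R * (Icc (-R) R).indicator 1 x := by
  by_cases hx : x ∈ Icc (-R) R
  · rw [indicator_of_mem hx, Pi.one_apply, mul_one, abs_mul, abs_mul, abs_neg, abs_two,
      abs_of_nonneg (le_max_left 0 (1 - (x / R) ^ 2))]
    have h0 : |2 * (x / R) / R| = 2 * |x / R| / R := by
      rw [abs_div, abs_mul, abs_of_pos hR, abs_two]
    rw [h0]
    have h1 : |x / R| ≤ 1 := by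
      rw [abs_div, abs_of_pos hR, div_le_one hR]; exact abs_le.2 hx
    have h2 : max 0 (1 - (x / R) ^ 2) ≤ 1 := max_le zero_le_one (by nlinarith [sq_nonneg (x / R)])
    have h3 : 2 * |x / R| / R ≤ 2 / R := by gcongr; linarith
    calc 2 * max 0 (1 - (x / R) ^ 2) * (2 * |x / R| / R) ≤ 2 * 1 * (2 / R) := by gcongr
      _ = 4 / R := by ring
  · rw [indicator_of_notMem hx, max_eq_left (one_sub_div_sq_nonpos hR hx)]
    simp

theorem volume_box (R : ℝ) :
    volume (Icc (-R) R ×ˢ Icc (0 : ℝ) 1 : Set (ℝ × ℝ)) = ENNReal.ofReal (2 * R) := by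
  rw [Measure.volume_eq_prod, Measure.prod_prod]
  simp [two_mul]

/-- Integrating `Φ(h) Δh + Φ'(h) |∇h|² = div (Φ(h) ∇h)` over a strip. There is no boundary term at
the sides of the strip, because `Φ(h)` vanishes off `Z`; and there is none at infinity, because
`|∇h|²` is dominated by an integrable function. -/
theorem setIntegral_nonpos_of_le_lap {O Z : Set (ℝ × ℝ)} (hO : IsOpen O) (hZ : IsClosed Z)
    (hZO : Z ⊆ O) (hOs : O ⊆ strip) {h e q : ℝ × ℝ → ℝ} (hh : ContDiffOn ℝ 2 h O)
    {Φ Φ' : ℝ → ℝ} (hΦ : ∀ x, HasDerivAt Φ (Φ' x) x) (cΦ : Continuous Φ')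
    (z0 : ∀ z ∈ O, z ∉ Z → Φ (h z) = 0) {m B : ℝ} (hm : ∀ z ∈ O, |Φ (h z)| ≤ m)
    (hB : 0 ≤ B) (he : IntegrableOn e O) (he0 : ∀ z ∈ O, 0 ≤ e z) (hq : IntegrableOn q O)
    (hgrad : ∀ z ∈ O, Φ (h z) ≠ 0 → dx h z ^ 2 ≤ B * e z)
    (hle : ∀ z ∈ O, q z ≤ Φ (h z) * lap h z + Φ' (h z) * (dx h z ^ 2 + dy h z ^ 2)) :
    ∫ z in O, q z ≤ 0 := by
  have m0 : 0 ≤ m ∨ O = ∅ := by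
    rcases O.eq_empty_or_nonempty with h' | ⟨z, hz⟩
    · exact Or.inr h'
    · exact Or.inl ((abs_nonneg _).trans (hm z hz))
  rcases m0 with m0 | rfl
  swap
  · simp
  -- The cutoff has radius `R = N²` and derivative `O(1 / R)` on a set of area `2 R`. With
  -- `2 |∂h/∂τ| ≤ N |∂h/∂τ|² + 1 / N` its contribution is `O(N / R) + O(1 / N) = O(1 / N)`.
  have step : ∀ N : ℕ, 0 < N →
      ∫ z in O, cutoff ((N : ℝ) ^ 2) z.1 * q z ≤ 2 * m * (B * ∫ z in O, e z) / N + 4 * m / N := by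
    intro N hN
    have hN' : (0 : ℝ) < N := by exact_mod_cast hN
    set R : ℝ := (N : ℝ) ^ 2 with hR
    have hR0 : 0 < R := by positivity
    obtain ⟨i, e1⟩ := integral_cutoff_lap hO hZ hZO (fun z hz ↦ (hOs (hZO hz)).2) hh hΦ cΦ
      (hasDerivAt_cutoff R) (by fun_prop) R
      (fun x hx ↦ posSq_of_nonpos (one_sub_div_sq_nonpos hR0 hx)) z0
    set S : Set (ℝ × ℝ) := Icc (-R) R ×ˢ Icc (0 : ℝ) 1 with hS
    have hSm : MeasurableSet S := measurableSet_Icc.prod measurableSet_Icc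
    have hSv : volume S = ENNReal.ofReal (2 * R) := volume_box R
    have iS : Integrable (S.indicator fun _ ↦ (1 : ℝ)) := by
      rw [integrable_indicator_iff hSm]
      exact integrableOn_const (by rw [hSv]; exact ENNReal.ofReal_ne_top)
    have iS' : ∫ z in O, S.indicator (fun _ ↦ (1 : ℝ)) z ≤ 2 * R := by
      calc _ ≤ ∫ z, S.indicator (fun _ ↦ (1 : ℝ)) z :=
            setIntegral_le_integral iS (Eventually.of_forall fun z ↦
              indicator_nonneg (fun _ _ ↦ zero_le_one) z)
        _ = 2 * R := by
            rw [integral_indicator hSm]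
            simp [Measure.real, hSv, hR0.le]
    have hbound : ∀ z ∈ O, cutoff R z.1 * q z ≤
        (cutoff R z.1 * (Φ (h z) * lap h z + Φ' (h z) * (dx h z ^ 2 + dy h z ^ 2))
          + 2 * max 0 (1 - (z.1 / R) ^ 2) * (-(2 * (z.1 / R) / R)) * (Φ (h z) * dx h z))
        + 2 * m / R * (N * B * e z + 1 / N * S.indicator (fun _ ↦ (1 : ℝ)) z) := by
      intro z hz
      have h1 := mul_le_mul_of_nonneg_left (hle z hz) (cutoff_nonneg R z.1)
      suffices |2 * max 0 (1 - (z.1 / R) ^ 2) * (-(2 * (z.1 / R) / R)) * (Φ (h z) * dx h z)| ≤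
          2 * m / R * (N * B * e z + 1 / N * S.indicator (fun _ ↦ (1 : ℝ)) z) by
        linarith [neg_abs_le
          (2 * max 0 (1 - (z.1 / R) ^ 2) * (-(2 * (z.1 / R) / R)) * (Φ (h z) * dx h z))]
      have hpos : 0 ≤ 2 * m / R * (N * B * e z + 1 / N * S.indicator (fun _ ↦ (1 : ℝ)) z) := by
        have := he0 z hz
        have : 0 ≤ S.indicator (fun _ ↦ (1 : ℝ)) z := indicator_nonneg (fun _ _ ↦ zero_le_one) z
        positivity
      by_cases hΦz : Φ (h z) = 0
      · rw [hΦz]; simpa using hpos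
      · have hSz : (Icc (-R) R).indicator (1 : ℝ → ℝ) z.1 = S.indicator (fun _ ↦ (1 : ℝ)) z := by
          have h2 := (hOs hz).2
          by_cases hz1 : z.1 ∈ Icc (-R) R
          · rw [indicator_of_mem hz1, indicator_of_mem (show z ∈ S from ⟨hz1, h2⟩)]; rfl
          · rw [indicator_of_notMem hz1, indicator_of_notMem (fun h' : z ∈ S ↦ hz1 h'.1)]
        have h3 := abs_deriv_cutoff_le hR0 z.1
        rw [hSz] at h3
        have h4 : |dx h z| * S.indicator (fun _ ↦ (1 : ℝ)) z ≤
            (N * B * e z + 1 / N * S.indicator (fun _ ↦ (1 : ℝ)) z) / 2 := by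
          have h5 := hgrad z hz hΦz
          rw [← sq_abs] at h5
          have h6 : 2 * |dx h z| ≤ N * |dx h z| ^ 2 + 1 / N := by
            have : 0 ≤ N * (|dx h z| - 1 / N) ^ 2 := by positivity
            have h7 : N * (|dx h z| - 1 / N) ^ 2 = N * |dx h z| ^ 2 - 2 * |dx h z| + 1 / N := by
              field_simp
              ring
            linarith
          have h8 := mul_le_mul_of_nonneg_left h5 hN'.le
          have h9 := he0 z hz
          by_cases hzS : z ∈ S
          · rw [indicator_of_mem hzS]; linarith
          · rw [indicator_of_notMem hzS, mul_zero, mul_zero, add_zero]; positivity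
        rw [abs_mul, abs_mul (Φ (h z))]
        calc _ ≤ (4 / R * S.indicator (fun _ ↦ (1 : ℝ)) z) * (m * |dx h z|) := by
              refine mul_le_mul h3 ?_ (by positivity) ((abs_nonneg _).trans h3)
              gcongr
              exact hm z hz
          _ = 4 / R * m * (|dx h z| * S.indicator (fun _ ↦ (1 : ℝ)) z) := by ring
          _ ≤ 4 / R * m * ((N * B * e z + 1 / N * S.indicator (fun _ ↦ (1 : ℝ)) z) / 2) := by
              gcongr
          _ = _ := by ring
    have iη : IntegrableOn (fun z ↦ cutoff R z.1 * q z) O := by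
      refine hq.bdd_mul (c := 1) ?_ (Eventually.of_forall fun z ↦ ?_)
      · have : Continuous (cutoff R) := contDiff_posSq.continuous.comp (by fun_prop)
        exact (this.comp continuous_fst).aestronglyMeasurable
      · rw [Real.norm_of_nonneg (cutoff_nonneg _ _)]; exact cutoff_le_one _ _
    have iS0 : IntegrableOn (fun z ↦ (N * B * e z + 1 / N * S.indicator (fun _ ↦ (1 : ℝ)) z)) O :=
      (he.const_mul _).add (iS.integrableOn.const_mul _)
    have iE : IntegrableOn (fun z ↦
        2 * m / R * (N * B * e z + 1 / N * S.indicator (fun _ ↦ (1 : ℝ)) z)) O := iS0.const_mul _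
    refine (setIntegral_mono_on iη (i.add iE) hO.measurableSet hbound).trans ?_
    refine (integral_add i iE).le.trans ?_
    calc _ = 2 * m / R * (N * B * (∫ z in O, e z) +
            1 / N * ∫ z in O, S.indicator (fun _ ↦ (1 : ℝ)) z) := by
          rw [e1, zero_add, integral_const_mul,
            integral_add (he.const_mul _) (iS.integrableOn.const_mul _), integral_const_mul,
            integral_const_mul]
      _ ≤ 2 * m / R * (N * B * (∫ z in O, e z) + 1 / N * (2 * R)) := by gcongr
      _ = _ := by rw [hR]; field_simp; ring
  have hlim : Tendsto (fun N : ℕ ↦ ∫ z in O, cutoff ((N : ℝ) ^ 2) z.1 * q z) atTop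
      (𝓝 (∫ z in O, q z)) := by
    refine tendsto_integral_of_dominated_convergence (fun z ↦ |q z|) (fun N ↦ ?_) hq.abs
      (fun N ↦ Eventually.of_forall fun z ↦ ?_) (Eventually.of_forall fun z ↦ ?_)
    · have : Continuous (cutoff ((N : ℝ) ^ 2)) := contDiff_posSq.continuous.comp (by fun_prop)
      exact (this.comp continuous_fst).aestronglyMeasurable.mul hq.aestronglyMeasurable
    · rw [norm_mul, Real.norm_of_nonneg (cutoff_nonneg _ _), Real.norm_eq_abs]
      exact mul_le_of_le_one_left (abs_nonneg _) (cutoff_le_one _ _)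
    · have h1 : Tendsto (fun N : ℕ ↦ (1 - (z.1 / (N : ℝ) ^ 2) ^ 2)) atTop (𝓝 (1 - 0 ^ 2)) := by
        refine tendsto_const_nhds.sub (Tendsto.pow ?_ 2)
        refine tendsto_const_nhds.div_atTop ?_
        exact (tendsto_pow_atTop two_ne_zero).comp tendsto_natCast_atTop_atTop
      have h2 := (contDiff_posSq.continuous.tendsto _).comp h1
      have h3 : posSq (1 - 0 ^ 2) = 1 := by norm_num [posSq]
      rw [h3] at h2
      simpa [Function.comp_def, cutoff] using h2.mul_const (q z)
  have hlim2 : Tendsto (fun N : ℕ ↦ 2 * m * (B * ∫ z in O, e z) / N + 4 * m / N) atTop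
      (𝓝 (0 + 0)) :=
    (tendsto_const_nhds.div_atTop tendsto_natCast_atTop_atTop).add
      (tendsto_const_nhds.div_atTop tendsto_natCast_atTop_atTop)
  rw [add_zero] at hlim2
  refine le_of_tendsto_of_tendsto hlim hlim2 ?_
  filter_upwards [eventually_gt_atTop 0] with N hN using step N hN

end Plane

/-! ### The monotonicity formula -/

section Monotonicity

/-- The derivative in `r` of the cut-off energy `∫ max(0, 1 - F / r²)² e`. -/
theorem hasDerivAt_cutoff_energy {O : Set (ℝ × ℝ)} (hO : IsOpen O) {F e : ℝ × ℝ → ℝ}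
    (hF : ContinuousOn F O) (hF0 : ∀ z ∈ O, 0 ≤ F z) (he : IntegrableOn e O)
    {r : ℝ} (hr : 0 < r) :
    IntegrableOn (fun z ↦ posSq (1 - F z / r ^ 2) * e z) O ∧
    IntegrableOn (fun z ↦ 2 * max 0 (1 - F z / r ^ 2) * (2 * F z / r ^ 3) * e z) O ∧
    HasDerivAt (fun s ↦ ∫ z in O, posSq (1 - F z / s ^ 2) * e z)
      (∫ z in O, 2 * max 0 (1 - F z / r ^ 2) * (2 * F z / r ^ 3) * e z) r := by
  have hmeas : ∀ s : ℝ, AEStronglyMeasurable (fun z ↦ posSq (1 - F z / s ^ 2) * e z)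
      (volume.restrict O) := fun s ↦ by
    refine AEStronglyMeasurable.mul ?_ he.aestronglyMeasurable
    exact (contDiff_posSq.continuous.comp_continuousOn
      (continuousOn_const.sub (hF.div_const _))).aestronglyMeasurable hO.measurableSet
  have hint : ∀ s : ℝ, IntegrableOn (fun z ↦ posSq (1 - F z / s ^ 2) * e z) O := fun s ↦ by
    refine he.norm.mono' (hmeas s) ?_
    filter_upwards [ae_restrict_mem hO.measurableSet] with z hz
    rw [norm_mul, Real.norm_of_nonneg (posSq_nonneg _)]
    refine mul_le_of_le_one_left (norm_nonneg _) (posSq_le_one ?_)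
    have := hF0 z hz
    have : 0 ≤ F z / s ^ 2 := by positivity
    linarith
  have key := hasDerivAt_integral_of_dominated_loc_of_deriv_le (μ := volume.restrict O)
    (F := fun s z ↦ posSq (1 - F z / s ^ 2) * e z)
    (F' := fun s z ↦ 2 * max 0 (1 - F z / s ^ 2) * (2 * F z / s ^ 3) * e z)
    (bound := fun z ↦ 8 / r * ‖e z‖)
    (x₀ := r) (s := Ioi (r / 2)) (Ioi_mem_nhds (by linarith))
    (Eventually.of_forall hmeas) (hint r) ?_ ?_ (he.norm.const_mul _) ?_
  · exact ⟨hint r, key.1, key.2⟩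
  · refine AEStronglyMeasurable.mul ?_ he.aestronglyMeasurable
    refine ContinuousOn.aestronglyMeasurable ?_ hO.measurableSet
    fun_prop
  · filter_upwards [ae_restrict_mem hO.measurableSet] with z hz s hs
    have hs0 : 0 < s := by have : r / 2 < s := hs; linarith
    have hFz := hF0 z hz
    rw [norm_mul]
    refine mul_le_mul_of_nonneg_right ?_ (norm_nonneg _)
    rw [Real.norm_of_nonneg (by positivity)]
    rcases le_total (1 - F z / s ^ 2) 0 with h | h
    · rw [max_eq_left h]; simp; positivity
    · rw [max_eq_right h]
      have h1 : F z / s ^ 2 ≤ 1 := by linarith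
      have h2 : 2 * F z / s ^ 3 = 2 / s * (F z / s ^ 2) := by field_simp
      have h3 : 2 / s ≤ 4 / r := by
        rw [div_le_div_iff₀ hs0 hr]; have : r / 2 < s := hs; linarith
      have h4 : 0 ≤ F z / s ^ 2 := by positivity
      rw [h2]
      calc 2 * (1 - F z / s ^ 2) * (2 / s * (F z / s ^ 2)) ≤ 2 * 1 * (4 / r * 1) := by
            gcongr; linarith
        _ = 8 / r := by ring
  · filter_upwards with z s hs
    have hs0 : s ≠ 0 := by have : r / 2 < s := hs; exact (by linarith : (0 : ℝ) < s).ne'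
    have h1 : HasDerivAt (fun s : ℝ ↦ 1 - F z / s ^ 2) (2 * F z / s ^ 3) s := by
      refine (((hasDerivAt_const s (F z)).fun_div (hasDerivAt_pow 2 s)
        (pow_ne_zero 2 hs0)).const_sub 1).congr_deriv ?_
      simp only [Nat.cast_ofNat, Nat.add_one_sub_one, pow_one]
      field_simp
      ring
    exact ((hasDerivAt_posSq _).comp s h1).mul_const (e z)

/-- An energy density `e` has energy at least a multiple of `r₁²` on `{F < r₁²}`, if `F` behaves
like the squared distance to a point along a holomorphic curve through this point: up to relative
errors `O(√F)`, `ΔF = 4e` and `|∇F|² = 4Fe`. Testing with `max(0, 1 - F / r²)²` shows that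
`r⁻² e^{4Kr} ∫ max(0, 1 - F / r²)² e` is nondecreasing in `r`. -/
theorem energy_lower_bound {O Z : Set (ℝ × ℝ)} (hO : IsOpen O) (hZ : IsClosed Z)
    (hZO : Z ⊆ O) (hOs : O ⊆ strip) {F e : ℝ × ℝ → ℝ} (hF : ContDiffOn ℝ 2 F O)
    (hF0 : ∀ z ∈ O, 0 ≤ F z) (he : IntegrableOn e O) (he0 : ∀ z ∈ O, 0 ≤ e z)
    {K r₁ : ℝ} (hK : 0 ≤ K) (hr₁ : 0 < r₁) (hFZ : ∀ z ∈ O, F z < r₁ ^ 2 → z ∈ Z)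
    (hlap : ∀ z ∈ O, F z < r₁ ^ 2 → 4 * (1 - K * √(F z)) * e z ≤ lap F z)
    (hgrad : ∀ z ∈ O, F z < r₁ ^ 2 →
      dx F z ^ 2 + dy F z ^ 2 ≤ 4 * F z * e z * (1 + K * √(F z)))
    {z₀ : ℝ × ℝ} (hz₀ : z₀ ∈ O) (ez₀ : 0 < e z₀) (ce : ContinuousAt e z₀)
    {A : ℝ} (hA : 0 < A) (hstart : ∀ᶠ z in 𝓝 z₀, F z ≤ A * e z₀ * ‖z - z₀‖ ^ 2) :
    Real.exp (-(4 * K * r₁)) * r₁ ^ 2 / (4 * A) ≤ ∫ z in O, e z := by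
  set a : ℝ → ℝ := fun s ↦ ∫ z in O, posSq (1 - F z / s ^ 2) * e z with ha
  set a' : ℝ → ℝ := fun r ↦ ∫ z in O, 2 * max 0 (1 - F z / r ^ 2) * (2 * F z / r ^ 3) * e z
    with ha'
  have hcF := hF.continuousOn
  have hd : ∀ r, 0 < r → HasDerivAt a (a' r) r := fun r hr ↦
    (hasDerivAt_cutoff_energy hO hcF hF0 he hr).2.2
  have apos : ∀ r, 0 ≤ a r := fun r ↦ setIntegral_nonneg hO.measurableSet fun z hz ↦
    mul_nonneg (posSq_nonneg _) (he0 z hz)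
  -- the differential inequality `a' ≥ (2 / r - 4 K) a`, from `∫ Φ(F) ΔF + Φ'(F) |∇F|² = 0` for
  -- `Φ(x) = max(0, 1 - x / r²)²`
  have hode : ∀ r, 0 < r → r ≤ r₁ → 2 / r * a r - 4 * K * a r ≤ a' r := by
    intro r hr hrr
    obtain ⟨i1, i2, -⟩ := hasDerivAt_cutoff_energy hO hcF hF0 he hr
    have hlt : ∀ z ∈ O, F z < r ^ 2 → F z < r₁ ^ 2 ∧ √(F z) ≤ r := fun z hz h ↦
      ⟨h.trans_le (pow_le_pow_left₀ hr.le hrr 2), by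
        rw [Real.sqrt_le_left hr.le]; exact h.le⟩
    have hΦ : ∀ x, HasDerivAt (fun x ↦ posSq (1 - x / r ^ 2))
        (2 * max 0 (1 - x / r ^ 2) * (-(1 / r ^ 2))) x := fun x ↦
      (hasDerivAt_posSq _).comp x (((hasDerivAt_id' x).div_const (r ^ 2)).const_sub 1)
    have hge : ∀ x, r ^ 2 ≤ x → 1 - x / r ^ 2 ≤ 0 := fun x hx ↦ by
      rw [sub_nonpos, one_le_div (by positivity)]; exact hx
    have iq : IntegrableOn (fun z ↦ 4 * (1 - K * r) * (posSq (1 - F z / r ^ 2) * e z) -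
        2 * r * (1 + K * r) * (2 * max 0 (1 - F z / r ^ 2) * (2 * F z / r ^ 3) * e z)) O :=
      (i1.const_mul _).sub (i2.const_mul _)
    have := setIntegral_nonpos_of_le_lap hO hZ hZO hOs (h := F) (e := e)
      (q := fun z ↦ 4 * (1 - K * r) * (posSq (1 - F z / r ^ 2) * e z) -
        2 * r * (1 + K * r) * (2 * max 0 (1 - F z / r ^ 2) * (2 * F z / r ^ 3) * e z))
      hF hΦ (by fun_prop) ?_ (m := 1) (B := 4 * r ^ 2 * (1 + K * r)) ?_ (by positivity) he he0
      iq ?_ ?_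
    · rw [integral_sub (i1.const_mul _) (i2.const_mul _), integral_const_mul,
        integral_const_mul] at this
      change 4 * (1 - K * r) * a r - 2 * r * (1 + K * r) * a' r ≤ 0 at this
      have h1 : 4 * (1 + K * r) * (1 - 2 * (K * r)) * a r ≤ 4 * (1 - K * r) * a r := by
        refine mul_le_mul_of_nonneg_right ?_ (apos r)
        nlinarith [sq_nonneg (K * r)]
      have h2 : 0 < 1 + K * r := by positivity
      have h3 : (1 + K * r) * (2 * (1 - 2 * (K * r)) * a r) ≤ (1 + K * r) * (r * a' r) := by
        linarith
      have h4 := le_of_mul_le_mul_left h3 h2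
      have h5 : 2 / r * a r - 4 * K * a r = 2 * (1 - 2 * (K * r)) * a r / r := by
        field_simp
        ring
      rw [h5, div_le_iff₀ hr]
      linarith
    · intro z hz hzZ
      refine posSq_of_nonpos (hge _ ?_)
      by_contra! h
      exact hzZ (hFZ z hz (hlt z hz h).1)
    · intro z hz
      rw [abs_of_nonneg (posSq_nonneg _)]
      refine posSq_le_one ?_
      have := hF0 z hz
      have : 0 ≤ F z / r ^ 2 := by positivity
      linarith
    · intro z hz hne
      have h : F z < r ^ 2 := by
        by_contra! h
        exact hne (posSq_of_nonpos (hge _ h))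
      obtain ⟨h1, h2⟩ := hlt z hz h
      have h3 := hgrad z hz h1
      have h4 := he0 z hz
      have h5 := hF0 z hz
      calc dx F z ^ 2 ≤ 4 * F z * e z * (1 + K * √(F z)) := by nlinarith [sq_nonneg (dy F z)]
        _ ≤ 4 * r ^ 2 * e z * (1 + K * r) := by gcongr
        _ = _ := by ring
    · intro z hz
      have h4 := he0 z hz
      have h5 := hF0 z hz
      rcases le_or_gt (r ^ 2) (F z) with h | h
      · simp [max_eq_left (hge _ h), posSq_of_nonpos (hge _ h)]
      · obtain ⟨h1, h2⟩ := hlt z hz h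
        have h3 : 4 * (1 - K * r) * e z ≤ lap F z := by
          refine le_trans ?_ (hlap z hz h1)
          gcongr
        have h6 : dx F z ^ 2 + dy F z ^ 2 ≤ 4 * F z * e z * (1 + K * r) := by
          refine (hgrad z hz h1).trans ?_
          gcongr
        have h7 := mul_le_mul_of_nonneg_left h3 (posSq_nonneg (1 - F z / r ^ 2))
        have h8 : 0 ≤ 2 * max 0 (1 - F z / r ^ 2) * (1 / r ^ 2) := by positivity
        have h9 := mul_le_mul_of_nonneg_left h6 h8
        have h10 : 2 * r * (1 + K * r) * (2 * max 0 (1 - F z / r ^ 2) * (2 * F z / r ^ 3) * e z) =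
            2 * max 0 (1 - F z / r ^ 2) * (1 / r ^ 2) * (4 * F z * e z * (1 + K * r)) := by
          field_simp
          ring
        rw [h10]
        linarith
  -- the monotone quantity
  have hmono : MonotoneOn (fun r ↦ a r / r ^ 2 * Real.exp (4 * K * r)) (Ioc 0 r₁) := by
    have hder : ∀ r, 0 < r → HasDerivAt (fun r ↦ a r / r ^ 2 * Real.exp (4 * K * r))
        ((a' r - (2 / r * a r - 4 * K * a r)) / r ^ 2 * Real.exp (4 * K * r)) r := by
      intro r hr
      have h1 := (hd r hr).fun_div (hasDerivAt_pow 2 r) (pow_ne_zero 2 hr.ne')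
      have h2 : HasDerivAt (fun r ↦ Real.exp (4 * K * r)) (Real.exp (4 * K * r) * (4 * K)) r := by
        have := ((hasDerivAt_id' r).const_mul (4 * K)).exp
        simpa using this
      refine (h1.mul h2).congr_deriv ?_
      simp only [Nat.cast_ofNat, Nat.add_one_sub_one, pow_one]
      field_simp
      ring
    refine monotoneOn_of_deriv_nonneg (convex_Ioc _ _) (fun r hr ↦
      (hder r hr.1).continuousAt.continuousWithinAt) (fun r hr ↦ ?_) fun r hr ↦ ?_
    · rw [interior_Ioc] at hr
      exact (hder r hr.1).differentiableAt.differentiableWithinAt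
    · rw [interior_Ioc] at hr
      rw [(hder r hr.1).deriv]
      have := hode r hr.1 hr.2.le
      have h0 : 0 ≤ a' r - (2 / r * a r - 4 * K * a r) := by linarith
      positivity
  -- For small `r`, `a(r)` is at least `e(z₀) / 8` times the area of a square of side `2 k` around
  -- `z₀`; by `hstart`, `F ≤ r² / 2` on this square if `r² = 2 A e(z₀) k²`.
  obtain ⟨r, hr, hrr, hlow⟩ : ∃ r, 0 < r ∧ r ≤ r₁ ∧ 1 / (4 * A) ≤ a r / r ^ 2 := by
    have h1 : ∀ᶠ z in 𝓝 z₀, z ∈ O ∧ F z ≤ A * e z₀ * ‖z - z₀‖ ^ 2 ∧ e z₀ / 2 < e z :=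
      (show ∀ᶠ z in 𝓝 z₀, z ∈ O from hO.mem_nhds hz₀).and (hstart.and
        (ce.eventually (lt_mem_nhds (by linarith))))
    obtain ⟨ε, hε, hball⟩ := Metric.eventually_nhds_iff_ball.1 h1
    set s : ℝ := √(2 * A * e z₀) with hs
    have hs0 : 0 < s := by positivity
    have hs2 : s ^ 2 = 2 * A * e z₀ := Real.sq_sqrt (by positivity)
    set k : ℝ := min (ε / 2) (r₁ / s) with hk
    have hk0 : 0 < k := by positivity
    have hkε : k < ε := (min_le_left _ _).trans_lt (by linarith)
    refine ⟨s * k, by positivity, ?_, ?_⟩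
    · rw [mul_comm, ← le_div_iff₀ hs0]
      exact min_le_right _ _
    set Q : Set (ℝ × ℝ) := Icc (z₀.1 - k) (z₀.1 + k) ×ˢ Icc (z₀.2 - k) (z₀.2 + k) with hQ
    have hQn : ∀ z ∈ Q, ‖z - z₀‖ ≤ k := by
      rintro z ⟨h1, h2⟩
      rw [Prod.norm_def, max_le_iff, Real.norm_eq_abs, Real.norm_eq_abs, abs_le, abs_le]
      refine ⟨⟨?_, ?_⟩, ?_, ?_⟩ <;> simp only [Prod.fst_sub, Prod.snd_sub] <;>
        linarith [h1.1, h1.2, h2.1, h2.2]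
    have hQb : ∀ z ∈ Q, z ∈ Metric.ball z₀ ε := fun z hz ↦ by
      rw [mem_ball_iff_norm]; exact (hQn z hz).trans_lt hkε
    have hQO : Q ⊆ O := fun z hz ↦ (hball z (hQb z hz)).1
    have hQm : MeasurableSet Q := measurableSet_Icc.prod measurableSet_Icc
    have hQv : volume Q = ENNReal.ofReal (2 * k) * ENNReal.ofReal (2 * k) := by
      rw [hQ, Measure.volume_eq_prod, Measure.prod_prod, Real.volume_Icc, Real.volume_Icc]
      congr 2 <;> ring
    have hQr : volume.real Q = 4 * k ^ 2 := by
      rw [Measure.real, hQv, ENNReal.toReal_mul, ENNReal.toReal_ofReal (by positivity)]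
      ring
    have hi := (hasDerivAt_cutoff_energy hO hcF hF0 he (r := s * k) (by positivity)).1
    have h2 : ∀ z ∈ Q, e z₀ / 8 ≤ posSq (1 - F z / (s * k) ^ 2) * e z := by
      intro z hz
      obtain ⟨-, h3, h4⟩ := hball z (hQb z hz)
      have h5 : F z / (s * k) ^ 2 ≤ 1 / 2 := by
        rw [div_le_iff₀ (by positivity), mul_pow, hs2]
        have : ‖z - z₀‖ ^ 2 ≤ k ^ 2 := pow_le_pow_left₀ (norm_nonneg _) (hQn z hz) 2
        calc F z ≤ A * e z₀ * ‖z - z₀‖ ^ 2 := h3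
          _ ≤ A * e z₀ * k ^ 2 := by gcongr
          _ = _ := by ring
      have h6 : 1 / 4 ≤ posSq (1 - F z / (s * k) ^ 2) := by
        refine le_trans ?_ (posSq_mono (show (1 / 2 : ℝ) ≤ _ by linarith))
        rw [posSq_of_nonneg (by norm_num)]; norm_num
      calc e z₀ / 8 = 1 / 4 * (e z₀ / 2) := by ring
        _ ≤ _ := by gcongr
    have hQt : volume Q ≠ ⊤ := by
      rw [hQv]
      exact ENNReal.mul_ne_top ENNReal.ofReal_ne_top ENNReal.ofReal_ne_top
    have h3 := setIntegral_ge_of_const_le_real hQm hQt h2 (hi.mono_set hQO)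
    have h4 : ∫ z in Q, posSq (1 - F z / (s * k) ^ 2) * e z ≤ a (s * k) := by
      refine setIntegral_mono_set hi ?_ hQO.eventuallyLE
      filter_upwards [ae_restrict_mem hO.measurableSet] with z hz using
        mul_nonneg (posSq_nonneg _) (he0 z hz)
    rw [hQr] at h3
    rw [le_div_iff₀ (by positivity), mul_pow, hs2]
    refine le_trans (le_of_eq ?_) (h3.trans h4)
    field_simp
    ring
  have h1 := hmono ⟨hr, hrr⟩ ⟨hr₁, le_rfl⟩ hrr
  have h2 : 1 / (4 * A) ≤ a r₁ / r₁ ^ 2 * Real.exp (4 * K * r₁) := by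
    refine (hlow.trans ?_).trans h1
    refine le_mul_of_one_le_right (div_nonneg (apos r) (by positivity)) ?_
    exact Real.one_le_exp (by positivity)
  have h3 : a r₁ ≤ ∫ z in O, e z := by
    refine setIntegral_mono_on (hasDerivAt_cutoff_energy hO hcF hF0 he hr₁).1 he
      hO.measurableSet fun z hz ↦ mul_le_of_le_one_left (he0 z hz) (posSq_le_one ?_)
    have := hF0 z hz
    have : 0 ≤ F z / r₁ ^ 2 := by positivity
    linarith
  refine le_trans ?_ h3
  rw [Real.exp_neg]
  have h5 := Real.exp_pos (4 * K * r₁)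
  calc (Real.exp (4 * K * r₁))⁻¹ * r₁ ^ 2 / (4 * A)
      = 1 / (4 * A) * (r₁ ^ 2 * (Real.exp (4 * K * r₁))⁻¹) := by ring
    _ ≤ a r₁ / r₁ ^ 2 * Real.exp (4 * K * r₁) * (r₁ ^ 2 * (Real.exp (4 * K * r₁))⁻¹) := by gcongr
    _ = a r₁ := by field_simp

end Monotonicity

/-! ### Monotonicity for holomorphic maps into a vector space -/

section Holomorphic

variable {E : Type*} [NormedAddCommGroup E] [NormedSpace ℝ E]

theorem hasFDerivAt_fderiv_apply {O : Set (ℝ × ℝ)} (hO : IsOpen O) {w : ℝ × ℝ → E}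
    (hw : ContDiffOn ℝ 2 w O) {z : ℝ × ℝ} (hz : z ∈ O) (v : ℝ × ℝ) :
    HasFDerivAt (fun z ↦ fderiv ℝ w z v) (fderiv ℝ (fun z ↦ fderiv ℝ w z v) z) z :=
  (((contDiffOn_fderiv_apply hO hw v).contDiffAt (hO.mem_nhds hz)).differentiableAt
    one_ne_zero).hasFDerivAt

/-- The mixed partial derivatives of a `C²` map agree. -/
theorem dx_dy_comm {O : Set (ℝ × ℝ)} (hO : IsOpen O) {w : ℝ × ℝ → E}
    (hw : ContDiffOn ℝ 2 w O) {z : ℝ × ℝ} (hz : z ∈ O) : dx (dy w) z = dy (dx w) z := by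
  have hwz := hw.contDiffAt (hO.mem_nhds hz)
  have hs : IsSymmSndFDerivAt ℝ w z := hwz.isSymmSndFDerivAt (by simp)
  have hd : DifferentiableAt ℝ (fderiv ℝ w) z :=
    (hwz.fderiv_right (m := 1) (by norm_num)).differentiableAt one_ne_zero
  have key : ∀ u v : ℝ × ℝ, fderiv ℝ (fun z ↦ fderiv ℝ w z v) z u =
      fderiv ℝ (fderiv ℝ w) z u v := by
    intro u v
    rw [fderiv_clm_apply hd (differentiableAt_const v)]
    simp
  change fderiv ℝ (fun z ↦ fderiv ℝ w z (0, 1)) z (1, 0) =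
    fderiv ℝ (fun z ↦ fderiv ℝ w z (1, 0)) z (0, 1)
  rw [key, key, hs]

/-- The Laplacian of a holomorphic map is quadratic in its first derivatives. -/
theorem lap_of_holomorphic {O : Set (ℝ × ℝ)} (hO : IsOpen O) {w : ℝ × ℝ → E}
    (hw : ContDiffOn ℝ 2 w O) {J : E → E →L[ℝ] E} (hJ : ∀ z ∈ O, DifferentiableAt ℝ J (w z))
    (h1 : ∀ z ∈ O, dy w z = J (w z) (dx w z)) (h2 : ∀ z ∈ O, dx w z = -J (w z) (dy w z))
    {z : ℝ × ℝ} (hz : z ∈ O) :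
    lap w z = fderiv ℝ J (w z) (dy w z) (dx w z) - fderiv ℝ J (w z) (dx w z) (dy w z) := by
  have hwz : HasFDerivAt w (fderiv ℝ w z) z :=
    ((hw.contDiffAt (hO.mem_nhds hz)).differentiableAt two_ne_zero).hasFDerivAt
  have hJw : HasFDerivAt (fun z ↦ J (w z)) ((fderiv ℝ J (w z)).comp (fderiv ℝ w z)) z :=
    (hJ z hz).hasFDerivAt.comp z hwz
  have e1 : dy (dy w) z = fderiv ℝ J (w z) (dy w z) (dx w z) + J (w z) (dy (dx w) z) := by
    have h3 : dy w =ᶠ[𝓝 z] fun z ↦ J (w z) (dx w z) := by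
      filter_upwards [hO.mem_nhds hz] with y hy using h1 y hy
    have h4 : HasFDerivAt (fun z ↦ J (w z) (dx w z)) _ z :=
      hJw.clm_apply (hasFDerivAt_fderiv_apply hO hw hz (1, 0))
    change fderiv ℝ (dy w) z (0, 1) = _
    rw [h3.fderiv_eq, h4.fderiv, add_comm]
    rfl
  have e2 : dx (dx w) z = -(fderiv ℝ J (w z) (dx w z) (dy w z) + J (w z) (dx (dy w) z)) := by
    have h3 : dx w =ᶠ[𝓝 z] fun z ↦ -J (w z) (dy w z) := by
      filter_upwards [hO.mem_nhds hz] with y hy using h2 y hy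
    have h4 : HasFDerivAt (fun z ↦ -J (w z) (dy w z)) _ z :=
      (hJw.clm_apply (hasFDerivAt_fderiv_apply hO hw hz (0, 1))).fun_neg
    change fderiv ℝ (dx w) z (1, 0) = _
    rw [h3.fderiv_eq, h4.fderiv, add_comm]
    rfl
  rw [lap, e1, e2, dx_dy_comm hO hw hz]
  abel

/-- First and second derivatives of the squared distance to `x` along `w`. -/
theorem sq_dist_derivs {O : Set (ℝ × ℝ)} (hO : IsOpen O) {w : ℝ × ℝ → E}
    (hw : ContDiffOn ℝ 2 w O) (b : E →L[ℝ] E →L[ℝ] ℝ) (hb : ∀ u v, b u v = b v u) (x : E)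
    {z : ℝ × ℝ} (hz : z ∈ O) :
    dx (fun z ↦ b (w z - x) (w z - x)) z = 2 * b (w z - x) (dx w z) ∧
    dy (fun z ↦ b (w z - x) (w z - x)) z = 2 * b (w z - x) (dy w z) ∧
    lap (fun z ↦ b (w z - x) (w z - x)) z =
      2 * b (dx w z) (dx w z) + 2 * b (dy w z) (dy w z) + 2 * b (w z - x) (lap w z) := by
  have hwx : ∀ y ∈ O, HasFDerivAt (fun z ↦ w z - x) (fderiv ℝ w y) y := fun y hy ↦
    (((hw.contDiffAt (hO.mem_nhds hy)).differentiableAt two_ne_zero).hasFDerivAt).sub_const x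
  have h1 : ∀ y ∈ O, ∀ v, fderiv ℝ (fun z ↦ b (w z - x) (w z - x)) y v =
      2 * b (w y - x) (fderiv ℝ w y v) := by
    intro y hy v
    have := ((b.hasFDerivAt.comp y (hwx y hy)).clm_apply (hwx y hy)).fderiv
    simp only [Function.comp_def] at this
    rw [this]
    have h3 := hb (fderiv ℝ w y v) (w y - x)
    simp only [add_apply, ContinuousLinearMap.comp_apply, ContinuousLinearMap.flip_apply, h3]
    ring
  have h2 : ∀ v, fderiv ℝ (fun y ↦ fderiv ℝ (fun z ↦ b (w z - x) (w z - x)) y v) z v =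
      2 * b (fderiv ℝ w z v) (fderiv ℝ w z v) +
        2 * b (w z - x) (fderiv ℝ (fun y ↦ fderiv ℝ w y v) z v) := by
    intro v
    have h3 : (fun y ↦ fderiv ℝ (fun z ↦ b (w z - x) (w z - x)) y v) =ᶠ[𝓝 z]
        fun y ↦ 2 * b (w y - x) (fderiv ℝ w y v) := by
      filter_upwards [hO.mem_nhds hz] with y hy using h1 y hy v
    rw [h3.fderiv_eq]
    have := (((b.hasFDerivAt.comp z (hwx z hz)).clm_apply
      (hasFDerivAt_fderiv_apply hO hw hz v)).const_mul 2).fderiv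
    simp only [Function.comp_def] at this
    rw [this]
    simp
    ring
  refine ⟨h1 z hz _, h1 z hz _, ?_⟩
  change fderiv ℝ (fun y ↦ fderiv ℝ (fun z ↦ b (w z - x) (w z - x)) y (1, 0)) z (1, 0) +
    fderiv ℝ (fun y ↦ fderiv ℝ (fun z ↦ b (w z - x) (w z - x)) y (0, 1)) z (0, 1) = _
  rw [h2, h2]
  change _ = 2 * b (fderiv ℝ w z (1, 0)) (fderiv ℝ w z (1, 0)) +
    2 * b (fderiv ℝ w z (0, 1)) (fderiv ℝ w z (0, 1)) +
    2 * b (w z - x) (fderiv ℝ (fun y ↦ fderiv ℝ w y (1, 0)) z (1, 0) +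
      fderiv ℝ (fun y ↦ fderiv ℝ w y (0, 1)) z (0, 1))
  rw [map_add]
  ring

variable {b : E →L[ℝ] E →L[ℝ] ℝ}

theorem abs_bilin_le (hb : ∀ u v, b u v = b v u) (hpos : ∀ u, 0 ≤ b u u) (u v : E) :
    |b u v| ≤ √(b u u) * √(b v v) := by
  have hB := LinearMap.BilinForm.apply_sq_le_of_symm
    (LinearMap.mk₂ ℝ (fun u v ↦ b u v) (by simp) (by simp) (by simp) (by simp)) (by simpa using hpos)
    ⟨fun u v ↦ by simpa using hb u v⟩ u v
  simp only [LinearMap.mk₂_apply] at hB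
  rw [← Real.sqrt_mul (hpos u), ← Real.sqrt_sq_eq_abs]
  exact Real.sqrt_le_sqrt hB

/-- Bessel's inequality for the orthogonal vectors `u` and `u'` of equal length. -/
theorem bessel_pair (hb : ∀ u v, b u v = b v u) (hpos : ∀ u, 0 ≤ b u u) {u u' : E}
    (h1 : b u' u' = b u u) (h0 : b u u' = 0) (y : E) :
    b y u ^ 2 + b y u' ^ 2 ≤ b y y * b u u := by
  set α := b y u
  set β := b y u'
  have hB := abs_bilin_le hb hpos y (α • u + β • u')
  have e1 : b y (α • u + β • u') = α ^ 2 + β ^ 2 := by simp [α, β]; ring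
  have e2 : b (α • u + β • u') (α • u + β • u') = (α ^ 2 + β ^ 2) * b u u := by
    simp [h0, hb u' u, h1]; ring
  rw [e1, e2, ← Real.sqrt_mul (hpos y), abs_of_nonneg (by positivity)] at hB
  have h3 : (α ^ 2 + β ^ 2) ^ 2 ≤ b y y * ((α ^ 2 + β ^ 2) * b u u) := by
    have := pow_le_pow_left₀ (by positivity) hB 2
    rwa [Real.sq_sqrt (mul_nonneg (hpos y) (mul_nonneg (by positivity) (hpos u)))] at this
  rcases (by positivity : 0 ≤ α ^ 2 + β ^ 2).eq_or_lt with h | h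
  · rw [← h]; exact mul_nonneg (hpos y) (hpos u)
  · refine le_of_mul_le_mul_left ?_ h
    linarith

/-- Monotonicity: a holomorphic map `w` which passes through `x` with nonzero derivative, and whose
boundary is outside the ball of radius `R / 2` around `x`, has energy at least `C`. The energy is
measured with a constant Hermitian metric `b` for the complex structure at `x`, and `C` depends
only on the bounds for `b` and for `J`. -/
theorem holomorphic_energy_lower_bound {c lam K R : ℝ} (hc : 0 < c) (hlam : 0 < lam) (hK : 0 < K)
    (hR : 0 < R) :
    ∃ C : ℝ, 0 < C ∧ ∀ (b : E →L[ℝ] E →L[ℝ] ℝ) (J : E → E →L[ℝ] E) (x : E)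
      (O : Set (ℝ × ℝ)) (w : ℝ × ℝ → E) (z₀ : ℝ × ℝ),
      (∀ u v, b u v = b v u) → (∀ u, c * ‖u‖ ^ 2 ≤ b u u) → (∀ u, b u u ≤ lam * ‖u‖ ^ 2) →
      (∀ y ∈ Metric.ball x R, DifferentiableAt ℝ J y) →
      (∀ y ∈ Metric.ball x R, ‖fderiv ℝ J y‖ ≤ K) → (∀ y ∈ Metric.ball x R, ‖J y‖ ≤ K) →
      (∀ y ∈ Metric.ball x R, ∀ u, J y (J y u) = -u) →
      (∀ u, b (J x u) (J x u) = b u u) → (∀ u, b u (J x u) = 0) →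
      IsOpen O → O ⊆ strip → ContDiffOn ℝ 2 w O → (∀ z ∈ O, w z ∈ Metric.ball x R) →
      (∀ z ∈ O, dx w z + J (w z) (dy w z) = 0) →
      IsClosed {z | z ∈ O ∧ w z ∈ Metric.closedBall x (R / 2)} →
      IntegrableOn (fun z ↦ b (dx w z) (dx w z)) O →
      z₀ ∈ O → w z₀ = x → dx w z₀ ≠ 0 → C ≤ ∫ z in O, b (dx w z) (dx w z) := by
  -- In terms of `F = b(w - x, w - x)` and `e = b(∂w/∂τ, ∂w/∂τ)`: `K₁ √F` bounds the relative
  -- deviation of `J` from `J x`, and `K₂ √F e` bounds `b(w - x, Δw)`. `F < r₁²` forces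
  -- `|w - x| < R / 2`, and `A` bounds `F / (e(z₀) |z - z₀|²)` near `z₀`.
  set K₁ : ℝ := √lam * K / c with hK₁
  set K₂ : ℝ := √lam * (2 * K ^ 2 / c) with hK₂
  set K₃ : ℝ := 2 * K₁ + K₁ ^ 2 + K₂ with hK₃
  set r₁ : ℝ := min 1 (√c * (R / 2)) with hr₁
  set A : ℝ := lam * (2 + K) ^ 2 / c with hA
  have hr₁0 : 0 < r₁ := by positivity
  refine ⟨Real.exp (-(4 * K₃ * r₁)) * r₁ ^ 2 / (4 * A), by positivity, ?_⟩
  intro b J x O w z₀ hb hcb hlb hJd hJ' hJn hJ2 hJb hJ0 hO hOs hw hwB hCR hZ hint hz₀ hwz₀ hdz₀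
  have hpos : ∀ u, 0 ≤ b u u := fun u ↦ le_trans (by positivity) (hcb u)
  have hx : x ∈ Metric.ball x R := Metric.mem_ball_self hR
  have h2 : ∀ z ∈ O, dx w z = -J (w z) (dy w z) := fun z hz ↦ eq_neg_of_add_eq_zero_left (hCR z hz)
  have h1 : ∀ z ∈ O, dy w z = J (w z) (dx w z) := fun z hz ↦ by
    rw [h2 z hz, map_neg, hJ2 _ (hwB z hz), neg_neg]
  have nlow : ∀ u, ‖u‖ ≤ √(b u u) / √c := fun u ↦ by
    rw [le_div_iff₀ (by positivity), ← Real.sqrt_sq (norm_nonneg u), ← Real.sqrt_mul (sq_nonneg _)]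
    exact Real.sqrt_le_sqrt (by linarith [hcb u])
  have nup : ∀ u, √(b u u) ≤ √lam * ‖u‖ := fun u ↦ by
    rw [← Real.sqrt_sq (norm_nonneg u), ← Real.sqrt_mul hlam.le]
    exact Real.sqrt_le_sqrt (hlb u)
  have hCS := abs_bilin_le hb hpos
  have hsq : ∀ u, √(b u u) ^ 2 = b u u := fun u ↦ Real.sq_sqrt (hpos u)
  have hcc : √c * √c = c := Real.mul_self_sqrt hc.le
  -- the deviation of `J (w z)` from `J x`
  have hdev : ∀ z ∈ O, √(b (dy w z - J x (dx w z)) (dy w z - J x (dx w z))) ≤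
      K₁ * √(b (w z - x) (w z - x)) * √(b (dx w z) (dx w z)) := by
    intro z hz
    have hL : ‖J (w z) - J x‖ ≤ K * ‖w z - x‖ :=
      (convex_ball x R).norm_image_sub_le_of_norm_fderiv_le hJd hJ' hx (hwB z hz)
    have h3 : ‖dy w z - J x (dx w z)‖ ≤ K * ‖w z - x‖ * ‖dx w z‖ := by
      rw [h1 z hz, ← sub_apply]
      exact ((J (w z) - J x).le_opNorm _).trans (by gcongr)
    calc _ ≤ √lam * (K * ‖w z - x‖ * ‖dx w z‖) := (nup _).trans (by gcongr)
      _ ≤ √lam * (K * (√(b (w z - x) (w z - x)) / √c) * (√(b (dx w z) (dx w z)) / √c)) := by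
          gcongr
          · exact nlow _
          · exact nlow _
      _ = √lam * K * √(b (w z - x) (w z - x)) * √(b (dx w z) (dx w z)) / (√c * √c) := by
          field_simp
      _ = _ := by
          rw [hcc, hK₁]
          ring
  have hlapw : ∀ z ∈ O, |b (w z - x) (lap w z)| ≤
      K₂ * √(b (w z - x) (w z - x)) * b (dx w z) (dx w z) := by
    intro z hz
    have hy := hwB z hz
    have h3 : ‖dy w z‖ ≤ K * ‖dx w z‖ := by
      rw [h1 z hz]
      exact ((J (w z)).le_opNorm _).trans (by gcongr; exact hJn _ hy)
    have h4 : ∀ u v, ‖fderiv ℝ J (w z) u v‖ ≤ K * ‖u‖ * ‖v‖ := fun u v ↦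
      ((fderiv ℝ J (w z)).le_opNorm₂ u v).trans (by gcongr; exact hJ' _ hy)
    have h5 : ‖lap w z‖ ≤ 2 * K ^ 2 * ‖dx w z‖ ^ 2 := by
      rw [lap_of_holomorphic hO hw (fun z hz ↦ hJd _ (hwB z hz)) h1 h2 hz]
      calc _ ≤ K * ‖dy w z‖ * ‖dx w z‖ + K * ‖dx w z‖ * ‖dy w z‖ :=
            (norm_sub_le _ _).trans (add_le_add (h4 _ _) (h4 _ _))
        _ = 2 * K * ‖dx w z‖ * ‖dy w z‖ := by ring
        _ ≤ 2 * K * ‖dx w z‖ * (K * ‖dx w z‖) := by gcongr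
        _ = _ := by ring
    have h6 : ‖dx w z‖ ^ 2 ≤ b (dx w z) (dx w z) / c := by
      rw [le_div_iff₀ hc]; linarith [hcb (dx w z)]
    calc _ ≤ √(b (w z - x) (w z - x)) * √(b (lap w z) (lap w z)) := hCS _ _
      _ ≤ √(b (w z - x) (w z - x)) * (√lam * (2 * K ^ 2 * (b (dx w z) (dx w z) / c))) := by
          gcongr
          refine (nup _).trans ?_
          gcongr
          exact h5.trans (by gcongr)
      _ = _ := by rw [hK₂]; ring
  have hsmall : ∀ z ∈ O, b (w z - x) (w z - x) < r₁ ^ 2 → √(b (w z - x) (w z - x)) < r₁ :=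
    fun z _ h ↦ (Real.sqrt_lt' hr₁0).2 h
  have he0 : ∀ z, 0 ≤ b (dx w z) (dx w z) := fun z ↦ hpos _
  refine energy_lower_bound (F := fun z ↦ b (w z - x) (w z - x)) hO hZ (fun z hz ↦ hz.1) hOs ?_
    (fun z _ ↦ hpos _) hint (fun z _ ↦ he0 z) (by positivity) hr₁0 ?_ ?_ ?_ hz₀ ?_ ?_
    (by positivity) ?_
  · have : ContDiffOn ℝ 2 (fun z ↦ w z - x) O := hw.sub contDiffOn_const
    exact (contDiffOn_const.clm_apply this).clm_apply this
  · intro z hz hlt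
    refine ⟨hz, ?_⟩
    rw [mem_closedBall_iff_norm]
    have h3 : √(b (w z - x) (w z - x)) ≤ √c * (R / 2) :=
      (hsmall z hz hlt).le.trans (min_le_right _ _)
    refine (nlow _).trans ?_
    rw [div_le_iff₀ (by positivity)]
    linarith
  · intro z hz hlt
    obtain ⟨-, -, e3⟩ := sq_dist_derivs hO hw b hb x hz
    rw [e3]
    set F := b (w z - x) (w z - x)
    set u := dx w z
    set e := b u u
    set ε := dy w z - J x u
    have hdy : dy w z = J x u + ε := by simp [ε]
    have h3 := hdev z hz
    have h4 : b (dy w z) (dy w z) = e + 2 * b (J x u) ε + b ε ε := by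
      rw [hdy]
      simp only [map_add, add_apply, hJb, hb ε (J x u)]
      ring
    have h5 : |b (J x u) ε| ≤ K₁ * √F * e := by
      calc _ ≤ √(b (J x u) (J x u)) * √(b ε ε) := hCS _ _
        _ ≤ √e * (K₁ * √F * √e) := by rw [hJb]; gcongr
        _ = K₁ * √F * (√e) ^ 2 := by ring
        _ = _ := by rw [hsq]
    have h6 := hlapw z hz
    have h7 : 4 * (1 - K₃ * √F) * e ≤ 4 * e - 4 * (K₁ * √F * e) - 2 * (K₂ * √F * e) := by
      have : 0 ≤ √F * e := mul_nonneg (Real.sqrt_nonneg _) (hpos _)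
      have h8 : 0 ≤ K₁ * (√F * e) := by positivity
      have h9 : 0 ≤ K₁ ^ 2 * (√F * e) := by positivity
      have h10 : 0 ≤ K₂ * (√F * e) := by positivity
      rw [hK₃]
      linarith
    have h8 := hpos ε
    rw [h4]
    linarith [neg_abs_le (b (J x u) ε), neg_abs_le (b (w z - x) (lap w z))]
  · intro z hz hlt
    obtain ⟨e1, e2, -⟩ := sq_dist_derivs hO hw b hb x hz
    rw [e1, e2]
    have h0 : √(b (w z - x) (w z - x)) ≤ 1 := (hsmall z hz hlt).le.trans (min_le_left _ _)
    have h3 := hdev z hz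
    have hbes := bessel_pair hb hpos (hJb (dx w z)) (hJ0 (dx w z)) (w z - x)
    set y := w z - x
    set F := b y y with hF
    set u := dx w z
    set e := b u u with he
    set ε := dy w z - J x u
    have hdy : dy w z = J x u + ε := by simp [ε]
    have h4 : |b y (J x u)| ≤ √F * √e := by
      refine (hCS _ _).trans ?_
      rw [hJb]
    have h5 : |b y ε| ≤ √F * (K₁ * √F * √e) := (hCS _ _).trans (by gcongr)
    have h6 : b y (J x u) * b y ε ≤ F * e * (K₁ * √F) := by
      refine (le_abs_self _).trans ?_
      rw [abs_mul]
      calc _ ≤ (√F * √e) * (√F * (K₁ * √F * √e)) := by gcongr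
        _ = (√F) ^ 2 * (√e) ^ 2 * (K₁ * √F) := by ring
        _ = _ := by rw [hF, he, hsq, hsq]
    have hFe : 0 ≤ F * e := mul_nonneg (hpos _) (hpos _)
    have h7 : b y ε ^ 2 ≤ F * e * (K₁ ^ 2 * √F) := by
      rw [← sq_abs]
      calc _ ≤ (√F * (K₁ * √F * √e)) ^ 2 := by gcongr
        _ = (√F) ^ 2 * (√e) ^ 2 * (K₁ ^ 2 * √F * √F) := by ring
        _ ≤ (√F) ^ 2 * (√e) ^ 2 * (K₁ ^ 2 * √F * 1) := by gcongr
        _ = _ := by rw [hF, he, hsq, hsq, mul_one]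
    have h8 : 0 ≤ F * e * (K₂ * √F) := by positivity
    rw [hdy, map_add, hK₃]
    calc _ = 4 * (b y u ^ 2 + b y (J x u) ^ 2 + 2 * (b y (J x u) * b y ε) + b y ε ^ 2) := by ring
      _ ≤ 4 * (F * e + 2 * (F * e * (K₁ * √F)) + F * e * (K₁ ^ 2 * √F)) := by linarith
      _ ≤ 4 * (F * e + 2 * (F * e * (K₁ * √F)) + F * e * (K₁ ^ 2 * √F) + F * e * (K₂ * √F)) := by
          linarith
      _ = _ := by ring
  · have : 0 < ‖dx w z₀‖ := norm_pos_iff.2 hdz₀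
    exact lt_of_lt_of_le (by positivity) (hcb _)
  · have : ContinuousAt (dx w) z₀ :=
      ((contDiffOn_fderiv_apply hO hw (1, 0)).contDiffAt (hO.mem_nhds hz₀)).continuousAt
    exact (continuousAt_const.clm_apply this).clm_apply this
  · have hu : 0 < ‖dx w z₀‖ := norm_pos_iff.2 hdz₀
    have hwd : HasFDerivAt w (fderiv ℝ w z₀) z₀ :=
      ((hw.contDiffAt (hO.mem_nhds hz₀)).differentiableAt two_ne_zero).hasFDerivAt
    have hD : ∀ v : ℝ × ℝ, ‖fderiv ℝ w z₀ v‖ ≤ (1 + K) * ‖dx w z₀‖ * ‖v‖ := by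
      intro v
      have hv : v = v.1 • ((1, 0) : ℝ × ℝ) + v.2 • ((0, 1) : ℝ × ℝ) := by ext <;> simp
      have e1 : fderiv ℝ w z₀ v = v.1 • dx w z₀ + v.2 • dy w z₀ := by
        conv_lhs => rw [hv, map_add, map_smul, map_smul]
        rfl
      have h3 : ‖dy w z₀‖ ≤ K * ‖dx w z₀‖ := by
        rw [h1 z₀ hz₀]
        exact ((J (w z₀)).le_opNorm _).trans (by gcongr; exact hJn _ (hwB _ hz₀))
      have h4 : ‖v.1‖ ≤ ‖v‖ := norm_fst_le v
      have h5 : ‖v.2‖ ≤ ‖v‖ := norm_snd_le v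
      rw [e1]
      calc _ ≤ ‖v.1‖ * ‖dx w z₀‖ + ‖v.2‖ * ‖dy w z₀‖ := by
            rw [← norm_smul, ← norm_smul]; exact norm_add_le _ _
        _ ≤ ‖v‖ * ‖dx w z₀‖ + ‖v‖ * (K * ‖dx w z₀‖) := by gcongr
        _ = _ := by ring
    filter_upwards [hwd.isLittleO.def hu] with z hz
    rw [hwz₀] at hz
    have h3 : ‖w z - x‖ ≤ (2 + K) * ‖dx w z₀‖ * ‖z - z₀‖ := by
      calc ‖w z - x‖ = ‖(w z - x - fderiv ℝ w z₀ (z - z₀)) + fderiv ℝ w z₀ (z - z₀)‖ := by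
            rw [sub_add_cancel]
        _ ≤ ‖dx w z₀‖ * ‖z - z₀‖ + (1 + K) * ‖dx w z₀‖ * ‖z - z₀‖ :=
            (norm_add_le _ _).trans (add_le_add hz (hD _))
        _ = _ := by ring
    have h4 : ‖dx w z₀‖ ^ 2 ≤ b (dx w z₀) (dx w z₀) / c := by
      rw [le_div_iff₀ hc]; linarith [hcb (dx w z₀)]
    calc _ ≤ lam * ‖w z - x‖ ^ 2 := hlb _
      _ ≤ lam * ((2 + K) * ‖dx w z₀‖ * ‖z - z₀‖) ^ 2 := by gcongr
      _ = lam * (2 + K) ^ 2 * ‖dx w z₀‖ ^ 2 * ‖z - z₀‖ ^ 2 := by ring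
      _ ≤ lam * (2 + K) ^ 2 * (b (dx w z₀) (dx w z₀) / c) * ‖z - z₀‖ ^ 2 := by gcongr
      _ = _ := by rw [hA]; ring

end Holomorphic

/-! ### Tensor fields in charts -/

section Charts

variable {m : ℕ} {M : Type*} [TopologicalSpace M] [ChartedSpace (Eucl m) M]
  [IsManifold 𝓘(ℝ, Eucl m) ∞ M]

/-- The derivative at `z` of the preferred chart at `x₀`, the inverse of `chartSymmDeriv`. -/
def chartDeriv (x₀ z : M) : TangentSpace 𝓘(ℝ, Eucl m) z →L[ℝ] Eucl m :=
  tangentCoordChange 𝓘(ℝ, Eucl m) z x₀ z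

theorem chartSymmDeriv_chart {x₀ z : M} (hz : z ∈ (chartAt (Eucl m) x₀).source) :
    chartSymmDeriv x₀ (chartAt (Eucl m) x₀ z) = tangentCoordChange 𝓘(ℝ, Eucl m) x₀ z z := by
  rw [chartSymmDeriv, (chartAt (Eucl m) x₀).left_inv hz]

theorem chartDeriv_chartSymmDeriv {x₀ z : M} (hz : z ∈ (chartAt (Eucl m) x₀).source) (a : Eucl m) :
    chartDeriv x₀ z (chartSymmDeriv x₀ (chartAt (Eucl m) x₀ z) a) = a := by
  rw [chartSymmDeriv_chart hz]
  exact (tangentCoordChange_comp (by simpa using hz)).trans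
    (tangentCoordChange_self (by simpa using hz))

theorem exists_chartDeriv_eq {x₀ z : M} (hz : z ∈ (chartAt (Eucl m) x₀).source) (u : Eucl m) :
    ∃ a : TangentSpace 𝓘(ℝ, Eucl m) z, chartDeriv x₀ z a = u :=
  ⟨_, chartDeriv_chartSymmDeriv hz u⟩

theorem chartSymmDeriv_chartDeriv {x₀ z : M} (hz : z ∈ (chartAt (Eucl m) x₀).source)
    (a : TangentSpace 𝓘(ℝ, Eucl m) z) :
    chartSymmDeriv x₀ (chartAt (Eucl m) x₀ z) (chartDeriv x₀ z a) = a := by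
  rw [chartSymmDeriv_chart hz]
  exact (tangentCoordChange_comp (by simpa using hz)).trans (tangentCoordChange_self (by simp))

theorem chartDeriv_self (x : M) (a : TangentSpace 𝓘(ℝ, Eucl m) x) : chartDeriv x x a = a :=
  tangentCoordChange_self (by simp)

theorem chartSymmDeriv_self (x : M) (a : Eucl m) :
    chartSymmDeriv x (chartAt (Eucl m) x x) a = a := by
  rw [chartSymmDeriv_chart (mem_chart_source _ x)]
  exact tangentCoordChange_self (by simp)

theorem hasMFDerivAt_chart {x₀ z : M} (hz : z ∈ (chartAt (Eucl m) x₀).source) :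
    HasMFDerivAt 𝓘(ℝ, Eucl m) 𝓘(ℝ, Eucl m) (chartAt (Eucl m) x₀) z (chartDeriv x₀ z) := by
  have h := (mdifferentiableAt_atlas (I := 𝓘(ℝ, Eucl m)) (chart_mem_atlas (Eucl m) x₀)
    hz).hasMFDerivAt
  rwa [mfderiv_chartAt_eq_tangentCoordChange hz] at h

/-- The derivative of a map into `M`, read in a chart. -/
theorem hasFDerivAt_chart_comp {F : Type*} [NormedAddCommGroup F] [NormedSpace ℝ F] {u : F → M}
    {z : F} {x₀ : M} (hu : MDifferentiableAt 𝓘(ℝ, F) 𝓘(ℝ, Eucl m) u z)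
    (hz : u z ∈ (chartAt (Eucl m) x₀).source) :
    HasFDerivAt (fun y ↦ chartAt (Eucl m) x₀ (u y))
      ((chartDeriv x₀ (u z)).comp
        (show F →L[ℝ] Eucl m from mfderiv 𝓘(ℝ, F) 𝓘(ℝ, Eucl m) u z)) z :=
  hasMFDerivAt_iff_hasFDerivAt.1 ((hasMFDerivAt_chart hz).comp z hu.hasMFDerivAt)

theorem contDiffAt_chart_comp {F : Type*} [NormedAddCommGroup F] [NormedSpace ℝ F] {u : F → M}
    {z : F} {x₀ : M} (hu : ContMDiffAt 𝓘(ℝ, F) 𝓘(ℝ, Eucl m) ∞ u z)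
    (hz : u z ∈ (chartAt (Eucl m) x₀).source) :
    ContDiffAt ℝ ∞ (fun y ↦ chartAt (Eucl m) x₀ (u y)) z := by
  have h1 : ContMDiffAt 𝓘(ℝ, Eucl m) 𝓘(ℝ, Eucl m) ∞ (chartAt (Eucl m) x₀) (u z) :=
    (contMDiffOn_chart (I := 𝓘(ℝ, Eucl m)) (n := ∞) (x := x₀)).contMDiffAt
      ((chartAt (Eucl m) x₀).open_source.mem_nhds hz)
  exact contMDiffAt_iff_contDiffAt.1 (h1.comp z hu)

theorem contMDiffAt_chart_symm {x₀ : M} {y : Eucl m} (hy : y ∈ (chartAt (Eucl m) x₀).target) :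
    ContMDiffAt 𝓘(ℝ, Eucl m) 𝓘(ℝ, Eucl m) ∞ (chartAt (Eucl m) x₀).symm y :=
  (contMDiffOn_chart_symm (I := 𝓘(ℝ, Eucl m)) (n := ∞) (x := x₀)).contMDiffAt
    ((chartAt (Eucl m) x₀).open_target.mem_nhds hy)

/-- `chartSymmDeriv` is the derivative of the inverse chart. -/
theorem hasMFDerivAt_chart_symm {x₀ : M} {y : Eucl m} (hy : y ∈ (chartAt (Eucl m) x₀).target) :
    HasMFDerivAt 𝓘(ℝ, Eucl m) 𝓘(ℝ, Eucl m) (chartAt (Eucl m) x₀).symm y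
      (chartSymmDeriv x₀ y) := by
  set c := chartAt (Eucl m) x₀
  have hd := (contMDiffAt_chart_symm hy).mdifferentiableAt (by simp)
  have hs : c.symm y ∈ c.source := c.map_target hy
  have h1 := hasFDerivAt_chart_comp hd hs
  have h2 : HasFDerivAt (fun y ↦ c (c.symm y)) (ContinuousLinearMap.id ℝ (Eucl m)) y := by
    refine (hasFDerivAt_id y).congr_of_eventuallyEq ?_
    filter_upwards [c.open_target.mem_nhds hy] with z hz using c.right_inv hz
  have h3 := h1.unique h2
  have h4 : mfderiv 𝓘(ℝ, Eucl m) 𝓘(ℝ, Eucl m) c.symm y = chartSymmDeriv x₀ y := by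
    refine ContinuousLinearMap.ext fun a ↦ ?_
    have h5 : chartDeriv x₀ (c.symm y) (mfderiv 𝓘(ℝ, Eucl m) 𝓘(ℝ, Eucl m) c.symm y a) = a :=
      congrArg (fun T : Eucl m →L[ℝ] Eucl m ↦ T a) h3
    have h6 := chartSymmDeriv_chartDeriv hs (mfderiv 𝓘(ℝ, Eucl m) 𝓘(ℝ, Eucl m) c.symm y a)
    rw [h5] at h6
    refine h6.symm.trans ?_
    change chartSymmDeriv x₀ (c (c.symm y)) a = chartSymmDeriv x₀ y a
    rw [c.right_inv hy]
  rw [← h4]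
  exact hd.hasMFDerivAt

theorem symmL_trivializationAt_tangent {x₀ z : M} (hz : z ∈ (chartAt (Eucl m) x₀).source) :
    (trivializationAt (Eucl m) (TangentSpace 𝓘(ℝ, Eucl m) (M := M)) x₀).symmL ℝ z =
      chartSymmDeriv x₀ (chartAt (Eucl m) x₀ z) := by
  rw [chartSymmDeriv_chart hz]
  exact TangentBundle.symmL_trivializationAt_eq_core hz

theorem continuousLinearMapAt_trivializationAt_tangent {x₀ z : M}
    (hz : z ∈ (chartAt (Eucl m) x₀).source) :
    (trivializationAt (Eucl m) (TangentSpace 𝓘(ℝ, Eucl m) (M := M)) x₀).continuousLinearMapAt ℝ z =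
      chartDeriv x₀ z :=
  TangentBundle.continuousLinearMapAt_trivializationAt_eq_core hz

theorem bilinInChart_apply
    (β : ∀ x : M, TangentSpace 𝓘(ℝ, Eucl m) x →L[ℝ] TangentSpace 𝓘(ℝ, Eucl m) x →L[ℝ] ℝ)
    {x₀ z : M} (hz : z ∈ (chartAt (Eucl m) x₀).source)
    (a b : TangentSpace 𝓘(ℝ, Eucl m) z) :
    bilinInChart β x₀ (chartAt (Eucl m) x₀ z) (chartDeriv x₀ z a) (chartDeriv x₀ z b) =
      β z a b := by
  change β ((chartAt (Eucl m) x₀).symm (chartAt (Eucl m) x₀ z))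
    (chartSymmDeriv x₀ (chartAt (Eucl m) x₀ z) (chartDeriv x₀ z a))
    (chartSymmDeriv x₀ (chartAt (Eucl m) x₀ z) (chartDeriv x₀ z b)) = _
  rw [chartSymmDeriv_chartDeriv hz, chartSymmDeriv_chartDeriv hz,
    (chartAt (Eucl m) x₀).left_inv hz]

/-- A field `u` of tangent vectors along `b` is smooth if it is so in a chart. -/
theorem contMDiffAt_tangent_iff {N : Type*} {F : Type*} [NormedAddCommGroup F] [NormedSpace ℝ F]
    {H : Type*} [TopologicalSpace H] {I : ModelWithCorners ℝ F H} [TopologicalSpace N]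
    [ChartedSpace H N] {b : N → M}
    {u : ∀ p, TangentSpace 𝓘(ℝ, Eucl m) (b p)} {p : N} {x₀ : M}
    (hb : ContMDiffAt I 𝓘(ℝ, Eucl m) ∞ b p) (hp : b p ∈ (chartAt (Eucl m) x₀).source) :
    ContMDiffAt I (𝓘(ℝ, Eucl m).prod 𝓘(ℝ, Eucl m)) ∞
      (fun p ↦ TotalSpace.mk' (Eucl m) (E := TangentSpace 𝓘(ℝ, Eucl m) (M := M)) (b p) (u p)) p ↔
    ContMDiffAt I 𝓘(ℝ, Eucl m) ∞ (fun p ↦ chartDeriv x₀ (b p) (u p)) p := by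
  rw [(trivializationAt (Eucl m) (TangentSpace 𝓘(ℝ, Eucl m) (M := M)) x₀).contMDiffAt_iff
    (by rw [Trivialization.mem_source]; exact hp)]
  have hev : (fun p ↦ (trivializationAt (Eucl m) (TangentSpace 𝓘(ℝ, Eucl m) (M := M)) x₀
      (TotalSpace.mk' (Eucl m) (b p) (u p))).2) =ᶠ[𝓝 p] fun p ↦ chartDeriv x₀ (b p) (u p) := by
    filter_upwards [hb.continuousAt ((chartAt (Eucl m) x₀).open_source.mem_nhds hp)] with q hq
    have hq' : b q ∈ (chartAt (Eucl m) x₀).source := hq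
    have e := congrArg (fun T : Eucl m →L[ℝ] Eucl m ↦ T (u q))
      (continuousLinearMapAt_trivializationAt_tangent hq')
    refine Eq.trans ?_ e
    exact (Trivialization.continuousLinearMapAt_apply_of_mem (R := ℝ)
      (e := trivializationAt (Eucl m) (TangentSpace 𝓘(ℝ, Eucl m) (M := M)) x₀) hq' _).symm
  exact ⟨fun h ↦ h.2.congr_of_eventuallyEq hev.symm, fun h ↦ ⟨hb, h.congr_of_eventuallyEq hev⟩⟩

theorem contMDiffAt_chartSymmDeriv {x₀ z : M} (hz : z ∈ (chartAt (Eucl m) x₀).source)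
    (a : Eucl m) : ContMDiffAt 𝓘(ℝ, Eucl m) (𝓘(ℝ, Eucl m).prod 𝓘(ℝ, Eucl m)) ∞
      (fun p ↦ TotalSpace.mk' (Eucl m) (E := TangentSpace 𝓘(ℝ, Eucl m) (M := M)) p
        (chartSymmDeriv x₀ (chartAt (Eucl m) x₀ p) a)) z := by
  refine (contMDiffAt_tangent_iff contMDiffAt_id hz).2 ?_
  refine (contMDiffAt_const (c := a)).congr_of_eventuallyEq ?_
  filter_upwards [(chartAt (Eucl m) x₀).open_source.mem_nhds hz] with p hp using
    chartDeriv_chartSymmDeriv hp a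

/-- Smooth fields of bilinear forms are smooth in charts. -/
theorem contDiffOn_bilinInChart
    {β : ∀ x : M, TangentSpace 𝓘(ℝ, Eucl m) x →L[ℝ] TangentSpace 𝓘(ℝ, Eucl m) x →L[ℝ] ℝ}
    (hβ : ContMDiff 𝓘(ℝ, Eucl m) (𝓘(ℝ, Eucl m).prod 𝓘(ℝ, Eucl m →L[ℝ] Eucl m →L[ℝ] ℝ)) ∞
      (fun x ↦ TotalSpace.mk' (Eucl m →L[ℝ] Eucl m →L[ℝ] ℝ) x (β x))) (x₀ : M) :
    ContDiffOn ℝ ∞ (bilinInChart β x₀) (chartAt (Eucl m) x₀).target := by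
  set c := chartAt (Eucl m) x₀ with hc
  rw [contDiffOn_clm_apply]
  intro a
  rw [contDiffOn_clm_apply]
  intro b y hy
  have hz : c.symm y ∈ c.source := c.map_target hy
  have h1 : ContMDiffAt 𝓘(ℝ, Eucl m) (𝓘(ℝ, Eucl m).prod 𝓘(ℝ, ℝ)) ∞
      (fun p ↦ TotalSpace.mk' ℝ (E := Bundle.Trivial M ℝ) p
        (β p (chartSymmDeriv x₀ (c p) a) (chartSymmDeriv x₀ (c p) b))) (c.symm y) := by
    apply ContMDiffAt.clm_bundle_apply₂ (F₁ := Eucl m) (F₂ := Eucl m)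
    · exact hβ _
    · exact contMDiffAt_chartSymmDeriv hz a
    · exact contMDiffAt_chartSymmDeriv hz b
  simp only [contMDiffAt_totalSpace] at h1
  have h2 := h1.2.comp_of_eq (contMDiffAt_chart_symm hy) rfl
  refine ((contMDiffAt_iff_contDiffAt.1 h2).congr_of_eventuallyEq ?_).contDiffWithinAt
  filter_upwards [c.open_target.mem_nhds hy] with y' hy'
  change β (c.symm y') (chartSymmDeriv x₀ y' a) (chartSymmDeriv x₀ y' b) =
    β (c.symm y') (chartSymmDeriv x₀ (c (c.symm y')) a) (chartSymmDeriv x₀ (c (c.symm y')) b)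
  rw [c.right_inv hy']

variable {Ω : SymplecticForm m M}

/-- The representation of an almost complex structure in the preferred chart at `x₀`. -/
def acsInChart (J : CompatibleACS Ω) (x₀ : M) (y : Eucl m) : Eucl m →L[ℝ] Eucl m :=
  let T : Eucl m →L[ℝ] Eucl m := J.J ((chartAt (Eucl m) x₀).symm y)
  (chartDeriv x₀ ((chartAt (Eucl m) x₀).symm y)).comp (T.comp (chartSymmDeriv x₀ y))

theorem acsInChart_apply (J : CompatibleACS Ω) {x₀ z : M} (hz : z ∈ (chartAt (Eucl m) x₀).source)
    (a : TangentSpace 𝓘(ℝ, Eucl m) z) :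
    acsInChart J x₀ (chartAt (Eucl m) x₀ z) (chartDeriv x₀ z a) = chartDeriv x₀ z (J.J z a) := by
  change chartDeriv x₀ ((chartAt (Eucl m) x₀).symm (chartAt (Eucl m) x₀ z))
    (J.J ((chartAt (Eucl m) x₀).symm (chartAt (Eucl m) x₀ z))
      (chartSymmDeriv x₀ (chartAt (Eucl m) x₀ z) (chartDeriv x₀ z a))) = _
  rw [chartSymmDeriv_chartDeriv hz, (chartAt (Eucl m) x₀).left_inv hz]

theorem contDiffOn_acsInChart (J : CompatibleACS Ω) (x₀ : M) :
    ContDiffOn ℝ ∞ (acsInChart J x₀) (chartAt (Eucl m) x₀).target := by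
  set c := chartAt (Eucl m) x₀ with hc
  rw [contDiffOn_clm_apply]
  intro a y hy
  have hz : c.symm y ∈ c.source := c.map_target hy
  have h1 : ContMDiffAt 𝓘(ℝ, Eucl m) (𝓘(ℝ, Eucl m).prod 𝓘(ℝ, Eucl m)) ∞
      (fun p ↦ TotalSpace.mk' (Eucl m) (E := TangentSpace 𝓘(ℝ, Eucl m) (M := M)) p
        (J.J p (chartSymmDeriv x₀ (c p) a))) (c.symm y) :=
    ContMDiffAt.clm_bundle_apply (F₁ := Eucl m) (J.contMDiff _) (contMDiffAt_chartSymmDeriv hz a)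
  have h2 := ((contMDiffAt_tangent_iff contMDiffAt_id hz).1 h1).comp_of_eq
    (contMDiffAt_chart_symm hy) rfl
  refine ((contMDiffAt_iff_contDiffAt.1 h2).congr_of_eventuallyEq ?_).contDiffWithinAt
  filter_upwards [c.open_target.mem_nhds hy] with y' hy'
  change chartDeriv x₀ (c.symm y') (J.J (c.symm y') (chartSymmDeriv x₀ y' a)) =
    chartDeriv x₀ (c.symm y') (J.J (c.symm y') (chartSymmDeriv x₀ (c (c.symm y')) a))
  rw [c.right_inv hy']

end Charts

/-! ### Holomorphic strips -/

section Strips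

variable {m : ℕ} {M : Type*} [TopologicalSpace M] [ChartedSpace (Eucl m) M]
  [IsManifold 𝓘(ℝ, Eucl m) ∞ M] {Ω : SymplecticForm m M} {J : CompatibleACS Ω}

theorem two_le_infty : (2 : WithTop ℕ∞) ≤ (∞ : WithTop ℕ∞) :=
  WithTop.coe_le_coe.2 (le_top : (2 : ℕ∞) ≤ ⊤)

/-- The interior `ℝ × (0,1)` of the strip. -/
def openStrip : Set (ℝ × ℝ) := univ ×ˢ Ioo 0 1

theorem isOpen_openStrip : IsOpen openStrip := isOpen_univ.prod isOpen_Ioo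

theorem openStrip_subset : openStrip ⊆ strip := prod_mono_right Ioo_subset_Icc_self

theorem isClosed_strip : IsClosed strip := isClosed_univ.prod isClosed_Icc

theorem strip_mem_nhds {z : ℝ × ℝ} (hz : z ∈ openStrip) : strip ∈ 𝓝 z :=
  mem_of_superset (isOpen_openStrip.mem_nhds hz) openStrip_subset

theorem openStrip_ae_eq : openStrip =ᵐ[volume] strip := by
  refine openStrip_subset.eventuallyLE.antisymm ?_
  rw [ae_le_set]
  have h : strip \ openStrip ⊆ univ ×ˢ ({0, 1} : Set ℝ) := by
    rintro ⟨a, b⟩ ⟨⟨-, h1, h2⟩, h3⟩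
    refine ⟨mem_univ _, ?_⟩
    by_contra! h4
    simp only [mem_insert_iff, mem_singleton_iff, not_or] at h4
    exact h3 ⟨mem_univ _, lt_of_le_of_ne h1 (Ne.symm h4.1), lt_of_le_of_ne h2 h4.2⟩
  refine measure_mono_null h ?_
  rw [Measure.volume_eq_prod, Measure.prod_prod, (Set.toFinite ({0, 1} : Set ℝ)).measure_zero volume,
    mul_zero]

theorem form_swap (Ω : SymplecticForm m M) (x : M) (u w : TangentSpace 𝓘(ℝ, Eucl m) x) :
    Ω.form x u w = -Ω.form x w u := by
  have h := Ω.alternating x (u + w)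
  simp only [map_add, add_apply, Ω.alternating, zero_add, add_zero] at h
  linarith

theorem form_J_symm (J : CompatibleACS Ω) (x : M) (u w : TangentSpace 𝓘(ℝ, Eucl m) x) :
    Ω.form x u (J.J x w) = Ω.form x w (J.J x u) := by
  rw [← J.invariant, J.sq, map_neg, form_swap Ω x w]

theorem form_J_nonneg (J : CompatibleACS Ω) (x : M) (u : TangentSpace 𝓘(ℝ, Eucl m) x) :
    0 ≤ Ω.form x u (J.J x u) := by
  rcases eq_or_ne u 0 with rfl | h
  · simp
  · exact (J.pos x u h).le

variable {A : Set M} {φ : ℝ → ℝ → M ≃ₘ⟮𝓘(ℝ, Eucl m), 𝓘(ℝ, Eucl m)⟯ M} {ρ : ℝ → ℝ}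
  {v : ℝ × ℝ → M}

namespace IsMovingStrip

theorem dTau_eq (hv : IsMovingStrip J A φ ρ v) {z : ℝ × ℝ} (hz : z ∈ strip) :
    dTau v z = -J.J (v z) (dT v z) := eq_neg_of_add_eq_zero_left (hv.cauchyRiemann z hz)

theorem dT_eq (hv : IsMovingStrip J A φ ρ v) {z : ℝ × ℝ} (hz : z ∈ strip) :
    dT v z = J.J (v z) (dTau v z) := by
  rw [hv.dTau_eq hz, map_neg, J.sq, neg_neg]

theorem contMDiffAt (hv : IsMovingStrip J A φ ρ v) {z : ℝ × ℝ} (hz : z ∈ openStrip) :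
    ContMDiffAt 𝓘(ℝ, ℝ × ℝ) 𝓘(ℝ, Eucl m) ∞ v z := hv.smooth.contMDiffAt (strip_mem_nhds hz)

theorem contDiffAt_chart (hv : IsMovingStrip J A φ ρ v) {z : ℝ × ℝ} (hz : z ∈ openStrip) {x₀ : M}
    (hx₀ : v z ∈ (chartAt (Eucl m) x₀).source) :
    ContDiffAt ℝ ∞ (fun y ↦ chartAt (Eucl m) x₀ (v y)) z :=
  contDiffAt_chart_comp (hv.contMDiffAt hz) hx₀

theorem dx_chart (hv : IsMovingStrip J A φ ρ v) {z : ℝ × ℝ} (hz : z ∈ openStrip) {x₀ : M}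
    (hx₀ : v z ∈ (chartAt (Eucl m) x₀).source) :
    dx (fun y ↦ chartAt (Eucl m) x₀ (v y)) z = chartDeriv x₀ (v z) (dTau v z) := by
  rw [dx, (hasFDerivAt_chart_comp ((hv.contMDiffAt hz).mdifferentiableAt (by simp)) hx₀).fderiv,
    dTau, mfderivWithin_of_mem_nhds (strip_mem_nhds hz)]
  rfl

theorem dy_chart (hv : IsMovingStrip J A φ ρ v) {z : ℝ × ℝ} (hz : z ∈ openStrip) {x₀ : M}
    (hx₀ : v z ∈ (chartAt (Eucl m) x₀).source) :
    dy (fun y ↦ chartAt (Eucl m) x₀ (v y)) z = chartDeriv x₀ (v z) (dT v z) := by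
  rw [dy, (hasFDerivAt_chart_comp ((hv.contMDiffAt hz).mdifferentiableAt (by simp)) hx₀).fderiv,
    dT, mfderivWithin_of_mem_nhds (strip_mem_nhds hz)]
  rfl

/-- The energy density equals the integrand of the symplectic area. -/
theorem density_eq (hv : IsMovingStrip J A φ ρ v) {z : ℝ × ℝ} (hz : z ∈ strip) :
    Ω.form (v z) (dTau v z) (dT v z) = Ω.form (v z) (dTau v z) (J.J (v z) (dTau v z)) := by
  rw [hv.dT_eq hz]

theorem density_nonneg (hv : IsMovingStrip J A φ ρ v) {z : ℝ × ℝ} (hz : z ∈ strip) :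
    0 ≤ Ω.form (v z) (dTau v z) (dT v z) := by
  rw [hv.density_eq hz]; exact form_J_nonneg J _ _

theorem dT_eq_zero_of_density (hv : IsMovingStrip J A φ ρ v) {z : ℝ × ℝ} (hz : z ∈ strip)
    (h : Ω.form (v z) (dTau v z) (dT v z) = 0) : dT (m := m) v z = 0 := by
  rw [hv.density_eq hz] at h
  have : dTau (m := m) v z = 0 := by
    by_contra hne
    exact (J.pos _ _ hne).ne' h
  rw [hv.dT_eq hz, this, map_zero]

theorem isOpen_preimage (hv : IsMovingStrip J A φ ρ v) {U : Set M} (hU : IsOpen U) :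
    IsOpen (openStrip ∩ v ⁻¹' U) :=
  ContinuousOn.isOpen_inter_preimage (fun _ hz ↦ (hv.contMDiffAt hz).continuousAt.continuousWithinAt)
    isOpen_openStrip hU

theorem continuousAt_density (hv : IsMovingStrip J A φ ρ v) {z : ℝ × ℝ} (hz : z ∈ openStrip) :
    ContinuousAt (fun z ↦ Ω.form (v z) (dTau v z) (dT v z)) z := by
  set c := chartAt (Eucl m) (v z) with hc
  have hzc : v z ∈ c.source := mem_chart_source _ _
  set O := openStrip ∩ v ⁻¹' c.source
  have hO : IsOpen O := hv.isOpen_preimage c.open_source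
  have hw : ContDiffOn ℝ 2 (fun y ↦ c (v y)) O := fun y hy ↦
    ((hv.contDiffAt_chart hy.1 hy.2).of_le two_le_infty).contDiffWithinAt
  have hB : ContinuousAt (bilinInChart Ω.form (v z)) (c (v z)) :=
    ((contDiffOn_bilinInChart Ω.contMDiff (v z)).contDiffAt
      (c.open_target.mem_nhds (c.map_source hzc))).continuousAt
  have hz' : z ∈ O := ⟨hz, hzc⟩
  have h1 : ContinuousAt (fun y ↦ bilinInChart Ω.form (v z) (c (v y))
      (dx (fun y ↦ c (v y)) y) (dy (fun y ↦ c (v y)) y)) z := by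
    refine ContinuousAt.clm_apply (ContinuousAt.clm_apply ?_ ?_) ?_
    · exact hB.comp (f := fun y ↦ c (v y)) (hw.contDiffAt (hO.mem_nhds hz')).continuousAt
    · exact ((contDiffOn_fderiv_apply hO hw (1, 0)).contDiffAt (hO.mem_nhds hz')).continuousAt
    · exact ((contDiffOn_fderiv_apply hO hw (0, 1)).contDiffAt (hO.mem_nhds hz')).continuousAt
  refine h1.congr ?_
  filter_upwards [hO.mem_nhds hz'] with y hy
  rw [hv.dx_chart hy.1 hy.2, hv.dy_chart hy.1 hy.2]
  exact bilinInChart_apply Ω.form hy.2 _ _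

theorem integrableOn_density (hv : IsMovingStrip J A φ ρ v) :
    IntegrableOn (fun z ↦ Ω.form (v z) (dTau v z) (dT v z)) strip := by
  have hmeas : AEStronglyMeasurable (fun z ↦ Ω.form (v z) (dTau v z) (dT v z))
      (volume.restrict strip) := by
    rw [← Measure.restrict_congr_set openStrip_ae_eq]
    exact ContinuousOn.aestronglyMeasurable (fun z hz ↦
      (hv.continuousAt_density hz).continuousWithinAt) isOpen_openStrip.measurableSet
  refine ⟨hmeas, ?_⟩
  rw [hasFiniteIntegral_iff_ofReal]
  swap
  · filter_upwards [ae_restrict_mem isClosed_strip.measurableSet] with z hz using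
      hv.density_nonneg hz
  have h1 : energy J v = ∫⁻ z in strip, ENNReal.ofReal (Ω.form (v z) (dTau v z) (dT v z)) := by
    rw [energy, ← lintegral_const_mul' _ _ (by simp)]
    refine setLIntegral_congr_fun isClosed_strip.measurableSet fun z hz ↦ ?_
    have e1 := hv.density_eq hz
    have e2 : Ω.form (v z) (dT v z) (J.J (v z) (dT v z)) =
        Ω.form (v z) (dTau v z) (dT v z) := by
      rw [e1, hv.dT_eq hz, J.invariant]
    simp only [e2, ← e1]
    rw [← two_mul, ENNReal.ofReal_mul zero_le_two, ← mul_assoc]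
    simp [ENNReal.inv_mul_cancel]
  rw [← h1]
  exact hv.finite_energy

theorem setIntegral_density_le_area (hv : IsMovingStrip J A φ ρ v) {O : Set (ℝ × ℝ)}
    (hO : O ⊆ strip) : ∫ z in O, Ω.form (v z) (dTau v z) (dT v z) ≤ area Ω v := by
  refine setIntegral_mono_set hv.integrableOn_density ?_ hO.eventuallyLE
  filter_upwards [ae_restrict_mem isClosed_strip.measurableSet] with z hz using
    hv.density_nonneg hz

end IsMovingStrip

set_option synthInstance.maxHeartbeats 200000 in
/-- Bounds, uniform over a compact set, for a positive field `ω(·, j ·)` and for `j`. -/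
theorem exists_uniform_bounds {E : Type*} [NormedAddCommGroup E] [NormedSpace ℝ E]
    [FiniteDimensional ℝ E] {B : Set E} (hB : IsCompact B) {Om : E → E →L[ℝ] E →L[ℝ] ℝ}
    {j : E → E →L[ℝ] E} (h_om : ContinuousOn Om B) (hj : ContinuousOn j B)
    (hj' : ContinuousOn (fderiv ℝ j) B) (hpos : ∀ y ∈ B, ∀ u, u ≠ 0 → 0 < Om y u (j y u)) :
    ∃ c lam K : ℝ, 0 < c ∧ 0 < lam ∧ 0 < K ∧ ∀ y ∈ B,
      (∀ u, c * ‖u‖ ^ 2 ≤ Om y u (j y u)) ∧ (∀ u, Om y u (j y u) ≤ lam * ‖u‖ ^ 2) ∧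
      ‖j y‖ ≤ K ∧ ‖fderiv ℝ j y‖ ≤ K := by
  obtain ⟨K₁, hK₁⟩ := hB.exists_bound_of_continuousOn hj
  obtain ⟨K₂, hK₂⟩ := hB.exists_bound_of_continuousOn (E := E →L[ℝ] E →L[ℝ] E) hj'
  obtain ⟨K₃, hK₃⟩ := hB.exists_bound_of_continuousOn (E := E →L[ℝ] E →L[ℝ] ℝ) h_om
  set K : ℝ := max 1 (max K₁ K₂)
  have hK0 : 0 < K := lt_max_of_lt_left zero_lt_one
  -- the minimum over the unit sphere
  obtain ⟨c, hc, hcB⟩ : ∃ c : ℝ, 0 < c ∧ ∀ y ∈ B, ∀ u : E, ‖u‖ = 1 → c ≤ Om y u (j y u) := by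
    have hcomp : IsCompact (B ×ˢ Metric.sphere (0 : E) 1) := hB.prod (isCompact_sphere _ _)
    have hcont : ContinuousOn (fun p : E × E ↦ Om p.1 p.2 (j p.1 p.2))
        (B ×ˢ Metric.sphere (0 : E) 1) := by
      have hm : MapsTo Prod.fst (B ×ˢ Metric.sphere (0 : E) 1) B := fun p hp ↦ hp.1
      exact ((h_om.comp continuousOn_fst hm).clm_apply continuousOn_snd).clm_apply
        ((hj.comp continuousOn_fst hm).clm_apply continuousOn_snd)
    rcases (B ×ˢ Metric.sphere (0 : E) 1).eq_empty_or_nonempty with he | hne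
    · refine ⟨1, one_pos, fun y hy u hu ↦ ?_⟩
      have : (y, u) ∈ B ×ˢ Metric.sphere (0 : E) 1 := ⟨hy, by simpa using hu⟩
      rw [he] at this
      exact this.elim
    · obtain ⟨p, hp, hmin⟩ := hcomp.exists_isMinOn hne hcont
      refine ⟨_, hpos p.1 hp.1 p.2 ?_, fun y hy u hu ↦
        hmin (show (y, u) ∈ B ×ˢ Metric.sphere (0 : E) 1 from ⟨hy, by simpa using hu⟩)⟩
      have : ‖p.2‖ = 1 := by simpa using hp.2
      exact norm_pos_iff.1 (by rw [this]; exact one_pos)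
  refine ⟨c, max 1 (K₃ * K), K, hc, lt_max_of_lt_left zero_lt_one, hK0, fun y hy ↦
    ⟨fun u ↦ ?_, fun u ↦ ?_, ?_, ?_⟩⟩
  · rcases eq_or_ne u 0 with rfl | hu
    · simp
    · have hu0 : 0 < ‖u‖ := norm_pos_iff.2 hu
      have h1 := hcB y hy (‖u‖⁻¹ • u) (by rw [norm_smul, norm_inv, norm_norm]; field_simp)
      simp only [map_smul, smul_apply, smul_eq_mul] at h1
      calc c * ‖u‖ ^ 2 ≤ ‖u‖⁻¹ * (‖u‖⁻¹ * Om y u (j y u)) * ‖u‖ ^ 2 := by gcongr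
        _ = _ := by field_simp
  · have hJy : ‖j y‖ ≤ K := (hK₁ y hy).trans ((le_max_left _ _).trans (le_max_right _ _))
    calc _ ≤ ‖Om y u (j y u)‖ := Real.le_norm_self _
      _ ≤ ‖Om y‖ * ‖u‖ * ‖j y u‖ := (Om y).le_opNorm₂ _ _
      _ ≤ K₃ * ‖u‖ * (K * ‖u‖) := by
          have h3 : ‖Om y‖ ≤ K₃ := hK₃ y hy
          have h4 : ‖j y u‖ ≤ K * ‖u‖ := ((j y).le_opNorm u).trans (by gcongr)
          have h5 : 0 ≤ K₃ := (norm_nonneg (Om y)).trans h3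
          gcongr
      _ = K₃ * K * ‖u‖ ^ 2 := by ring
      _ ≤ _ := by gcongr; exact le_max_right _ _
  · exact (hK₁ y hy).trans ((le_max_left _ _).trans (le_max_right _ _))
  · exact (hK₂ y hy).trans ((le_max_right _ _).trans (le_max_right _ _))

theorem exists_chart_bounds (J : CompatibleACS Ω) (x₀ : M) {B : Set (Eucl m)} (hB : IsCompact B)
    (hBt : B ⊆ (chartAt (Eucl m) x₀).target) :
    ∃ c lam K : ℝ, 0 < c ∧ 0 < lam ∧ 0 < K ∧ ∀ y ∈ B,
      (∀ u, c * ‖u‖ ^ 2 ≤ bilinInChart Ω.form x₀ y u (acsInChart J x₀ y u)) ∧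
      (∀ u, bilinInChart Ω.form x₀ y u (acsInChart J x₀ y u) ≤ lam * ‖u‖ ^ 2) ∧
      ‖acsInChart J x₀ y‖ ≤ K ∧ ‖fderiv ℝ (acsInChart J x₀) y‖ ≤ K := by
  set ch := chartAt (Eucl m) x₀
  have hJs := contDiffOn_acsInChart J x₀
  refine exists_uniform_bounds hB
    ((contDiffOn_bilinInChart Ω.contMDiff x₀).continuousOn.mono hBt) (hJs.continuousOn.mono hBt)
    ((hJs.continuousOn_fderiv_of_isOpen ch.open_target (by simp)).mono hBt) ?_
  have h : ∀ p ∈ ch.source, ∀ u, u ≠ 0 →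
      0 < bilinInChart Ω.form x₀ (ch p) u (acsInChart J x₀ (ch p) u) := by
    intro p hp u hu
    obtain ⟨a, rfl⟩ := exists_chartDeriv_eq hp u
    rw [acsInChart_apply J hp, bilinInChart_apply Ω.form hp]
    refine J.pos _ _ fun h0 ↦ hu ?_
    rw [h0, map_zero]
  intro y hy u hu
  simpa only [ch.right_inv (hBt hy)] using h _ (ch.map_target (hBt hy)) u hu

/-- A holomorphic strip whose boundary avoids the open set `W`, and which passes with nonzero
derivative through a point near `x₀ ∈ W`, has area bounded below. -/
theorem exists_local_area_bound [T2Space M] (J : CompatibleACS Ω) {W : Set M} (hW : IsOpen W)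
    {x₀ : M} (hx₀ : x₀ ∈ W) :
    ∃ N ∈ 𝓝 x₀, ∃ C : ℝ, 0 < C ∧ ∀ (A : Set M)
      (φ : ℝ → ℝ → M ≃ₘ⟮𝓘(ℝ, Eucl m), 𝓘(ℝ, Eucl m)⟯ M) (ρ : ℝ → ℝ) (v : ℝ × ℝ → M),
      IsMovingStrip J A φ ρ v → (∀ τ, v (τ, 0) ∉ W) → (∀ τ, v (τ, 1) ∉ W) →
      ∀ z₀ ∈ strip, v z₀ ∈ N → dT (m := m) v z₀ ≠ 0 → C ≤ area Ω v := by
  -- A closed ball of radius `R'` in the chart lies in `W`; points of the concentric ball of radius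
  -- `R = R' / 2` are centres of balls of radius `R` on which the same bounds hold.
  set ch := chartAt (Eucl m) x₀ with hch
  have hx₀s : x₀ ∈ ch.source := mem_chart_source _ _
  have hopen : IsOpen (ch.target ∩ ch.symm ⁻¹' W) := ch.isOpen_inter_preimage_symm hW
  have hmem : ch x₀ ∈ ch.target ∩ ch.symm ⁻¹' W :=
    ⟨ch.map_source hx₀s, by rw [mem_preimage, ch.left_inv hx₀s]; exact hx₀⟩
  obtain ⟨R', hR', hball⟩ := Metric.nhds_basis_closedBall.mem_iff.1 (hopen.mem_nhds hmem)
  set R := R' / 2 with hRdef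
  have hR : 0 < R := by positivity
  set B := Metric.closedBall (ch x₀) R' with hBdef
  have hBt : B ⊆ ch.target := fun y hy ↦ (hball hy).1
  obtain ⟨c, lam, K, hc, hlam, hK, hbd⟩ := exists_chart_bounds J x₀ (isCompact_closedBall _ _) hBt
  obtain ⟨C, hC, hmain⟩ := holomorphic_energy_lower_bound (E := Eucl m) hc hlam hK hR
  refine ⟨ch.source ∩ ch ⁻¹' Metric.ball (ch x₀) R,
    (ch.isOpen_inter_preimage Metric.isOpen_ball).mem_nhds ⟨hx₀s, Metric.mem_ball_self hR⟩,
    C * (c / lam), by positivity, ?_⟩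
  intro A φ ρ v hv h0 h1 z₀ hz₀ hzN hdz
  set y₀ := ch (v z₀) with hy₀
  have hballB : Metric.closedBall y₀ R ⊆ B := fun y hy ↦ by
    have h2 : dist y₀ (ch x₀) < R := hzN.2
    rw [Metric.mem_closedBall] at hy ⊢
    linarith [dist_triangle y y₀ (ch x₀)]
  have hbB : Metric.ball y₀ R ⊆ B := Metric.ball_subset_closedBall.trans hballB
  have hint : ∀ z ∈ strip, v z ∈ W → z ∈ openStrip := by
    rintro ⟨τ, t⟩ ⟨-, ht⟩ hzW
    refine ⟨mem_univ _, lt_of_le_of_ne ht.1 ?_, lt_of_le_of_ne ht.2 ?_⟩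
    · rintro h
      exact h0 τ (by rwa [show t = 0 from h.symm] at hzW)
    · rintro h
      exact h1 τ (by rwa [show t = 1 from h] at hzW)
  have hBW : ∀ p ∈ ch.source, ch p ∈ B → p ∈ W := fun p hp hpB ↦ by
    have := (hball hpB).2
    rwa [mem_preimage, ch.left_inv hp] at this
  -- the identities of a compatible almost complex structure, in the chart
  have hT : ∀ p ∈ ch.source, ∀ u, ∃ a : TangentSpace 𝓘(ℝ, Eucl m) p, chartDeriv x₀ p a = u :=
    fun p hp u ↦ exists_chartDeriv_eq hp u
  have hsq : ∀ y ∈ B, ∀ u, acsInChart J x₀ y (acsInChart J x₀ y u) = -u := by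
    have h2 : ∀ p ∈ ch.source, ∀ u, acsInChart J x₀ (ch p) (acsInChart J x₀ (ch p) u) = -u := by
      intro p hp u
      obtain ⟨a, rfl⟩ := hT _ hp u
      rw [acsInChart_apply J hp, acsInChart_apply J hp, J.sq, map_neg]
    intro y hy u
    simpa only [ch.right_inv (hBt hy)] using h2 _ (ch.map_target (hBt hy)) u
  set b : Eucl m →L[ℝ] Eucl m →L[ℝ] ℝ :=
    ((bilinInChart Ω.form x₀ y₀).flip.comp (acsInChart J x₀ y₀)).flip with hb
  have hb_apply : ∀ u w, b u w = bilinInChart Ω.form x₀ y₀ u (acsInChart J x₀ y₀ w) :=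
    fun u w ↦ rfl
  have hzs : v z₀ ∈ ch.source := hzN.1
  have hb' : ∀ a a' : TangentSpace 𝓘(ℝ, Eucl m) (v z₀),
      b (chartDeriv x₀ (v z₀) a) (chartDeriv x₀ (v z₀) a') =
      Ω.form (v z₀) a (J.J (v z₀) a') := fun a a' ↦ by
    rw [hb_apply, hy₀, acsInChart_apply J hzs, bilinInChart_apply Ω.form hzs]
  have hy₀B : y₀ ∈ B := hbB (Metric.mem_ball_self hR)
  set O : Set (ℝ × ℝ) := openStrip ∩ v ⁻¹' (ch.source ∩ ch ⁻¹' Metric.ball y₀ R) with hO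
  have hOopen : IsOpen O := hv.isOpen_preimage (ch.isOpen_inter_preimage Metric.isOpen_ball)
  have hOs : O ⊆ strip := inter_subset_left.trans openStrip_subset
  set w : ℝ × ℝ → Eucl m := fun z ↦ ch (v z) with hw
  have hw2 : ContDiffOn ℝ 2 w O := fun z hz ↦
    ((hv.contDiffAt_chart hz.1 hz.2.1).of_le two_le_infty).contDiffWithinAt
  have hdx : ∀ z ∈ O, dx w z = chartDeriv x₀ (v z) (dTau v z) := fun z hz ↦
    hv.dx_chart hz.1 hz.2.1
  have hdy : ∀ z ∈ O, dy w z = chartDeriv x₀ (v z) (dT v z) := fun z hz ↦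
    hv.dy_chart hz.1 hz.2.1
  have hz₀O : z₀ ∈ O := ⟨hint z₀ hz₀ (hBW _ hzs hy₀B), hzs, Metric.mem_ball_self hR⟩
  -- comparison of the energy densities
  have hcomp : ∀ z ∈ O, b (dx w z) (dx w z) ≤
      lam / c * Ω.form (v z) (dTau v z) (dT v z) := by
    intro z hz
    have h2 : c * ‖dx w z‖ ^ 2 ≤ Ω.form (v z) (dTau v z) (dT v z) := by
      rw [hv.density_eq (hOs hz)]
      refine ((hbd (w z) (hbB hz.2.2)).1 _).trans_eq ?_
      rw [hdx z hz]
      change bilinInChart Ω.form x₀ (chartAt (Eucl m) x₀ (v z)) _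
        (acsInChart J x₀ (chartAt (Eucl m) x₀ (v z)) _) = _
      rw [acsInChart_apply J hz.2.1, bilinInChart_apply Ω.form hz.2.1]
    calc b (dx w z) (dx w z) ≤ lam * ‖dx w z‖ ^ 2 := (hbd y₀ hy₀B).2.1 _
      _ = lam / c * (c * ‖dx w z‖ ^ 2) := by field_simp
      _ ≤ _ := by gcongr
  have hiO : IntegrableOn (fun z ↦ Ω.form (v z) (dTau v z) (dT v z)) O :=
    hv.integrableOn_density.mono_set hOs
  have hib : IntegrableOn (fun z ↦ b (dx w z) (dx w z)) O := by
    refine (hiO.const_mul (lam / c)).mono' ?_ ?_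
    · have : ContinuousOn (dx w) O := (contDiffOn_fderiv_apply hOopen hw2 (1, 0)).continuousOn
      exact ((continuousOn_const.clm_apply this).clm_apply this).aestronglyMeasurable
        hOopen.measurableSet
    · filter_upwards [ae_restrict_mem hOopen.measurableSet] with z hz
      have hnn : 0 ≤ b (dx w z) (dx w z) :=
        le_trans (by positivity) ((hbd y₀ hy₀B).1 (dx w z))
      rw [Real.norm_of_nonneg hnn]
      exact hcomp z hz
  have key := hmain b (acsInChart J x₀) y₀ O w z₀ ?_ (hbd y₀ hy₀B).1 (hbd y₀ hy₀B).2.1 ?_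
    (fun y hy ↦ (hbd y (hbB hy)).2.2.2) (fun y hy ↦ (hbd y (hbB hy)).2.2.1)
    (fun y hy ↦ hsq y (hbB hy)) ?_ ?_ hOopen hOs hw2 (fun z hz ↦ hz.2.2) ?_ ?_ hib hz₀O rfl ?_
  · have h2 : C ≤ lam / c * area Ω v := by
      refine key.trans ((setIntegral_mono_on hib (hiO.const_mul _) hOopen.measurableSet hcomp).trans
        ?_)
      rw [integral_const_mul]
      gcongr
      exact hv.setIntegral_density_le_area hOs
    calc C * (c / lam) ≤ lam / c * area Ω v * (c / lam) := by gcongr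
      _ = area Ω v := by field_simp
  · intro u u'
    obtain ⟨a, rfl⟩ := hT _ hzs u
    obtain ⟨a', rfl⟩ := hT _ hzs u'
    rw [hb', hb', form_J_symm]
  · intro y hy
    exact ((contDiffOn_acsInChart J x₀).contDiffAt
      (ch.open_target.mem_nhds (hBt (hbB hy)))).differentiableAt (by simp)
  · intro u
    obtain ⟨a, rfl⟩ := hT _ hzs u
    rw [hy₀, acsInChart_apply J hzs, hb', hb', J.invariant]
  · intro u
    rw [hb_apply, hsq y₀ hy₀B]
    obtain ⟨a, rfl⟩ := hT _ hzs u
    rw [map_neg, hy₀, bilinInChart_apply Ω.form hzs, Ω.alternating, neg_zero]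
  · intro z hz
    rw [hdx z hz, hdy z hz]
    change _ + acsInChart J x₀ (chartAt (Eucl m) x₀ (v z)) _ = _
    rw [acsInChart_apply J hz.2.1, ← map_add, hv.cauchyRiemann z (hOs hz), map_zero]
  · have hcl : IsClosed (ch.symm '' Metric.closedBall y₀ (R / 2)) := by
      refine IsCompact.isClosed ((isCompact_closedBall _ _).image_of_continuousOn ?_)
      refine ch.continuousOn_symm.mono fun y hy ↦ hBt (hballB ?_)
      exact Metric.closedBall_subset_closedBall (by linarith) hy
    have heq : {z | z ∈ O ∧ w z ∈ Metric.closedBall y₀ (R / 2)} =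
        strip ∩ v ⁻¹' (ch.symm '' Metric.closedBall y₀ (R / 2)) := by
      ext z
      constructor
      · rintro ⟨hz, hzb⟩
        exact ⟨hOs hz, w z, hzb, ch.left_inv hz.2.1⟩
      · rintro ⟨hz, y, hy, hyz⟩
        have hyR : y ∈ Metric.ball y₀ R := Metric.closedBall_subset_ball (by linarith) hy
        have hyt : y ∈ ch.target := hBt (hbB hyR)
        have hvs : v z ∈ ch.source := by rw [← hyz]; exact ch.map_target hyt
        have hvy : ch (v z) = y := by rw [← hyz]; exact ch.right_inv hyt
        refine ⟨⟨hint z hz (hBW _ hvs ?_), hvs, ?_⟩, ?_⟩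
        · rw [hvy]; exact hbB hyR
        · rw [mem_preimage, hvy]; exact hyR
        · change ch (v z) ∈ _
          rw [hvy]; exact hy
    rw [heq]
    exact hv.smooth.continuousOn.preimage_isClosed_of_isClosed isClosed_strip hcl
  · intro h
    rw [hdx z₀ hz₀O] at h
    have h2 := chartSymmDeriv_chartDeriv hzs (dTau v z₀)
    rw [h, map_zero] at h2
    have h3 : dTau (m := m) v z₀ = 0 := h2.symm
    exact hdz (by rw [hv.dT_eq hz₀, h3, map_zero])

end Strips

/-! ### The Sasakian structure near the zero section -/

section Legendre

variable {X F : Type*} [NormedAddCommGroup X] [NormedSpace ℝ X] [NormedAddCommGroup F]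
  [NormedSpace ℝ F] [FiniteDimensional ℝ F]

theorem isInvertible_of_pos {B : F →L[ℝ] F →L[ℝ] ℝ} (hB : ∀ u, u ≠ 0 → 0 < B u u) :
    B.IsInvertible := by
  have hinj : Function.Injective B := by
    rw [injective_iff_map_eq_zero]
    intro u hu
    by_contra hne
    have h1 : B u u = 0 := by rw [hu]; rfl
    exact (hB u hne).ne' h1
  have hfin : Module.finrank ℝ F = Module.finrank ℝ (F →L[ℝ] ℝ) := by
    rw [← (LinearMap.toContinuousLinearMap (𝕜 := ℝ) (E := F) (F' := ℝ)).finrank_eq]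
    exact Subspace.dual_finrank_eq.symm
  have : FiniteDimensional ℝ (F →L[ℝ] ℝ) :=
    (LinearMap.toContinuousLinearMap (𝕜 := ℝ) (E := F) (F' := ℝ)).finiteDimensional
  exact ⟨(LinearEquiv.ofInjectiveOfFinrankEq B.toLinearMap hinj hfin).toContinuousLinearEquiv, rfl⟩

/-- The quadratic form `½ P(s)`, `B(s, ·) = P`, dual to a family of positive definite symmetric
forms `B`: it is smooth, and its derivative is that of `P(s) - ½ B(s, s)` for `s` held fixed. -/
theorem contDiffAt_dualForm {B : X → F →L[ℝ] F →L[ℝ] ℝ} {P : X → F →L[ℝ] ℝ} {s : X → F} {f : X → ℝ}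
    {y₀ : X} (hB : ContDiffAt ℝ ∞ B y₀) (hP : ContDiffAt ℝ ∞ P y₀)
    (hsymm : ∀ u w, B y₀ u w = B y₀ w u) (hpos : ∀ᶠ y in 𝓝 y₀, ∀ u, u ≠ 0 → 0 < B y u u)
    (hs : ∀ᶠ y in 𝓝 y₀, B y (s y) = P y) (hf : ∀ᶠ y in 𝓝 y₀, f y = 1 / 2 * P y (s y)) :
    ContDiffAt ℝ ∞ f y₀ ∧ ∀ a, fderiv ℝ f y₀ a =
      fderiv ℝ P y₀ a (s y₀) - 1 / 2 * fderiv ℝ B y₀ a (s y₀) (s y₀) := by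
  have hs' : ContDiffAt ℝ ∞ s y₀ := by
    have h1 : ContDiffAt ℝ ∞ (fun y ↦ (B y).inverse (P y)) y₀ :=
      ((isInvertible_of_pos hpos.self_of_nhds).contDiffAt_map_inverse.comp y₀ hB).clm_apply hP
    refine h1.congr_of_eventuallyEq ?_
    filter_upwards [hpos, hs] with y hy hsy
    exact ((isInvertible_of_pos hy).inverse_apply_eq.2 hsy.symm).symm
  have hfs : ContDiffAt ℝ ∞ f y₀ :=
    (contDiffAt_const.mul (hP.clm_apply hs')).congr_of_eventuallyEq hf
  refine ⟨hfs, fun a ↦ ?_⟩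
  have dB := (hB.differentiableAt (by simp)).hasFDerivAt
  have dP := (hP.differentiableAt (by simp)).hasFDerivAt
  have ds := (hs'.differentiableAt (by simp)).hasFDerivAt
  have e1 : fderiv ℝ f y₀ = (1 / 2 : ℝ) • fderiv ℝ (fun y ↦ P y (s y)) y₀ := by
    rw [Filter.EventuallyEq.fderiv_eq hf]
    exact fderiv_const_mul (dP.clm_apply ds).differentiableAt _
  have e2 := congrArg (fun T ↦ T a (s y₀)) (((dB.clm_apply ds).congr_of_eventuallyEq
    (EventuallyEq.symm hs)).unique dP)
  rw [e1, (dP.clm_apply ds).fderiv]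
  simp only [ContinuousLinearMap.comp_apply, ContinuousLinearMap.flip_apply, smul_apply,
    smul_eq_mul, add_apply] at e2 ⊢
  rw [hsymm, hs.self_of_nhds] at e2
  linarith

end Legendre

section Sasaki

variable {n : ℕ} {L : Type*} [TopologicalSpace L] [ChartedSpace (Eucl n) L]
  [IsManifold 𝓘(ℝ, Eucl n) ∞ L] {m : ℕ} {M : Type*} [TopologicalSpace M]
  [ChartedSpace (Eucl m) M] [IsManifold 𝓘(ℝ, Eucl m) ∞ M]
  {Ω : SymplecticForm m M} {ι : L → M} {ψ : OpenPartialHomeomorph M (Cotangent n L)}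

theorem IsDarbouxChart.contMDiffAt_base (hψ : IsDarbouxChart Ω ι ψ) {z : M} (hz : z ∈ ψ.source) :
    ContMDiffAt 𝓘(ℝ, Eucl m) 𝓘(ℝ, Eucl n) ∞ (fun y ↦ (ψ y).1) z :=
  (contMDiffAt_totalSpace.1 (hψ.smooth.contMDiffAt (ψ.open_source.mem_nhds hz))).1

theorem IsDarbouxChart.contMDiffAt_fibreCoord (hψ : IsDarbouxChart Ω ι ψ) {z : M}
    (hz : z ∈ ψ.source) {q₀ : L} (hq : (ψ z).1 ∈ (chartAt (Eucl n) q₀).source) :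
    ContMDiffAt 𝓘(ℝ, Eucl m) 𝓘(ℝ, Eucl n →L[ℝ] ℝ) ∞ (fibreCoord ψ q₀) z := by
  have h1 := hψ.smooth.contMDiffAt (ψ.open_source.mem_nhds hz)
  have h2 := ((trivializationAt (Eucl n →L[ℝ] ℝ)
    (fun q : L ↦ TangentSpace 𝓘(ℝ, Eucl n) q →L[ℝ] ℝ) q₀).contMDiffAt_iff (by
      rw [Trivialization.mem_source, hom_trivializationAt_baseSet]
      exact ⟨hq, mem_univ _⟩)).1 h1
  refine h2.2.congr_of_eventuallyEq ?_
  filter_upwards [h2.1.continuousAt ((chartAt (Eucl n) q₀).open_source.mem_nhds hq)] with y hy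
  have hy' : (ψ y).1 ∈ (chartAt (Eucl n) q₀).source := hy
  rw [hom_trivializationAt_apply]
  change _ = ContinuousLinearMap.inCoordinates _ _ _ _ _ _ _ _ _
  rw [ContinuousLinearMap.inCoordinates, symmL_trivializationAt_tangent hy']
  refine ContinuousLinearMap.ext fun w ↦ ?_
  exact (congrArg (fun T : ℝ →L[ℝ] ℝ ↦ T (fibreCoord ψ q₀ y w))
    (Bundle.Trivial.continuousLinearMapAt_trivialization ℝ L ℝ (ψ y).1)).symm

/-- The base coordinate `y ↦ q(y)`, in the preferred charts of `M` at `x₀` and of `L` at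
`q(x₀)`. -/
def qCoord (ψ : OpenPartialHomeomorph M (Cotangent n L)) (x₀ : M) (y : Eucl m) : Eucl n :=
  chartAt (Eucl n) (ψ x₀).1 (ψ ((chartAt (Eucl m) x₀).symm y)).1

/-- The fibre coordinate `y ↦ p(y)`, in the preferred charts of `M` at `x₀` and of `L` at
`q(x₀)`. -/
def pCoord (ψ : OpenPartialHomeomorph M (Cotangent n L)) (x₀ : M) (y : Eucl m) :
    Eucl n →L[ℝ] ℝ :=
  fibreCoord ψ (ψ x₀).1 ((chartAt (Eucl m) x₀).symm y)

/-- The points `y` of the preferred chart of `M` at `x₀` at which `qCoord` and `pCoord` are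
coordinates of `ψ`. -/
def coordDomain (m : ℕ) {M : Type*} [TopologicalSpace M] [ChartedSpace (Eucl m) M]
    (ψ : OpenPartialHomeomorph M (Cotangent n L)) (x₀ : M) : Set (Eucl m) :=
  (chartAt (Eucl m) x₀).target ∩ (chartAt (Eucl m) x₀).symm ⁻¹'
    (ψ.source ∩ ψ ⁻¹' (TotalSpace.proj ⁻¹' (chartAt (Eucl n) (ψ x₀).1).source))

theorem isOpen_coordDomain (x₀ : M) : IsOpen (coordDomain m ψ x₀) :=
  (chartAt (Eucl m) x₀).isOpen_inter_preimage_symm (ψ.isOpen_inter_preimage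
    ((chartAt (Eucl n) (ψ x₀).1).open_source.preimage (FiberBundle.continuous_proj _ _)))

theorem mem_coordDomain {x₀ : M} (hx₀ : x₀ ∈ ψ.source) :
    chartAt (Eucl m) x₀ x₀ ∈ coordDomain m ψ x₀ := by
  refine ⟨mem_chart_target _ _, ?_⟩
  rw [mem_preimage, (chartAt (Eucl m) x₀).left_inv (mem_chart_source _ _)]
  exact ⟨hx₀, mem_chart_source (Eucl n) (ψ x₀).1⟩

namespace IsDarbouxChart

theorem contDiffAt_qCoord (hψ : IsDarbouxChart Ω ι ψ) {x₀ : M} {y : Eucl m}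
    (hy : y ∈ coordDomain m ψ x₀) : ContDiffAt ℝ ∞ (qCoord ψ x₀) y :=
  contDiffAt_chart_comp ((hψ.contMDiffAt_base hy.2.1).comp y (contMDiffAt_chart_symm hy.1)) hy.2.2

theorem contDiffAt_pCoord (hψ : IsDarbouxChart Ω ι ψ) {x₀ : M} {y : Eucl m}
    (hy : y ∈ coordDomain m ψ x₀) : ContDiffAt ℝ ∞ (pCoord ψ x₀) y :=
  contMDiffAt_iff_contDiffAt.1
    ((hψ.contMDiffAt_fibreCoord hy.2.1 hy.2.2).comp y (contMDiffAt_chart_symm hy.1))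

theorem fderiv_qCoord (hψ : IsDarbouxChart Ω ι ψ) {x₀ : M} {y : Eucl m}
    (hy : y ∈ coordDomain m ψ x₀) (a : Eucl m) :
    fderiv ℝ (qCoord ψ x₀) y a = chartDeriv (ψ x₀).1 (ψ ((chartAt (Eucl m) x₀).symm y)).1
      (dq ψ ((chartAt (Eucl m) x₀).symm y) (chartSymmDeriv x₀ y a)) := by
  have h1 := (hψ.contMDiffAt_base hy.2.1).mdifferentiableAt (by simp)
  have h2 := h1.hasMFDerivAt.comp y (hasMFDerivAt_chart_symm hy.1)
  have h3 := hasFDerivAt_chart_comp h2.mdifferentiableAt hy.2.2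
  rw [h2.mfderiv] at h3
  exact congrArg (fun T ↦ T a) h3.fderiv

theorem pCoord_chartDeriv {x₀ : M} {y : Eucl m} (hy : y ∈ coordDomain m ψ x₀)
    (w : TangentSpace 𝓘(ℝ, Eucl n) (ψ ((chartAt (Eucl m) x₀).symm y)).1) :
    pCoord ψ x₀ y (chartDeriv (ψ x₀).1 (ψ ((chartAt (Eucl m) x₀).symm y)).1 w) =
      (ψ ((chartAt (Eucl m) x₀).symm y)).2 w :=
  congrArg (ψ ((chartAt (Eucl m) x₀).symm y)).2 (chartSymmDeriv_chartDeriv hy.2.2 w)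

/-- The Liouville form is `p dq`, in coordinates. -/
theorem covectorInChart_liouville (hψ : IsDarbouxChart Ω ι ψ) {x₀ : M} {y : Eucl m}
    (hy : y ∈ coordDomain m ψ x₀) :
    covectorInChart (liouville ψ) x₀ y = (pCoord ψ x₀ y).comp (fderiv ℝ (qCoord ψ x₀) y) := by
  ext a
  rw [ContinuousLinearMap.comp_apply, hψ.fderiv_qCoord hy, pCoord_chartDeriv hy]
  rfl

theorem contDiffAt_covectorInChart (hψ : IsDarbouxChart Ω ι ψ) {x₀ : M} {y : Eucl m}
    (hy : y ∈ coordDomain m ψ x₀) : ContDiffAt ℝ ∞ (covectorInChart (liouville ψ) x₀) y := by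
  have h1 : ContDiffAt ℝ ∞ (fun y ↦ (pCoord ψ x₀ y).comp (fderiv ℝ (qCoord ψ x₀) y)) y :=
    (hψ.contDiffAt_pCoord hy).clm_comp ((hψ.contDiffAt_qCoord hy).fderiv_right (by simp))
  refine h1.congr_of_eventuallyEq ?_
  filter_upwards [(isOpen_coordDomain x₀).mem_nhds hy] with y' hy' using
    hψ.covectorInChart_liouville hy'

theorem dq_eq (hψ : IsDarbouxChart Ω ι ψ) {x : M} (hx : x ∈ ψ.source)
    (a : TangentSpace 𝓘(ℝ, Eucl m) x) :
    dq ψ x a = fderiv ℝ (qCoord ψ x) (chartAt (Eucl m) x x) a := by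
  have h := hψ.fderiv_qCoord (mem_coordDomain hx) a
  rw [h, (chartAt (Eucl m) x).left_inv (mem_chart_source _ _)]
  refine Eq.trans ?_ (chartDeriv_self _ _).symm
  exact congrArg (dq ψ x) (chartSymmDeriv_self x a).symm

theorem dFibre_eq (hψ : IsDarbouxChart Ω ι ψ) {x : M} (hx : x ∈ ψ.source)
    (a : TangentSpace 𝓘(ℝ, Eucl m) x) :
    dFibre ψ x a = fderiv ℝ (pCoord ψ x) (chartAt (Eucl m) x x) a := by
  have hx' : (chartAt (Eucl m) x).symm (chartAt (Eucl m) x x) = x :=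
    (chartAt (Eucl m) x).left_inv (mem_chart_source _ _)
  have h1 : HasMFDerivAt 𝓘(ℝ, Eucl m) 𝓘(ℝ, Eucl n →L[ℝ] ℝ) (fibreCoord ψ (ψ x).1)
      ((chartAt (Eucl m) x).symm (chartAt (Eucl m) x x)) (dFibre ψ x) := by
    rw [hx']
    exact ((hψ.contMDiffAt_fibreCoord hx (mem_chart_source (Eucl n) (ψ x).1)).mdifferentiableAt
      (by simp)).hasMFDerivAt
  have h2 : HasFDerivAt (pCoord ψ x) ((show Eucl m →L[ℝ] Eucl n →L[ℝ] ℝ from dFibre ψ x).comp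
      (chartSymmDeriv x (chartAt (Eucl m) x x))) (chartAt (Eucl m) x x) :=
    hasMFDerivAt_iff_hasFDerivAt.1 (h1.comp (chartAt (Eucl m) x x)
      (hasMFDerivAt_chart_symm (mem_chart_target (Eucl m) x)))
  have h3 : ∀ b : Eucl m, fderiv ℝ (pCoord ψ x) (chartAt (Eucl m) x x) b =
      dFibre ψ x (chartSymmDeriv x (chartAt (Eucl m) x x) b) := fun b ↦
    congrArg (fun T : Eucl m →L[ℝ] Eucl n →L[ℝ] ℝ ↦ T b) h2.fderiv
  exact ((h3 a).trans (congrArg (dFibre ψ x) (chartSymmDeriv_self x a))).symm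

end IsDarbouxChart

end Sasaki

section FibreEnergy

variable {n : ℕ} {L : Type*} [TopologicalSpace L] [ChartedSpace (Eucl n) L]
  [IsManifold 𝓘(ℝ, Eucl n) ∞ L] {m : ℕ} {M : Type*} [TopologicalSpace M]
  [ChartedSpace (Eucl m) M] [IsManifold 𝓘(ℝ, Eucl m) ∞ M]
  {Ω : SymplecticForm m M} {ι : L → M} {ψ : OpenPartialHomeomorph M (Cotangent n L)}

theorem inner_sharp (g : RMetric n L) (q : L) (p : TangentSpace 𝓘(ℝ, Eucl n) q →L[ℝ] ℝ) :
    g.inner q (sharp g q p) = p := (exists_sharp g q p).choose_spec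

theorem inner_self_nonneg (g : RMetric n L) (q : L) (u : TangentSpace 𝓘(ℝ, Eucl n) q) :
    0 ≤ g.inner q u u := by
  rcases eq_or_ne u 0 with rfl | h
  · simp
  · exact (g.pos q u h).le

theorem inner_sq_le (g : RMetric n L) (q : L) (u w : TangentSpace 𝓘(ℝ, Eucl n) q) :
    g.inner q u w ^ 2 ≤ g.inner q u u * g.inner q w w := by
  have hB := LinearMap.BilinForm.apply_sq_le_of_symm
    (LinearMap.mk₂ ℝ (fun u v ↦ g.inner q u v) (by simp) (by simp) (by simp) (by simp))
    (by simpa using inner_self_nonneg g q) ⟨fun u v ↦ by simpa using g.symm q u v⟩ u w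
  simpa using hB

theorem bilinInChart_symm (g : RMetric n L) (q : L) (y u w : Eucl n) :
    bilinInChart g.inner q y u w = bilinInChart g.inner q y w u := g.symm _ _ _

theorem christoffel_symm (g : RMetric n L) (q : L) (u w a : Eucl n) :
    christoffel g q u w a = christoffel g q w u a := by
  have hd : DifferentiableAt ℝ (bilinInChart g.inner q) (chartAt (Eucl n) q q) :=
    ((contDiffOn_bilinInChart g.contMDiff q).contDiffAt
      ((chartAt (Eucl n) q).open_target.mem_nhds (mem_chart_target _ _))).differentiableAt (by simp)
  have h1 : ∀ u w, HasFDerivAt (fun y ↦ bilinInChart g.inner q y u w)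
      (((fderiv ℝ (bilinInChart g.inner q) (chartAt (Eucl n) q q)).flip u).flip w)
      (chartAt (Eucl n) q q) := by
    intro u w
    have h := (hd.hasFDerivAt.clm_apply (hasFDerivAt_const u _)).clm_apply (hasFDerivAt_const w _)
    refine h.congr_fderiv ?_
    ext a
    simp
  have h2 : fderiv ℝ (bilinInChart g.inner q) (chartAt (Eucl n) q q) a u w =
      fderiv ℝ (bilinInChart g.inner q) (chartAt (Eucl n) q q) a w u := by
    have h := h1 w u
    simp only [bilinInChart_symm g q _ w u] at h
    exact DFunLike.congr_fun ((h1 u w).unique h) a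
  simp only [christoffel, h2]
  ring

set_option synthInstance.maxHeartbeats 200000 in
theorem christoffel_self (g : RMetric n L) (q : L) (u w : Eucl n) : christoffel g q u w w =
    1 / 2 * fderiv ℝ (bilinInChart g.inner q) (chartAt (Eucl n) q q) u w w := by
  simp only [christoffel]
  ring

set_option synthInstance.maxHeartbeats 200000 in
theorem christoffel_neg (g : RMetric n L) (q : L) (u w a : Eucl n) :
    christoffel g q (-u) w a = -christoffel g q u w a := by
  simp only [christoffel, map_neg, neg_apply]
  ring

/-- The exterior derivative of `P dQ` is `dP ∧ dQ`. -/
theorem fderiv_comp_fderiv_sub {X F : Type*} [NormedAddCommGroup X] [NormedSpace ℝ X]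
    [NormedAddCommGroup F] [NormedSpace ℝ F] {P : X → F →L[ℝ] ℝ} {Q : X → F} {T : X → X →L[ℝ] ℝ}
    {y : X} (hP : ContDiffAt ℝ ∞ P y) (hQ : ContDiffAt ℝ ∞ Q y)
    (hT : ∀ᶠ y in 𝓝 y, T y = (P y).comp (fderiv ℝ Q y)) (a b : X) :
    fderiv ℝ T y a b - fderiv ℝ T y b a =
      fderiv ℝ P y a (fderiv ℝ Q y b) - fderiv ℝ P y b (fderiv ℝ Q y a) := by
  have dP := (hP.differentiableAt (by simp)).hasFDerivAt
  have dQ := ((hQ.fderiv_right (m := ∞) (by simp)).differentiableAt (by simp)).hasFDerivAt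
  have hD : HasFDerivAt T _ y := (dP.clm_comp dQ).congr_of_eventuallyEq hT
  have hsymm := (hQ.isSymmSndFDerivAt
    (by rw [minSmoothness_of_isRCLikeNormedField]; exact two_le_infty)).eq a b
  rw [hD.fderiv]
  simp only [add_apply, ContinuousLinearMap.comp_apply, ContinuousLinearMap.compL_apply,
    ContinuousLinearMap.flip_apply]
  rw [hsymm]
  ring

/-- In coordinates, `ω = -d(p dq) = dq ∧ dp`. -/
theorem IsDarbouxChart.form_eq_dFibre (hψ : IsDarbouxChart Ω ι ψ) {x : M} (hx : x ∈ ψ.source)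
    (a b : TangentSpace 𝓘(ℝ, Eucl m) x) :
    Ω.form x a b = dFibre ψ x b (dq ψ x a) - dFibre ψ x a (dq ψ x b) := by
  have hy := mem_coordDomain (m := m) hx
  have e : ∀ a b : TangentSpace 𝓘(ℝ, Eucl m) x, dFibre ψ x b (dq ψ x a) =
      fderiv ℝ (pCoord ψ x) (chartAt (Eucl m) x x) b
        (fderiv ℝ (qCoord ψ x) (chartAt (Eucl m) x x) a) := fun a b ↦ by
    rw [hψ.dFibre_eq hx]
    exact congrArg _ (hψ.dq_eq hx a)
  have key := fderiv_comp_fderiv_sub (hψ.contDiffAt_pCoord hy) (hψ.contDiffAt_qCoord hy) (by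
    filter_upwards [(isOpen_coordDomain x).mem_nhds hy] with y' hy' using
      hψ.covectorInChart_liouville hy') a b
  rw [hψ.symplectic x hx, e, e]
  exact (congrArg Neg.neg key).trans (neg_sub _ _)

/-- By the symmetry of the Christoffel symbols, horizontal spaces are Lagrangian, and `ω` pairs
horizontal with vertical parts. -/
theorem IsDarbouxChart.form_eq_connectionMap (hψ : IsDarbouxChart Ω ι ψ) (g : RMetric n L) {x : M}
    (hx : x ∈ ψ.source) (a b : TangentSpace 𝓘(ℝ, Eucl m) x) :
    Ω.form x a b = connectionMap ψ g x b (dq ψ x a) - connectionMap ψ g x a (dq ψ x b) := by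
  have h := christoffel_symm g (ψ x).1 (dq ψ x b) (dq ψ x a) (sharp g (ψ x).1 (ψ x).2)
  rw [hψ.form_eq_dFibre hx, connectionMap, connectionMap]
  linarith

theorem connectionMap_neg (g : RMetric n L) (x : M) (a : TangentSpace 𝓘(ℝ, Eucl m) x)
    (w : TangentSpace 𝓘(ℝ, Eucl n) (ψ x).1) :
    connectionMap ψ g x (-a) w = -connectionMap ψ g x a w := by
  have h := christoffel_neg g (ψ x).1 (dq ψ x a) w (sharp g (ψ x).1 (ψ x).2)
  have h1 : dq ψ x (-a) = -dq ψ x a := map_neg _ _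
  have h2 : dFibre ψ x (-a) w = -dFibre ψ x a w := by rw [map_neg]; rfl
  have h3 : christoffel g (ψ x).1 (dq ψ x (-a)) w (sharp g (ψ x).1 (ψ x).2) =
      -christoffel g (ψ x).1 (dq ψ x a) w (sharp g (ψ x).1 (ψ x).2) :=
    (congrArg (fun u ↦ christoffel g (ψ x).1 u w (sharp g (ψ x).1 (ψ x).2)) h1).trans h
  rw [connectionMap, connectionMap]
  linarith

/-- The kinetic energy `½ |p|²` of the fibre coordinate. -/
def fibreEnergy (ψ : OpenPartialHomeomorph M (Cotangent n L)) (g : RMetric n L) (x : M) : ℝ :=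
  1 / 2 * (ψ x).2 (sharp g (ψ x).1 (ψ x).2)

omit [ChartedSpace (Eucl m) M] [IsManifold 𝓘(ℝ, Eucl m) ∞ M] in
theorem two_mul_fibreEnergy (g : RMetric n L) (x : M) : 2 * fibreEnergy ψ g x =
    g.inner (ψ x).1 (sharp g (ψ x).1 (ψ x).2) (sharp g (ψ x).1 (ψ x).2) := by
  rw [inner_sharp, fibreEnergy]
  ring

theorem fibreEnergy_nonneg (g : RMetric n L) (x : M) : 0 ≤ fibreEnergy ψ g x := by
  have := two_mul_fibreEnergy (ψ := ψ) g x
  linarith [inner_self_nonneg g (ψ x).1 (sharp g (ψ x).1 (ψ x).2)]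

theorem covNorm_eq (g : RMetric n L) (x : M) : covNorm g (ψ x) = √(2 * fibreEnergy ψ g x) := by
  rw [covNorm, fibreEnergy]
  ring_nf

set_option synthInstance.maxHeartbeats 200000 in
theorem IsDarbouxChart.contDiffAt_fibreEnergy (hψ : IsDarbouxChart Ω ι ψ) (g : RMetric n L) {x : M}
    (hx : x ∈ ψ.source) :
    ContDiffAt ℝ ∞ (fun y ↦ fibreEnergy ψ g ((chartAt (Eucl m) x).symm y)) (chartAt (Eucl m) x x) ∧
    ∀ a : TangentSpace 𝓘(ℝ, Eucl m) x,
      fderiv ℝ (fun y ↦ fibreEnergy ψ g ((chartAt (Eucl m) x).symm y)) (chartAt (Eucl m) x x) a =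
        connectionMap ψ g x a (sharp g (ψ x).1 (ψ x).2) := by
  have hy := mem_coordDomain (m := m) hx
  have hx' : (chartAt (Eucl m) x).symm (chartAt (Eucl m) x x) = x :=
    (chartAt (Eucl m) x).left_inv (mem_chart_source _ _)
  have hG : ContDiffAt ℝ ∞ (bilinInChart g.inner (ψ x).1) (qCoord ψ x (chartAt (Eucl m) x x)) :=
    (contDiffOn_bilinInChart g.contMDiff (ψ x).1).contDiffAt
      ((chartAt (Eucl n) (ψ x).1).open_target.mem_nhds
        ((chartAt (Eucl n) (ψ x).1).map_source hy.2.2))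
  have hev := (isOpen_coordDomain x).mem_nhds hy
  set s : Eucl m → Eucl n := fun y ↦ chartDeriv (ψ x).1 (ψ ((chartAt (Eucl m) x).symm y)).1
    (sharp g (ψ ((chartAt (Eucl m) x).symm y)).1 (ψ ((chartAt (Eucl m) x).symm y)).2) with hs
  obtain ⟨h1, h2⟩ := contDiffAt_dualForm (B := fun y ↦ bilinInChart g.inner (ψ x).1 (qCoord ψ x y))
    (P := pCoord ψ x) (s := s) (f := fun y ↦ fibreEnergy ψ g ((chartAt (Eucl m) x).symm y))
    (hG.comp _ (hψ.contDiffAt_qCoord hy)) (hψ.contDiffAt_pCoord hy)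
    (fun u w ↦ bilinInChart_symm g _ _ u w)
    (by
      filter_upwards [hev] with y hy u hu
      obtain ⟨a, rfl⟩ := exists_chartDeriv_eq hy.2.2 u
      rw [qCoord, bilinInChart_apply g.inner hy.2.2]
      exact g.pos _ _ fun h ↦ hu (by rw [h, map_zero]))
    (by
      filter_upwards [hev] with y hy
      ext u
      obtain ⟨a, rfl⟩ := exists_chartDeriv_eq hy.2.2 u
      rw [qCoord, hs, bilinInChart_apply g.inner hy.2.2, inner_sharp]
      exact (IsDarbouxChart.pCoord_chartDeriv hy a).symm)
    (by
      filter_upwards [hev] with y hy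
      rw [hs, fibreEnergy]
      exact congrArg _ (IsDarbouxChart.pCoord_chartDeriv hy _).symm)
  refine ⟨h1, fun a ↦ (h2 a).trans ?_⟩
  have hs0 : s (chartAt (Eucl m) x x) = sharp g (ψ x).1 (ψ x).2 := by
    have h : ∀ z, z = x → chartDeriv (ψ x).1 (ψ z).1 (sharp g (ψ z).1 (ψ z).2) =
        sharp g (ψ x).1 (ψ x).2 := by
      rintro z rfl
      exact chartDeriv_self _ _
    exact h _ hx'
  have hq0 : qCoord ψ x (chartAt (Eucl m) x x) = chartAt (Eucl n) (ψ x).1 (ψ x).1 := by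
    rw [qCoord, hx']
  have hd : fderiv ℝ (fun y ↦ bilinInChart g.inner (ψ x).1 (qCoord ψ x y)) (chartAt (Eucl m) x x) a
      = fderiv ℝ (bilinInChart g.inner (ψ x).1) (chartAt (Eucl n) (ψ x).1 (ψ x).1) (dq ψ x a) := by
    have h := (hG.differentiableAt (by simp)).hasFDerivAt.comp _
      ((hψ.contDiffAt_qCoord hy).differentiableAt (by simp)).hasFDerivAt
    rw [hq0] at h
    exact (DFunLike.congr_fun h.fderiv a).trans (congrArg _ (hψ.dq_eq hx a).symm)
  have h3 := christoffel_self g (ψ x).1 (dq ψ x a) (sharp g (ψ x).1 (ψ x).2)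
  rw [hd, hs0, connectionMap, hψ.dFibre_eq hx]
  exact congrArg (fun r ↦ _ - r) h3.symm

theorem IsDarbouxChart.contMDiffAt_fibreEnergy (hψ : IsDarbouxChart Ω ι ψ) (g : RMetric n L)
    {x : M} (hx : x ∈ ψ.source) :
    ContMDiffAt 𝓘(ℝ, Eucl m) 𝓘(ℝ, ℝ) ∞ (fibreEnergy ψ g) x := by
  have h1 : ContMDiffAt 𝓘(ℝ, Eucl m) 𝓘(ℝ, Eucl m) ∞ (chartAt (Eucl m) x) x :=
    (contMDiffOn_chart (I := 𝓘(ℝ, Eucl m)) (n := ∞) (x := x)).contMDiffAt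
      ((chartAt (Eucl m) x).open_source.mem_nhds (mem_chart_source _ x))
  refine ((hψ.contDiffAt_fibreEnergy g hx).1.contMDiffAt.comp x h1).congr_of_eventuallyEq ?_
  filter_upwards [(chartAt (Eucl m) x).open_source.mem_nhds (mem_chart_source _ x)] with z hz
  exact congrArg _ ((chartAt (Eucl m) x).left_inv hz).symm

/-- The differential of the kinetic energy. -/
def dFibreEnergy (ψ : OpenPartialHomeomorph M (Cotangent n L)) (g : RMetric n L) (x : M) :
    TangentSpace 𝓘(ℝ, Eucl m) x →L[ℝ] ℝ :=
  mfderiv 𝓘(ℝ, Eucl m) 𝓘(ℝ, ℝ) (fibreEnergy ψ g) x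

theorem IsDarbouxChart.hasMFDerivAt_fibreEnergy (hψ : IsDarbouxChart Ω ι ψ) (g : RMetric n L)
    {x : M} (hx : x ∈ ψ.source) :
    HasMFDerivAt 𝓘(ℝ, Eucl m) 𝓘(ℝ, ℝ) (fibreEnergy ψ g) x (dFibreEnergy ψ g x) :=
  ((hψ.contMDiffAt_fibreEnergy g hx).mdifferentiableAt (by simp)).hasMFDerivAt

/-- The differential of the kinetic energy is the pairing of the vertical part with `p^♯`; in
particular it vanishes on horizontal vectors. -/
theorem IsDarbouxChart.dFibreEnergy_apply (hψ : IsDarbouxChart Ω ι ψ) (g : RMetric n L)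
    {x : M} (hx : x ∈ ψ.source) (a : TangentSpace 𝓘(ℝ, Eucl m) x) :
    dFibreEnergy ψ g x a =
      connectionMap ψ g x a (sharp g (ψ x).1 (ψ x).2) := by
  have h1 := hψ.hasMFDerivAt_fibreEnergy g hx
  have hx' : (chartAt (Eucl m) x).symm (chartAt (Eucl m) x x) = x :=
    (chartAt (Eucl m) x).left_inv (mem_chart_source _ _)
  have h2 : HasFDerivAt (fun y ↦ fibreEnergy ψ g ((chartAt (Eucl m) x).symm y))
      ((show Eucl m →L[ℝ] ℝ from dFibreEnergy ψ g x).comp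
        (chartSymmDeriv x (chartAt (Eucl m) x x))) (chartAt (Eucl m) x x) := by
    have h3 : HasMFDerivAt 𝓘(ℝ, Eucl m) 𝓘(ℝ, ℝ) (fibreEnergy ψ g)
        ((chartAt (Eucl m) x).symm (chartAt (Eucl m) x x)) (dFibreEnergy ψ g x) := by
      rw [hx']
      exact h1
    exact hasMFDerivAt_iff_hasFDerivAt.1
      (h3.comp _ (hasMFDerivAt_chart_symm (mem_chart_target (Eucl m) x)))
  have h4 := (hψ.contDiffAt_fibreEnergy g hx).2 a
  rw [h2.fderiv] at h4
  refine Eq.trans ?_ h4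
  exact congrArg (dFibreEnergy ψ g x) (chartSymmDeriv_self x a).symm

variable {J : CompatibleACS Ω} {g : RMetric n L} {V : Set M}

namespace IsSasakianOn

theorem connectionMap_eq (hS : IsSasakianOn J ψ g V) {x : M} (hx : x ∈ V)
    (a : TangentSpace 𝓘(ℝ, Eucl m) x) (w : TangentSpace 𝓘(ℝ, Eucl n) (ψ x).1) :
    connectionMap ψ g x a w = -g.inner (ψ x).1 (dq ψ x (J.J x a)) w := by
  rw [← hS x hx, J.sq, connectionMap_neg, neg_neg]

/-- The Sasakian metric: horizontal and vertical parts are orthogonal, and each carries `g`. -/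
theorem form_J_eq (hS : IsSasakianOn J ψ g V) (hψ : IsDarbouxChart Ω ι ψ) {x : M} (hx : x ∈ V)
    (hxs : x ∈ ψ.source) (a : TangentSpace 𝓘(ℝ, Eucl m) x) :
    Ω.form x a (J.J x a) = g.inner (ψ x).1 (dq ψ x a) (dq ψ x a) +
      g.inner (ψ x).1 (dq ψ x (J.J x a)) (dq ψ x (J.J x a)) := by
  rw [hψ.form_eq_connectionMap g hxs, hS x hx, hS.connectionMap_eq hx, sub_neg_eq_add]

/-- `df ∘ J = Θ` for `f = ½ |p|²`. -/
theorem dFibreEnergy_J (hS : IsSasakianOn J ψ g V) (hψ : IsDarbouxChart Ω ι ψ) {x : M}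
    (hx : x ∈ V) (hxs : x ∈ ψ.source) (a : TangentSpace 𝓘(ℝ, Eucl m) x) :
    dFibreEnergy ψ g x (J.J x a) = liouville ψ x a := by
  rw [hψ.dFibreEnergy_apply g hxs, hS x hx, g.symm, inner_sharp]
  rfl

/-- The gradient of `f = ½ |p|²` has norm at most `|p|`. -/
theorem dFibreEnergy_sq_le (hS : IsSasakianOn J ψ g V) (hψ : IsDarbouxChart Ω ι ψ) {x : M}
    (hx : x ∈ V) (hxs : x ∈ ψ.source) (a : TangentSpace 𝓘(ℝ, Eucl m) x) :
    dFibreEnergy ψ g x a ^ 2 ≤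
      2 * fibreEnergy ψ g x * Ω.form x a (J.J x a) := by
  rw [hψ.dFibreEnergy_apply g hxs, hS.connectionMap_eq hx, neg_sq, hS.form_J_eq hψ hx hxs,
    two_mul_fibreEnergy, mul_comm]
  refine (inner_sq_le g _ _ _).trans ?_
  exact mul_le_mul_of_nonneg_right (le_add_of_nonneg_left (inner_self_nonneg g _ _))
    (inner_self_nonneg g _ _)

end IsSasakianOn

end FibreEnergy

/-! ### Paths and distances -/

section PathLength

variable {m : ℕ} {M : Type*} [TopologicalSpace M] [ChartedSpace (Eucl m) M]
  [IsManifold 𝓘(ℝ, Eucl m) ∞ M] {Ω : SymplecticForm m M}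

/-- The velocity of a path. -/
def velocity (m : ℕ) {M : Type*} [TopologicalSpace M] [ChartedSpace (Eucl m) M] (γ : ℝ → M)
    (t : ℝ) : TangentSpace 𝓘(ℝ, Eucl m) (γ t) :=
  mfderiv 𝓘(ℝ, ℝ) 𝓘(ℝ, Eucl m) γ t (1 : ℝ)

/-- The length of a path with respect to the metric `Ω(·, J ·)`. -/
def pathLength (J : CompatibleACS Ω) (γ : ℝ → M) (a b : ℝ) : ℝ≥0∞ :=
  ∫⁻ t in Icc a b, ENNReal.ofReal √(Ω.form (γ t) (velocity m γ t) (J.J (γ t) (velocity m γ t)))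

theorem pathLength_mono (J : CompatibleACS Ω) (γ : ℝ → M) {a b a' b' : ℝ} (ha : a' ≤ a)
    (hb : b ≤ b') : pathLength J γ a b ≤ pathLength J γ a' b' :=
  lintegral_mono_set (Icc_subset_Icc ha hb)

theorem exists_path_of_distJ_lt (J : CompatibleACS Ω) {x y : M} {r : ℝ≥0∞} (h : distJ J x y < r) :
    ∃ γ : ℝ → M, γ 0 = x ∧ γ 1 = y ∧ ContMDiffOn 𝓘(ℝ, ℝ) 𝓘(ℝ, Eucl m) 1 γ (Icc 0 1) ∧
      pathLength J γ 0 1 < r := by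
  let _ : ∀ x : M, ENorm (TangentSpace 𝓘(ℝ, Eucl m) x) :=
    fun x ↦ ⟨fun u ↦ ENNReal.ofReal √(Ω.form x u (J.J x u))⟩
  obtain ⟨γ, h0, h1, h2, h3⟩ := exists_lt_of_riemannianEDist_lt (I := 𝓘(ℝ, Eucl m)) h
  rw [pathELength_eq_lintegral_mfderiv_Icc] at h3
  exact ⟨γ, h0, h1, h2, h3⟩

theorem distJ_le_pathLength (J : CompatibleACS Ω) {γ : ℝ → M} {a b : ℝ} (hab : a ≤ b)
    (hγ : ContMDiffOn 𝓘(ℝ, ℝ) 𝓘(ℝ, Eucl m) 1 γ (Icc a b)) :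
    distJ J (γ a) (γ b) ≤ pathLength J γ a b := by
  let _ : ∀ x : M, ENorm (TangentSpace 𝓘(ℝ, Eucl m) x) :=
    fun x ↦ ⟨fun u ↦ ENNReal.ofReal √(Ω.form x u (J.J x u))⟩
  have _ : ∀ x : M, ENormSMulClass ℝ (TangentSpace 𝓘(ℝ, Eucl m) x) := fun x ↦ ⟨fun c u ↦ by
    change ENNReal.ofReal √(Ω.form x (c • u) (J.J x (c • u))) =
      ‖c‖ₑ * ENNReal.ofReal √(Ω.form x u (J.J x u))
    have h : Ω.form x (c • u) (J.J x (c • u)) = c ^ 2 * Ω.form x u (J.J x u) := by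
      simp only [map_smul, smul_apply, smul_eq_mul]
      ring
    rw [h, Real.sqrt_mul (sq_nonneg c), Real.sqrt_sq_eq_abs, ENNReal.ofReal_mul (abs_nonneg c),
      ← Real.enorm_eq_ofReal_abs]⟩
  have h := riemannianEDist_le_pathELength (I := 𝓘(ℝ, Eucl m)) hγ rfl rfl hab
  rw [pathELength_eq_lintegral_mfderiv_Icc] at h
  exact h

end PathLength

section Distance

variable {n : ℕ} {L : Type*} [TopologicalSpace L] [ChartedSpace (Eucl n) L]
  [IsManifold 𝓘(ℝ, Eucl n) ∞ L] {m : ℕ} {M : Type*} [TopologicalSpace M]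
  [ChartedSpace (Eucl m) M] [IsManifold 𝓘(ℝ, Eucl m) ∞ M]
  {Ω : SymplecticForm m M} {ι : L → M} {ψ : OpenPartialHomeomorph M (Cotangent n L)}
  {J : CompatibleACS Ω} {g : RMetric n L} {V : Set M}

theorem covNorm_mk_zero (g : RMetric n L) (q : L) : covNorm g ⟨q, 0⟩ = 0 := by
  simp [covNorm]

theorem eq_zero_of_covNorm_eq_zero {g : RMetric n L} {ξ : Cotangent n L} (h : covNorm g ξ = 0) :
    ξ.2 = 0 := by
  obtain ⟨q, p⟩ := ξ
  have h1 : p (sharp g q p) = g.inner q (sharp g q p) (sharp g q p) := by rw [inner_sharp]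
  have h2 : p (sharp g q p) ≤ 0 := Real.sqrt_eq_zero'.1 h
  have h3 : sharp g q p = 0 := by
    by_contra hne
    linarith [g.pos q _ hne]
  change p = 0
  rw [← inner_sharp g q p, h3, map_zero]

/-- The norm of a covector `g(u, ·)` is that of `u`. -/
theorem covNorm_sq_of_inner_eq (g : RMetric n L) {q : L}
    {p : TangentSpace 𝓘(ℝ, Eucl n) q →L[ℝ] ℝ} {u : TangentSpace 𝓘(ℝ, Eucl n) q}
    (hu : g.inner q u = p) : covNorm g ⟨q, p⟩ ^ 2 = g.inner q u u := by
  have h : p (sharp g q p) = g.inner q u u := by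
    rw [← hu, g.symm, inner_sharp]
  rw [covNorm]
  change √(p (sharp g q p)) ^ 2 = _
  rw [h, Real.sq_sqrt (inner_self_nonneg g q u)]

theorem covNorm_smul (g : RMetric n L) (q : L) (p : TangentSpace 𝓘(ℝ, Eucl n) q →L[ℝ] ℝ) (c : ℝ) :
    covNorm g ⟨q, c • p⟩ = |c| * covNorm g ⟨q, p⟩ := by
  have h1 := covNorm_sq_of_inner_eq g (inner_sharp g q p)
  have h2 := covNorm_sq_of_inner_eq g (p := c • p) (u := c • sharp g q p) (by
    rw [map_smul, inner_sharp])
  have h3 : covNorm g ⟨q, c • p⟩ ^ 2 = (|c| * covNorm g ⟨q, p⟩) ^ 2 := by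
    rw [h2, mul_pow, sq_abs, h1]
    simp only [map_smul, smul_apply, smul_eq_mul]
    ring
  exact (sq_eq_sq₀ (Real.sqrt_nonneg _) (mul_nonneg (abs_nonneg c) (Real.sqrt_nonneg _))).1 h3

theorem IsDarbouxChart.continuousOn_covNorm (hψ : IsDarbouxChart Ω ι ψ) (g : RMetric n L) :
    ContinuousOn (fun x ↦ covNorm g (ψ x)) ψ.source := by
  simp only [covNorm_eq]
  exact Real.continuous_sqrt.comp_continuousOn (continuousOn_const.mul fun x hx ↦
    (hψ.contMDiffAt_fibreEnergy g hx).continuousAt.continuousWithinAt)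

theorem IsDarbouxChart.covNorm_of_mem_range (hψ : IsDarbouxChart Ω ι ψ) (g : RMetric n L) {x : M}
    (hx : x ∈ range ι) : covNorm g (ψ x) = 0 := by
  obtain ⟨q, rfl⟩ := hx
  rw [hψ.zero_section, covNorm_mk_zero]

theorem IsInnerNbhd.subset_source (hV : IsInnerNbhd ι ψ V) : V ⊆ ψ.source :=
  subset_closure.trans hV.closure_subset

/-- By compactness the minimum over `∂V` is attained, and `|p|` vanishes only on `L ⊆ V`. -/
theorem size_pos (hψ : IsDarbouxChart Ω ι ψ) (hV : IsInnerNbhd ι ψ V) (g : RMetric n L) :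
    0 < size ψ g V := by
  have hF : IsCompact (frontier V) :=
    hV.isCompact_closure.of_isClosed_subset isClosed_frontier frontier_subset_closure
  rcases (frontier V).eq_empty_or_nonempty with he | hne
  · simp [size, he]
  obtain ⟨x, hx, hmin⟩ := hF.exists_isMinOn hne ((hψ.continuousOn_covNorm g).mono
    (frontier_subset_closure.trans hV.closure_subset))
  have hpos : 0 < covNorm g (ψ x) := by
    refine lt_of_le_of_ne (Real.sqrt_nonneg _) fun h ↦ ?_
    have h1 : (ψ x).2 = 0 := eq_zero_of_covNorm_eq_zero h.symm
    have h2 : ψ x = ψ (ι (ψ x).1) := by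
      rw [hψ.zero_section, ← h1]
    have h3 : x = ι (ψ x).1 := ψ.injOn (hV.closure_subset (frontier_subset_closure hx))
      (hV.subset_source (hV.range_subset (mem_range_self _))) h2
    have h4 : x ∈ V := by
      rw [h3]
      exact hV.range_subset (mem_range_self _)
    rw [hV.isOpen.frontier_eq] at hx
    exact hx.2 h4
  refine (ENNReal.ofReal_pos.2 hpos).trans_le ?_
  exact le_iInf₂ fun y hy ↦ ENNReal.ofReal_le_ofReal (hmin hy)

theorem size_le_of_mem_frontier (ψ : OpenPartialHomeomorph M (Cotangent n L)) (g : RMetric n L)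
    {x : M} (hx : x ∈ frontier V) : size ψ g V ≤ ENNReal.ofReal (covNorm g (ψ x)) :=
  iInf₂_le x hx

/-- `|p|` at the start of a path in `V` which ends on `L` is at most the length of the path. -/
theorem IsSasakianOn.covNorm_le_pathLength (hS : IsSasakianOn J ψ g V) (hψ : IsDarbouxChart Ω ι ψ)
    (hVs : V ⊆ ψ.source) {γ : ℝ → M} {a b : ℝ} (hab : a ≤ b)
    (hγ : ContMDiffOn 𝓘(ℝ, ℝ) 𝓘(ℝ, Eucl m) 1 γ (Icc a b)) (hγV : ∀ t ∈ Icc a b, γ t ∈ V)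
    (hb : γ b ∈ range ι) : ENNReal.ofReal (covNorm g (ψ (γ a))) ≤ pathLength J γ a b := by
  have hfb : fibreEnergy ψ g (γ b) = 0 := by
    have h := hψ.covNorm_of_mem_range g hb
    rw [covNorm_eq, Real.sqrt_eq_zero'] at h
    linarith [fibreEnergy_nonneg (ψ := ψ) g (γ b)]
  -- `|p|` is not smooth on the zero section, `√(|p|² + ε²)` is
  have key : ∀ ε : ℝ, 0 < ε → ENNReal.ofReal (covNorm g (ψ (γ a)) - ε) ≤ pathLength J γ a b := by
    intro ε hε
    have hpos : ∀ t, 0 < 2 * fibreEnergy ψ g (γ t) + ε ^ 2 := fun t ↦ by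
      have := fibreEnergy_nonneg (ψ := ψ) g (γ t)
      positivity
    have hfC : ContDiffOn ℝ 1 (fun t ↦ fibreEnergy ψ g (γ t)) (Icc a b) := by
      rw [← contMDiffOn_iff_contDiffOn]
      intro t ht
      exact ((hψ.contMDiffAt_fibreEnergy g (hVs (hγV t ht))).of_le (by simp)).comp_contMDiffWithinAt
        t (hγ t ht)
    have hC : ContDiffOn ℝ 1 (fun t ↦ √(2 * fibreEnergy ψ g (γ t) + ε ^ 2)) (Icc a b) :=
      ((contDiffOn_const.mul hfC).add contDiffOn_const).sqrt fun t _ ↦ (hpos t).ne'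
    have h1 := enorm_sub_le_lintegral_deriv_of_contDiffOn_Icc hC hab
    have h2 : ∫⁻ t in Icc a b, ‖deriv (fun t ↦ √(2 * fibreEnergy ψ g (γ t) + ε ^ 2)) t‖ₑ ≤
        pathLength J γ a b := by
      rw [pathLength, ← restrict_Ioo_eq_restrict_Icc]
      refine setLIntegral_mono' measurableSet_Ioo fun t ht ↦ ?_
      have htV := hγV t (Ioo_subset_Icc_self ht)
      have dγ := ((hγ.contMDiffAt (Icc_mem_nhds ht.1 ht.2)).mdifferentiableAt
        (by simp)).hasMFDerivAt
      have df' : HasFDerivAt (fun t ↦ fibreEnergy ψ g (γ t))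
          ((show Eucl m →L[ℝ] ℝ from dFibreEnergy ψ g (γ t)).comp
            (show ℝ →L[ℝ] Eucl m from mfderiv 𝓘(ℝ, ℝ) 𝓘(ℝ, Eucl m) γ t)) t :=
        hasMFDerivAt_iff_hasFDerivAt.1 ((hψ.hasMFDerivAt_fibreEnergy g (hVs htV)).comp t dγ)
      have df : HasDerivAt (fun t ↦ fibreEnergy ψ g (γ t))
          (dFibreEnergy ψ g (γ t) (velocity m γ t)) t := df'.hasDerivAt
      have dh := ((df.const_mul 2).add_const (ε ^ 2)).sqrt (hpos t).ne'
      rw [dh.deriv, Real.enorm_eq_ofReal_abs]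
      refine ENNReal.ofReal_le_ofReal (Real.le_sqrt_of_sq_le ?_)
      have h3 := hS.dFibreEnergy_sq_le hψ htV (hVs htV) (velocity m γ t)
      have h4 := form_J_nonneg J (γ t) (velocity m γ t)
      rw [sq_abs, div_pow, mul_pow, mul_pow, Real.sq_sqrt (hpos t).le, div_le_iff₀ (by
        have := hpos t
        positivity)]
      nlinarith [sq_nonneg ε, mul_nonneg h4 (sq_nonneg ε)]
    refine le_trans ?_ (h1.trans h2)
    rw [Real.enorm_eq_ofReal_abs]
    refine ENNReal.ofReal_le_ofReal ?_
    rw [hfb, mul_zero, zero_add, Real.sqrt_sq hε.le, covNorm_eq, abs_sub_comm]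
    refine le_trans ?_ (le_abs_self _)
    gcongr
    linarith [sq_nonneg ε]
  have hlim : Tendsto (fun ε ↦ ENNReal.ofReal (covNorm g (ψ (γ a)) - ε)) (𝓝[>] (0 : ℝ))
      (𝓝 (ENNReal.ofReal (covNorm g (ψ (γ a)) - 0))) := by
    refine (ENNReal.continuous_ofReal.tendsto _).comp ?_
    exact (tendsto_const_nhds.sub tendsto_id).mono_left nhdsWithin_le_nhds
  rw [sub_zero] at hlim
  exact le_of_tendsto hlim (by filter_upwards [self_mem_nhdsWithin] with ε hε using key ε hε)

/-- A path which ends on `L` and is shorter than the size of `V` stays in `V`. -/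
theorem IsSasakianOn.mem_of_pathLength_lt (hS : IsSasakianOn J ψ g V) (hψ : IsDarbouxChart Ω ι ψ)
    (hV : IsInnerNbhd ι ψ V) {γ : ℝ → M}
    (hγ : ContMDiffOn 𝓘(ℝ, ℝ) 𝓘(ℝ, Eucl m) 1 γ (Icc 0 1)) (h1 : γ 1 ∈ range ι)
    (hlen : pathLength J γ 0 1 < size ψ g V) : ∀ t ∈ Icc (0 : ℝ) 1, γ t ∈ V := by
  by_contra! hex
  -- the last time outside `V`
  set T : Set ℝ := Icc 0 1 ∩ γ ⁻¹' Vᶜ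
  have hTc : IsClosed T :=
    hγ.continuousOn.preimage_isClosed_of_isClosed isClosed_Icc hV.isOpen.isClosed_compl
  have hTb : BddAbove T := ⟨1, fun t ht ↦ ht.1.2⟩
  have hTne : T.Nonempty := let ⟨t, ht, hV'⟩ := hex; ⟨t, ht, hV'⟩
  have hs : sSup T ∈ T := hTc.csSup_mem hTne hTb
  set s := sSup T
  have hs1 : s < 1 := lt_of_le_of_ne hs.1.2 fun h ↦ hs.2 (by rw [h]; exact hV.range_subset h1)
  have hafter : ∀ t ∈ Ioc s 1, γ t ∈ V := fun t ht ↦ by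
    by_contra hn
    exact ht.1.not_ge (le_csSup hTb ⟨⟨hs.1.1.trans ht.1.le, ht.2⟩, hn⟩)
  have hcont : ContinuousWithinAt γ (Ioc s 1) s :=
    (hγ.continuousOn s hs.1).mono fun t ht ↦ ⟨hs.1.1.trans ht.1.le, ht.2⟩
  have hne : (𝓝[Ioc s 1] s).NeBot := by
    rw [nhdsWithin_Ioc_eq_nhdsGT hs1]
    infer_instance
  have hcl : γ s ∈ closure V :=
    mem_closure_of_tendsto hcont (by filter_upwards [self_mem_nhdsWithin] with t ht using hafter t ht)
  have hfr : γ s ∈ frontier V := by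
    rw [hV.isOpen.frontier_eq]
    exact ⟨hcl, hs.2⟩
  have hsrc := hV.closure_subset hcl
  have hlim : Tendsto (fun t ↦ ENNReal.ofReal (covNorm g (ψ (γ t)))) (𝓝[Ioc s 1] s)
      (𝓝 (ENNReal.ofReal (covNorm g (ψ (γ s))))) :=
    (ENNReal.continuous_ofReal.tendsto _).comp
      (((hψ.continuousOn_covNorm g).continuousAt (ψ.open_source.mem_nhds hsrc)).tendsto.comp hcont)
  have hle : ENNReal.ofReal (covNorm g (ψ (γ s))) ≤ pathLength J γ 0 1 := by
    refine le_of_tendsto hlim ?_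
    filter_upwards [self_mem_nhdsWithin] with t ht
    refine (hS.covNorm_le_pathLength hψ hV.subset_source ht.2 (hγ.mono (Icc_subset_Icc
      (hs.1.1.trans ht.1.le) le_rfl)) (fun t' ht' ↦ hafter t' ⟨ht.1.trans_le ht'.1, ht'.2⟩) h1).trans
      (pathLength_mono J γ (hs.1.1.trans ht.1.le) le_rfl)
  exact ((size_le_of_mem_frontier ψ g hfr).trans hle).not_gt hlen

/-- Points closer to `L` than the size of `V` lie in `V`, and there `|p|` is at most the distance
to `L`. -/
theorem IsSasakianOn.mem_and_covNorm_le (hS : IsSasakianOn J ψ g V) (hψ : IsDarbouxChart Ω ι ψ)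
    (hV : IsInnerNbhd ι ψ V) {x : M} (hx : distTo J (range ι) x < size ψ g V) :
    x ∈ V ∧ ENNReal.ofReal (covNorm g (ψ x)) ≤ distTo J (range ι) x := by
  have key : ∀ r, distTo J (range ι) x < r → r ≤ size ψ g V →
      x ∈ V ∧ ENNReal.ofReal (covNorm g (ψ x)) ≤ r := by
    intro r hr hr'
    simp only [distTo, iInf_lt_iff] at hr
    obtain ⟨y, hy, hxy⟩ := hr
    obtain ⟨γ, rfl, rfl, hγ, hlen⟩ := exists_path_of_distJ_lt J hxy
    have hmem := hS.mem_of_pathLength_lt hψ hV hγ hy (hlen.trans_le hr')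
    exact ⟨hmem 0 (left_mem_Icc.2 zero_le_one),
      (hS.covNorm_le_pathLength hψ hV.subset_source zero_le_one hγ hmem hy).trans hlen.le⟩
  refine ⟨(key _ hx le_rfl).1, le_of_forall_gt fun r hr ↦ ?_⟩
  obtain ⟨r', h1, h2⟩ := exists_between (lt_min hr hx)
  exact (key r' h1 (h2.le.trans (min_le_right _ _))).2.trans_lt (h2.trans_le (min_le_left _ _))

/-! ### Radial paths -/

/-- The cotangent bundle is Hausdorff: points of one fibre are separated in a trivialization, points
of different fibres in the base. -/
theorem t2Space_cotangent [T2Space L] : T2Space (Cotangent n L) := by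
  refine ⟨fun ξ η hne ↦ ?_⟩
  have hπ : Continuous (TotalSpace.proj : Cotangent n L → L) := FiberBundle.continuous_proj _ _
  by_cases h : ξ.1 = η.1
  · set e := trivializationAt (Eucl n →L[ℝ] ℝ)
      (fun q : L ↦ TangentSpace 𝓘(ℝ, Eucl n) q →L[ℝ] ℝ) ξ.1 with he
    have hξ : ξ ∈ e.source := FiberBundle.mem_trivializationAt_proj_source
    have hη : η ∈ e.source := by
      rw [e.mem_source, ← h, ← e.mem_source]
      exact hξ
    obtain ⟨A, B, hA, hB, hξA, hηB, hAB⟩ :=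
      t2_separation (show e ξ ≠ e η from fun h' ↦ hne (e.injOn hξ hη h'))
    exact ⟨e.source ∩ e ⁻¹' A, e.source ∩ e ⁻¹' B,
      e.toOpenPartialHomeomorph.isOpen_inter_preimage hA,
      e.toOpenPartialHomeomorph.isOpen_inter_preimage hB, ⟨hξ, hξA⟩, ⟨hη, hηB⟩,
      Disjoint.mono inter_subset_right inter_subset_right (hAB.preimage e)⟩
  · obtain ⟨A, B, hA, hB, hξA, hηB, hAB⟩ := t2_separation h
    exact ⟨_, _, hA.preimage hπ, hB.preimage hπ, hξA, hηB, hAB.preimage _⟩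

/-- The segment from the covector `ξ` to the zero section, in the fibre through `ξ`. -/
def cotangentRay (ξ : Cotangent n L) (t : ℝ) : Cotangent n L := ⟨ξ.1, (1 - t) • ξ.2⟩

theorem contMDiff_cotangentRay (ξ : Cotangent n L) :
    ContMDiff 𝓘(ℝ, ℝ) (𝓘(ℝ, Eucl n).prod 𝓘(ℝ, Eucl n →L[ℝ] ℝ)) ∞ (cotangentRay ξ) := by
  intro t
  rw [contMDiffAt_totalSpace]
  refine ⟨contMDiffAt_const, ?_⟩
  set e := trivializationAt (Eucl n →L[ℝ] ℝ)
    (fun q : L ↦ TangentSpace 𝓘(ℝ, Eucl n) q →L[ℝ] ℝ) ξ.1 with he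
  have hξ : ξ.1 ∈ e.baseSet := FiberBundle.mem_baseSet_trivializationAt _ _ _
  have h : ∀ t, (e (cotangentRay ξ t)).2 = (1 - t) • (e ⟨ξ.1, ξ.2⟩).2 := fun t ↦
    (e.linear ℝ hξ).map_smul (1 - t) ξ.2
  change ContMDiffAt 𝓘(ℝ, ℝ) 𝓘(ℝ, Eucl n →L[ℝ] ℝ) ∞ (fun t ↦ (e (cotangentRay ξ t)).2) t
  simp only [h]
  rw [contMDiffAt_iff_contDiffAt]
  exact (contDiffAt_const.sub contDiffAt_id).smul contDiffAt_const

theorem covNorm_cotangentRay (g : RMetric n L) (ξ : Cotangent n L) (t : ℝ) :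
    covNorm g (cotangentRay ξ t) = |1 - t| * covNorm g ξ := covNorm_smul g ξ.1 ξ.2 (1 - t)

/-- The radial path from `x` to `L`. -/
def radialPath (ψ : OpenPartialHomeomorph M (Cotangent n L)) (x : M) (t : ℝ) : M :=
  ψ.symm (cotangentRay (ψ x) t)

/-- Since `|p|` is at most `|p(x)| < d(V, Θ)` on the segment, the segment does not meet the boundary
of `ψ(V)`. -/
theorem cotangentRay_mem [T2Space L] (hV : IsInnerNbhd ι ψ V) {x : M}
    (hx : x ∈ V) (hxs : ENNReal.ofReal (covNorm g (ψ x)) < size ψ g V) {t : ℝ}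
    (ht : t ∈ Icc (0 : ℝ) 1) : cotangentRay (ψ x) t ∈ ψ '' V := by
  have hT2 : T2Space (Cotangent n L) := t2Space_cotangent
  have hc : Continuous (cotangentRay (ψ x)) := (contMDiff_cotangentRay (ψ x)).continuous
  have hK : IsClosed (ψ '' closure V) :=
    (hV.isCompact_closure.image_of_continuousOn (ψ.continuousOn.mono hV.closure_subset)).isClosed
  have hU : IsOpen (ψ '' V) := ψ.isOpen_image_of_subset_source hV.isOpen hV.subset_source
  refine isPreconnected_Icc.subset_of_closure_inter_subset (hU.preimage hc)
    ⟨0, left_mem_Icc.2 zero_le_one, x, hx, ?_⟩ ?_ ht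
  · simp [cotangentRay]
  rintro s ⟨hs, hs'⟩
  have h1 : s ∈ cotangentRay (ψ x) ⁻¹' (ψ '' closure V) :=
    (hK.preimage hc).closure_subset_iff.2 (preimage_mono (image_mono subset_closure)) hs
  obtain ⟨y, hy, hys⟩ := h1
  refine ⟨y, ?_, hys⟩
  by_contra hn
  have h2 := size_le_of_mem_frontier (V := V) ψ g (x := y) (by
    rw [hV.isOpen.frontier_eq]
    exact ⟨hy, hn⟩)
  rw [hys, covNorm_cotangentRay] at h2
  refine (h2.trans (ENNReal.ofReal_le_ofReal ?_)).not_gt hxs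
  refine mul_le_of_le_one_left (Real.sqrt_nonneg _) ?_
  rw [abs_le]
  constructor <;> linarith [hs'.1, hs'.2]

/-- A vertical vector `a` at a point over `q` has the Sasakian norm of its fibre part. -/
theorem IsSasakianOn.form_J_of_vertical (hS : IsSasakianOn J ψ g V) (hψ : IsDarbouxChart Ω ι ψ)
    {x : M} (hx : x ∈ V) (hxs : x ∈ ψ.source) {a : TangentSpace 𝓘(ℝ, Eucl m) x}
    (ha : dq ψ x a = 0) {ξ : Cotangent n L} (hξ : ξ.1 = (ψ x).1)
    (hF : ∀ w : Eucl n, dFibre ψ x a w = -(show Eucl n →L[ℝ] ℝ from ξ.2) w) :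
    Ω.form x a (J.J x a) = covNorm g ξ ^ 2 := by
  obtain ⟨q, p⟩ := ξ
  change q = (ψ x).1 at hξ
  subst hξ
  have h1 : g.inner (ψ x).1 (dq ψ x (J.J x a)) = p := by
    ext w
    have h2 := hS.connectionMap_eq hx a w
    have h3 : connectionMap ψ g x a w = dFibre ψ x a w := by
      have h4 : christoffel g (ψ x).1 (dq ψ x a) w (sharp g (ψ x).1 (ψ x).2) = 0 := by
        have h5 := christoffel_neg g (ψ x).1 0 w (sharp g (ψ x).1 (ψ x).2)
        rw [neg_zero] at h5
        rw [ha]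
        change christoffel g (ψ x).1 (0 : Eucl n) w (sharp g (ψ x).1 (ψ x).2) = 0
        linarith
      rw [connectionMap, h4, sub_zero]
    rw [h3] at h2
    exact neg_injective (h2.symm.trans (hF w))
  rw [covNorm_sq_of_inner_eq g h1, hS.form_J_eq hψ hx hxs, ha]
  simp

/-- Radial paths have constant speed `|p|`. -/
theorem IsSasakianOn.form_velocity_radialPath (hS : IsSasakianOn J ψ g V)
    (hψ : IsDarbouxChart Ω ι ψ) (hVs : V ⊆ ψ.source) {x : M} {t : ℝ}
    (ht : cotangentRay (ψ x) t ∈ ψ '' V) :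
    ContMDiffAt 𝓘(ℝ, ℝ) 𝓘(ℝ, Eucl m) ∞ (radialPath ψ x) t ∧
    Ω.form (radialPath ψ x t) (velocity m (radialPath ψ x) t)
      (J.J (radialPath ψ x t) (velocity m (radialPath ψ x) t)) = covNorm g (ψ x) ^ 2 := by
  have htar : cotangentRay (ψ x) t ∈ ψ.target := by
    obtain ⟨y, hy, hyt⟩ := ht
    rw [← hyt]
    exact ψ.map_source (hVs hy)
  have hsm : ContMDiffAt 𝓘(ℝ, ℝ) 𝓘(ℝ, Eucl m) ∞ (radialPath ψ x) t :=
    (hψ.smooth_symm.contMDiffAt (ψ.open_target.mem_nhds htar)).comp t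
      (contMDiff_cotangentRay (ψ x) t)
  refine ⟨hsm, ?_⟩
  have hmem : radialPath ψ x t ∈ V := by
    obtain ⟨y, hy, hyt⟩ := ht
    rw [radialPath, ← hyt, ψ.left_inv (hVs hy)]
    exact hy
  have hev : ∀ᶠ s in 𝓝 t, ψ (radialPath ψ x s) = cotangentRay (ψ x) s := by
    filter_upwards [(contMDiff_cotangentRay (ψ x)).continuous.continuousAt
      (ψ.open_target.mem_nhds htar)] with s hs using ψ.right_inv hs
  have hd := (hsm.mdifferentiableAt (by simp)).hasMFDerivAt
  have hq : (ψ x).1 = (ψ (radialPath ψ x t)).1 := by rw [hev.self_of_nhds]; rfl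
  refine hS.form_J_of_vertical hψ hmem (hVs hmem) ?_ hq fun w ↦ ?_
  · have h1 := ((hψ.contMDiffAt_base (hVs hmem)).mdifferentiableAt (by simp)).hasMFDerivAt.comp t hd
    have h2 : HasMFDerivAt 𝓘(ℝ, ℝ) 𝓘(ℝ, Eucl n) ((fun y ↦ (ψ y).1) ∘ radialPath ψ x) t 0 := by
      refine (hasMFDerivAt_const (ψ x).1 t).congr_of_eventuallyEq ?_
      filter_upwards [hev] with s hs
      change (ψ (radialPath ψ x s)).1 = (ψ x).1
      rw [hs]
      rfl
    exact DFunLike.congr_fun (hasMFDerivAt_unique h1 h2) (1 : ℝ)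
  · have h1 : HasFDerivAt (fibreCoord ψ (ψ (radialPath ψ x t)).1 ∘ radialPath ψ x)
        ((show Eucl m →L[ℝ] Eucl n →L[ℝ] ℝ from dFibre ψ (radialPath ψ x t)).comp
          (show ℝ →L[ℝ] Eucl m from mfderiv 𝓘(ℝ, ℝ) 𝓘(ℝ, Eucl m) (radialPath ψ x) t)) t :=
      hasMFDerivAt_iff_hasFDerivAt.1 (((hψ.contMDiffAt_fibreCoord (hVs hmem)
        (mem_chart_source (Eucl n) (ψ (radialPath ψ x t)).1)).mdifferentiableAt
          (by simp)).hasMFDerivAt.comp t hd)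
    have h2 : HasDerivAt (fibreCoord ψ (ψ (radialPath ψ x t)).1 ∘ radialPath ψ x)
        ((-1 : ℝ) • (show Eucl n →L[ℝ] ℝ from (ψ x).2)) t := by
      have h3 : ∀ P : Eucl n →L[ℝ] ℝ, HasDerivAt (fun s : ℝ ↦ (1 - s) • P) ((-1 : ℝ) • P) t :=
        fun P ↦ ((hasDerivAt_id' t).const_sub 1).smul_const P
      refine (h3 (ψ x).2).congr_of_eventuallyEq ?_
      filter_upwards [hev] with s hs
      ext u
      have h4 : ∀ ξ : Cotangent n L, ψ (radialPath ψ x s) = ξ →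
          fibreCoord ψ (ψ x).1 (radialPath ψ x s) u =
            ξ.2 (chartSymmDeriv (ψ x).1 (chartAt (Eucl n) (ψ x).1 ξ.1) u) := by
        rintro ξ rfl
        rfl
      rw [← hq]
      refine (h4 _ hs).trans ?_
      exact congrArg ((1 - s) • (ψ x).2) (chartSymmDeriv_self (ψ x).1 u)
    have h5 := congrArg (fun T : Eucl n →L[ℝ] ℝ ↦ T w) (h1.hasDerivAt.unique h2)
    refine Eq.trans ?_ (h5.trans ?_)
    · rfl
    · exact neg_one_mul _

/-- The distance to `L` is at most the length of the radial path. -/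
theorem IsSasakianOn.distTo_le_covNorm [T2Space L] (hS : IsSasakianOn J ψ g V)
    (hψ : IsDarbouxChart Ω ι ψ) (hV : IsInnerNbhd ι ψ V) {x : M} (hx : x ∈ V)
    (hxs : ENNReal.ofReal (covNorm g (ψ x)) < size ψ g V) :
    distTo J (range ι) x ≤ ENNReal.ofReal (covNorm g (ψ x)) := by
  have hrad := fun t (ht : t ∈ Icc (0 : ℝ) 1) ↦
    hS.form_velocity_radialPath hψ hV.subset_source (cotangentRay_mem hV hx hxs ht)
  have h0 : radialPath ψ x 0 = x := by
    have : cotangentRay (ψ x) 0 = ψ x := by simp [cotangentRay]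
    rw [radialPath, this, ψ.left_inv (hV.subset_source hx)]
  have h1 : radialPath ψ x 1 = ι (ψ x).1 := by
    have : cotangentRay (ψ x) 1 = ψ (ι (ψ x).1) := by
      rw [hψ.zero_section]
      simp [cotangentRay]
    rw [radialPath, this, ψ.left_inv (hψ.range_subset (mem_range_self _))]
  have h2 := distJ_le_pathLength J (γ := radialPath ψ x) zero_le_one fun t ht ↦
    ((hrad t ht).1.of_le (by simp)).contMDiffWithinAt
  rw [h0, h1] at h2
  refine (iInf₂_le _ (mem_range_self _)).trans (h2.trans_eq ?_)
  rw [pathLength, setLIntegral_congr_fun measurableSet_Icc (g := fun _ ↦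
    ENNReal.ofReal (covNorm g (ψ x))) fun t ht ↦ ?_]
  · simp
  · simp only [(hrad t ht).2]
    rw [Real.sqrt_sq (show 0 ≤ covNorm g (ψ x) from Real.sqrt_nonneg _)]

end Distance

/-! ### The kinetic energy along a holomorphic strip -/

/-- `d(w^*T) = w^*(dT)`, for a 1-form `T` on a vector space and a map `w` of the plane. -/
theorem dx_sub_dy_pullback {E : Type*} [NormedAddCommGroup E] [NormedSpace ℝ E]
    {O : Set (ℝ × ℝ)} (hO : IsOpen O) {w : ℝ × ℝ → E} (hw : ContDiffOn ℝ 2 w O)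
    {T : E → E →L[ℝ] ℝ} {z : ℝ × ℝ} (hz : z ∈ O) (hT : DifferentiableAt ℝ T (w z)) :
    dx (fun y ↦ T (w y) (dy w y)) z - dy (fun y ↦ T (w y) (dx w y)) z =
      fderiv ℝ T (w z) (dx w z) (dy w z) - fderiv ℝ T (w z) (dy w z) (dx w z) := by
  have hwz : HasFDerivAt w (fderiv ℝ w z) z :=
    ((hw.contDiffAt (hO.mem_nhds hz)).differentiableAt two_ne_zero).hasFDerivAt
  have hTw : HasFDerivAt (fun z ↦ T (w z)) ((fderiv ℝ T (w z)).comp (fderiv ℝ w z)) z :=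
    hT.hasFDerivAt.comp z hwz
  have e1 : dx (fun y ↦ T (w y) (dy w y)) z =
      T (w z) (dx (dy w) z) + fderiv ℝ T (w z) (dx w z) (dy w z) := by
    have h4 : HasFDerivAt (fun z ↦ T (w z) (dy w z)) _ z :=
      hTw.clm_apply (hasFDerivAt_fderiv_apply hO hw hz (0, 1))
    rw [dx, h4.fderiv]
    rfl
  have e2 : dy (fun y ↦ T (w y) (dx w y)) z =
      T (w z) (dy (dx w) z) + fderiv ℝ T (w z) (dy w z) (dx w z) := by
    have h4 : HasFDerivAt (fun z ↦ T (w z) (dx w z)) _ z :=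
      hTw.clm_apply (hasFDerivAt_fderiv_apply hO hw hz (1, 0))
    rw [dy, h4.fderiv]
    rfl
  rw [e1, e2, dx_dy_comm hO hw hz]
  ring

section Subharmonic

variable {n : ℕ} {L : Type*} [TopologicalSpace L] [ChartedSpace (Eucl n) L]
  [IsManifold 𝓘(ℝ, Eucl n) ∞ L] {m : ℕ} {M : Type*} [TopologicalSpace M]
  [ChartedSpace (Eucl m) M] [IsManifold 𝓘(ℝ, Eucl m) ∞ M]
  {Ω : SymplecticForm m M} {ι : L → M} {ψ : OpenPartialHomeomorph M (Cotangent n L)}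
  {J : CompatibleACS Ω} {g : RMetric n L} {V : Set M}
  {A : Set M} {φ : ℝ → ℝ → M ≃ₘ⟮𝓘(ℝ, Eucl m), 𝓘(ℝ, Eucl m)⟯ M} {ρ : ℝ → ℝ} {v : ℝ × ℝ → M}

theorem covectorInChart_apply (θ : ∀ x : M, TangentSpace 𝓘(ℝ, Eucl m) x →L[ℝ] ℝ) {x₀ z : M}
    (hz : z ∈ (chartAt (Eucl m) x₀).source) (a : TangentSpace 𝓘(ℝ, Eucl m) z) :
    covectorInChart θ x₀ (chartAt (Eucl m) x₀ z) (chartDeriv x₀ z a) = θ z a := by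
  change θ ((chartAt (Eucl m) x₀).symm (chartAt (Eucl m) x₀ z))
    (chartSymmDeriv x₀ (chartAt (Eucl m) x₀ z) (chartDeriv x₀ z a)) = _
  rw [chartSymmDeriv_chartDeriv hz, (chartAt (Eucl m) x₀).left_inv hz]

namespace IsMovingStrip

theorem contDiffAt_fibreEnergy (hv : IsMovingStrip J A φ ρ v) (hψ : IsDarbouxChart Ω ι ψ)
    (g : RMetric n L) {z : ℝ × ℝ} (hz : z ∈ openStrip) (hzs : v z ∈ ψ.source) :
    ContDiffAt ℝ ∞ (fun z ↦ fibreEnergy ψ g (v z)) z :=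
  contMDiffAt_iff_contDiffAt.1 ((hψ.contMDiffAt_fibreEnergy g hzs).comp z (hv.contMDiffAt hz))

theorem dx_fibreEnergy (hv : IsMovingStrip J A φ ρ v) (hψ : IsDarbouxChart Ω ι ψ)
    (g : RMetric n L) {z : ℝ × ℝ} (hz : z ∈ openStrip) (hzs : v z ∈ ψ.source) :
    dx (fun z ↦ fibreEnergy ψ g (v z)) z = dFibreEnergy ψ g (v z) (dTau (m := m) v z) := by
  have h : HasFDerivAt (fun z ↦ fibreEnergy ψ g (v z))
      ((show Eucl m →L[ℝ] ℝ from dFibreEnergy ψ g (v z)).comp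
        (show ℝ × ℝ →L[ℝ] Eucl m from mfderiv 𝓘(ℝ, ℝ × ℝ) 𝓘(ℝ, Eucl m) v z)) z :=
    hasMFDerivAt_iff_hasFDerivAt.1 ((hψ.hasMFDerivAt_fibreEnergy g hzs).comp z
      ((hv.contMDiffAt hz).mdifferentiableAt (by simp)).hasMFDerivAt)
  rw [dx, h.fderiv, dTau, mfderivWithin_of_mem_nhds (strip_mem_nhds hz)]
  rfl

theorem dy_fibreEnergy (hv : IsMovingStrip J A φ ρ v) (hψ : IsDarbouxChart Ω ι ψ)
    (g : RMetric n L) {z : ℝ × ℝ} (hz : z ∈ openStrip) (hzs : v z ∈ ψ.source) :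
    dy (fun z ↦ fibreEnergy ψ g (v z)) z = dFibreEnergy ψ g (v z) (dT (m := m) v z) := by
  have h : HasFDerivAt (fun z ↦ fibreEnergy ψ g (v z))
      ((show Eucl m →L[ℝ] ℝ from dFibreEnergy ψ g (v z)).comp
        (show ℝ × ℝ →L[ℝ] Eucl m from mfderiv 𝓘(ℝ, ℝ × ℝ) 𝓘(ℝ, Eucl m) v z)) z :=
    hasMFDerivAt_iff_hasFDerivAt.1 ((hψ.hasMFDerivAt_fibreEnergy g hzs).comp z
      ((hv.contMDiffAt hz).mdifferentiableAt (by simp)).hasMFDerivAt)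
  rw [dy, h.fderiv, dT, mfderivWithin_of_mem_nhds (strip_mem_nhds hz)]
  rfl

/-- `Δ(f ∘ v) = |∂v/∂τ|²`, since `d(f ∘ v)` is, up to rotation by a quarter turn, the pull-back of
the Liouville form. -/
theorem lap_fibreEnergy (hv : IsMovingStrip J A φ ρ v) (hψ : IsDarbouxChart Ω ι ψ)
    (hS : IsSasakianOn J ψ g V) (hV : IsOpen V) (hVs : V ⊆ ψ.source) {z : ℝ × ℝ}
    (hz : z ∈ openStrip) (hzV : v z ∈ V) :
    lap (fun z ↦ fibreEnergy ψ g (v z)) z = Ω.form (v z) (dTau v z) (dT v z) := by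
  set c := chartAt (Eucl m) (v z) with hc
  set w : ℝ × ℝ → Eucl m := fun y ↦ c (v y) with hw
  set T := covectorInChart (liouville (m := m) ψ) (v z) with hT
  set O : Set (ℝ × ℝ) := openStrip ∩ v ⁻¹' (c.source ∩ V) with hOdef
  have hO : IsOpen O := hv.isOpen_preimage (c.open_source.inter hV)
  have hzO : z ∈ O := ⟨hz, mem_chart_source _ _, hzV⟩
  have hw2 : ContDiffOn ℝ 2 w O := fun y hy ↦
    ((hv.contDiffAt_chart hy.1 hy.2.1).of_le two_le_infty).contDiffWithinAt
  have h1 : ∀ y ∈ O, dx (fun z ↦ fibreEnergy ψ g (v z)) y = -T (w y) (dy w y) := by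
    intro y hy
    have hys : y ∈ strip := openStrip_subset hy.1
    have e1 : dy w y = chartDeriv (v z) (v y) (dT v y) := hv.dy_chart hy.1 hy.2.1
    rw [hv.dx_fibreEnergy hψ g hy.1 (hVs hy.2.2), hv.dTau_eq hys, map_neg,
      hS.dFibreEnergy_J hψ hy.2.2 (hVs hy.2.2), e1]
    exact congrArg Neg.neg (covectorInChart_apply (liouville ψ) hy.2.1 _).symm
  have h2 : ∀ y ∈ O, dy (fun z ↦ fibreEnergy ψ g (v z)) y = T (w y) (dx w y) := by
    intro y hy
    have hys : y ∈ strip := openStrip_subset hy.1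
    have e1 : dx w y = chartDeriv (v z) (v y) (dTau v y) := hv.dx_chart hy.1 hy.2.1
    rw [hv.dy_fibreEnergy hψ g hy.1 (hVs hy.2.2), hv.dT_eq hys,
      hS.dFibreEnergy_J hψ hy.2.2 (hVs hy.2.2), e1]
    exact (covectorInChart_apply (liouville ψ) hy.2.1 _).symm
  have e1 : dx (dx (fun z ↦ fibreEnergy ψ g (v z))) z = -dx (fun y ↦ T (w y) (dy w y)) z := by
    have : dx (fun z ↦ fibreEnergy ψ g (v z)) =ᶠ[𝓝 z] fun y ↦ -T (w y) (dy w y) := by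
      filter_upwards [hO.mem_nhds hzO] with y hy using h1 y hy
    rw [dx, this.fderiv_eq, fderiv_fun_neg]
    rfl
  have e2 : dy (dy (fun z ↦ fibreEnergy ψ g (v z))) z = dy (fun y ↦ T (w y) (dx w y)) z := by
    have : dy (fun z ↦ fibreEnergy ψ g (v z)) =ᶠ[𝓝 z] fun y ↦ T (w y) (dx w y) := by
      filter_upwards [hO.mem_nhds hzO] with y hy using h2 y hy
    rw [dy, this.fderiv_eq]
    rfl
  have hTd : DifferentiableAt ℝ T (w z) :=
    (hψ.contDiffAt_covectorInChart (mem_coordDomain (hVs hzV))).differentiableAt (by simp)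
  have key := dx_sub_dy_pullback hO hw2 hzO hTd
  have e3 : dx w z = dTau (m := m) v z :=
    (hv.dx_chart hz (mem_chart_source _ _)).trans (chartDeriv_self _ _)
  have e4 : dy w z = dT (m := m) v z :=
    (hv.dy_chart hz (mem_chart_source _ _)).trans (chartDeriv_self _ _)
  have e5 : Ω.form (v z) (dTau v z) (dT v z) =
      -(fderiv ℝ T (w z) (dx w z) (dy w z) - fderiv ℝ T (w z) (dy w z) (dx w z)) := by
    rw [e3, e4]
    exact hψ.symplectic _ (hVs hzV) _ _
  rw [lap, e1, e2, e5]
  linarith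

theorem dx_fibreEnergy_sq_le (hv : IsMovingStrip J A φ ρ v) (hψ : IsDarbouxChart Ω ι ψ)
    (hS : IsSasakianOn J ψ g V) (hVs : V ⊆ ψ.source) {z : ℝ × ℝ} (hz : z ∈ openStrip)
    (hzV : v z ∈ V) : dx (fun z ↦ fibreEnergy ψ g (v z)) z ^ 2 ≤
      2 * fibreEnergy ψ g (v z) * Ω.form (v z) (dTau v z) (dT v z) := by
  rw [hv.dx_fibreEnergy hψ g hz (hVs hzV), hv.density_eq (openStrip_subset hz)]
  exact hS.dFibreEnergy_sq_le hψ hzV (hVs hzV) _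

/-- If the strip is stationary in the `t`-direction wherever `f > k`, then `f ≤ k` at the start of
every vertical segment in `V` which ends on `L`. -/
theorem fibreEnergy_le_of_dT_eq_zero (hv : IsMovingStrip J A φ ρ v) (hψ : IsDarbouxChart Ω ι ψ)
    (hVs : V ⊆ ψ.source) {k : ℝ} (hk : 0 ≤ k) {τ t₀ : ℝ}
    (ht₀ : t₀ ∈ Ico (0 : ℝ) 1) (hmem : ∀ t ∈ Icc t₀ 1, v (τ, t) ∈ V)
    (hend : fibreEnergy ψ g (v (τ, 1)) = 0)
    (hstat : ∀ t ∈ Ioo t₀ 1, k < fibreEnergy ψ g (v (τ, t)) → dT (m := m) v (τ, t) = 0) :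
    fibreEnergy ψ g (v (τ, t₀)) ≤ k := by
  set F : ℝ → ℝ := fun t ↦ posSq (fibreEnergy ψ g (v (τ, t)) - k) with hF
  have hcont : ContinuousOn (fun t ↦ fibreEnergy ψ g (v (τ, t))) (Icc t₀ 1) := by
    intro t ht
    have hts : (τ, t) ∈ strip := ⟨mem_univ _, ht₀.1.trans ht.1, ht.2⟩
    have h1 : ContinuousWithinAt (fun t ↦ v (τ, t)) (Icc t₀ 1) t :=
      (hv.smooth.continuousOn _ hts).comp (Continuous.prodMk_right τ).continuousWithinAt
        fun s hs ↦ ⟨mem_univ _, ht₀.1.trans hs.1, hs.2⟩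
    exact (hψ.contMDiffAt_fibreEnergy g (hVs (hmem t ht))).continuousAt.comp_continuousWithinAt
      (f := fun t ↦ v (τ, t)) h1
  have hFc : ContinuousOn F (Icc t₀ 1) :=
    contDiff_posSq.continuous.comp_continuousOn (hcont.sub continuousOn_const)
  have hFd : ∀ t ∈ Ioo t₀ 1, HasDerivAt F 0 t := by
    intro t ht
    have hts : (τ, t) ∈ openStrip := ⟨mem_univ _, ht₀.1.trans_lt ht.1, ht.2⟩
    have htV := hVs (hmem t (Ioo_subset_Icc_self ht))
    have h1 : HasDerivAt (fun t ↦ fibreEnergy ψ g (v (τ, t)))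
        (dy (fun z ↦ fibreEnergy ψ g (v z)) (τ, t)) t :=
      ((hv.contDiffAt_fibreEnergy hψ g hts htV).differentiableAt
        (by simp)).hasFDerivAt.comp_hasDerivAt t ((hasDerivAt_const t τ).prodMk (hasDerivAt_id t))
    refine ((hasDerivAt_posSq _).comp t (h1.sub_const k)).congr_deriv ?_
    rcases le_or_gt (fibreEnergy ψ g (v (τ, t))) k with h | h
    · rw [max_eq_left (by linarith), mul_zero, zero_mul]
    · rw [hv.dy_fibreEnergy hψ g hts htV, hstat t ht h, map_zero, mul_zero]
  obtain ⟨s, -, hs⟩ := exists_hasDerivAt_eq_slope F (fun _ ↦ 0) ht₀.2 hFc hFd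
  have h1 : F 1 - F t₀ = 0 := by
    rcases div_eq_zero_iff.1 hs.symm with h | h
    · exact h
    · linarith [ht₀.2]
  have h2 : F 1 = 0 := posSq_of_nonpos (by rw [hend]; linarith)
  by_contra! h3
  have h4 : 0 < F t₀ := posSq_pos (by linarith)
  linarith

end IsMovingStrip

end Subharmonic

/-! ### The two alternatives -/

section Alternatives

variable {n : ℕ} {L : Type*} [TopologicalSpace L] [ChartedSpace (Eucl n) L]
  [IsManifold 𝓘(ℝ, Eucl n) ∞ L] {m : ℕ} {M : Type*} [TopologicalSpace M]
  [ChartedSpace (Eucl m) M] [IsManifold 𝓘(ℝ, Eucl m) ∞ M]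
  {Ω : SymplecticForm m M} {ι : L → M} {ψ : OpenPartialHomeomorph M (Cotangent n L)}
  {J : CompatibleACS Ω} {g : RMetric n L} {V : Set M}
  {φ : ℝ → ℝ → M ≃ₘ⟮𝓘(ℝ, Eucl m), 𝓘(ℝ, Eucl m)⟯ M} {ρ : ℝ → ℝ} {v : ℝ × ℝ → M}

theorem IsDarbouxChart.fibreEnergy_of_mem_range (hψ : IsDarbouxChart Ω ι ψ) (g : RMetric n L)
    {x : M} (hx : x ∈ range ι) : fibreEnergy ψ g x = 0 := by
  have h := hψ.covNorm_of_mem_range g hx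
  rw [covNorm_eq, Real.sqrt_eq_zero'] at h
  linarith [fibreEnergy_nonneg (ψ := ψ) g x]

theorem IsDarbouxChart.continuousOn_fibreEnergy (hψ : IsDarbouxChart Ω ι ψ) (g : RMetric n L) :
    ContinuousOn (fibreEnergy ψ g) ψ.source := fun _ hx ↦
  (hψ.contMDiffAt_fibreEnergy g hx).continuousAt.continuousWithinAt

/-- Where `f ∘ v` exceeds its boundary values, a holomorphic strip in `V` is stationary. -/
theorem IsMovingStrip.dT_eq_zero_of_lt (hv : IsMovingStrip J (range ι) φ ρ v)
    (hψ : IsDarbouxChart Ω ι ψ) (hS : IsSasakianOn J ψ g V) (hV : IsInnerNbhd ι ψ V)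
    (hvV : ∀ z ∈ strip, v z ∈ V) {k : ℝ} (hk : 0 < k)
    (hb : ∀ τ, fibreEnergy ψ g (v (τ, 0)) < k) {z : ℝ × ℝ} (hz : z ∈ openStrip)
    (hkz : k < fibreEnergy ψ g (v z)) : dT (m := m) v z = 0 := by
  have hVs := hV.subset_source
  obtain ⟨C, hC⟩ := hV.isCompact_closure.exists_bound_of_continuousOn
    ((hψ.continuousOn_fibreEnergy g).mono hV.closure_subset)
  have hfC : ∀ z ∈ strip, fibreEnergy ψ g (v z) ≤ C := fun z hz ↦
    (Real.le_norm_self _).trans (hC _ (subset_closure (hvV z hz)))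
  set h : ℝ × ℝ → ℝ := fun z ↦ fibreEnergy ψ g (v z) with hh
  set e : ℝ × ℝ → ℝ := fun z ↦ Ω.form (v z) (dTau v z) (dT v z) with he
  have hcont : ContinuousOn h strip := (hψ.continuousOn_fibreEnergy g).comp hv.smooth.continuousOn
    fun z hz ↦ hVs (hvV z hz)
  have hie : IntegrableOn e openStrip := hv.integrableOn_density.mono_set openStrip_subset
  have he0 : ∀ z ∈ openStrip, 0 ≤ e z := fun z hz ↦ hv.density_nonneg (openStrip_subset hz)
  have hec : ContinuousOn e openStrip := fun z hz ↦
    (hv.continuousAt_density hz).continuousWithinAt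
  have hqc : ContinuousOn (fun z ↦ posSq (h z - k) * e z) openStrip :=
    (contDiff_posSq.continuous.comp_continuousOn
      ((hcont.mono openStrip_subset).sub continuousOn_const)).mul hec
  have hbd : ∀ z ∈ openStrip, posSq (h z - k) ≤ posSq C := fun z hz ↦
    posSq_mono (by linarith [hfC z (openStrip_subset hz)])
  have hq : IntegrableOn (fun z ↦ posSq (h z - k) * e z) openStrip := by
    refine (hie.const_mul (posSq C)).mono' (hqc.aestronglyMeasurable
      isOpen_openStrip.measurableSet) ?_
    filter_upwards [ae_restrict_mem isOpen_openStrip.measurableSet] with z hz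
    rw [Real.norm_of_nonneg (mul_nonneg (posSq_nonneg _) (he0 z hz))]
    exact mul_le_mul_of_nonneg_right (hbd z hz) (he0 z hz)
  have hZ : IsClosed (strip ∩ h ⁻¹' Ici k) :=
    hcont.preimage_isClosed_of_isClosed isClosed_strip isClosed_Ici
  have hle : ∫ z in openStrip, posSq (h z - k) * e z ≤ 0 := by
    refine setIntegral_nonpos_of_le_lap (h := h) (Φ := fun x ↦ posSq (x - k))
      (Φ' := fun x ↦ 2 * max 0 (x - k)) (Z := strip ∩ h ⁻¹' Ici k) (m := posSq C) (B := 2 * |C|)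
      isOpen_openStrip hZ ?_ openStrip_subset ?_ ?_ (by fun_prop) ?_ ?_ (by positivity) hie he0 hq
      ?_ ?_
    · rintro ⟨τ, t⟩ ⟨hs, hkt⟩
      refine ⟨mem_univ _, lt_of_le_of_ne hs.2.1 ?_, lt_of_le_of_ne hs.2.2 ?_⟩
      · rintro ht
        have ht' : t = 0 := ht.symm
        subst ht'
        exact (hb τ).not_ge hkt
      · rintro ht
        have ht' : t = 1 := ht
        subst ht'
        have h0 := hψ.fibreEnergy_of_mem_range g (hv.boundary_one τ)
        have hkt' : k ≤ fibreEnergy ψ g (v (τ, 1)) := hkt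
        linarith
    · exact fun z hz ↦ ((hv.contDiffAt_fibreEnergy hψ g hz
        (hVs (hvV z (openStrip_subset hz)))).of_le two_le_infty).contDiffWithinAt
    · intro x
      exact ((hasDerivAt_posSq _).comp x ((hasDerivAt_id x).sub_const k)).congr_deriv (by simp)
    · intro z hz hzZ
      refine posSq_of_nonpos ?_
      by_contra! hc
      exact hzZ ⟨openStrip_subset hz, by rw [mem_preimage, mem_Ici]; linarith⟩
    · intro z hz
      rw [abs_of_nonneg (posSq_nonneg _)]
      exact hbd z hz
    · intro z hz _
      have hzV := hvV z (openStrip_subset hz)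
      refine (hv.dx_fibreEnergy_sq_le hψ hS hVs hz hzV).trans ?_
      refine mul_le_mul_of_nonneg_right ?_ (he0 z hz)
      linarith [hfC z (openStrip_subset hz), le_abs_self C]
    · intro z hz
      rw [hv.lap_fibreEnergy hψ hS hV.isOpen hVs hz (hvV z (openStrip_subset hz))]
      have : 0 ≤ 2 * max 0 (h z - k) * (dx h z ^ 2 + dy h z ^ 2) := by positivity
      linarith
  have hzero : ∫ z in openStrip, posSq (h z - k) * e z = 0 :=
    le_antisymm hle (setIntegral_nonneg isOpen_openStrip.measurableSet fun z hz ↦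
      mul_nonneg (posSq_nonneg _) (he0 z hz))
  rw [setIntegral_eq_zero_iff_of_nonneg_ae ?_ hq] at hzero
  swap
  · filter_upwards [ae_restrict_mem isOpen_openStrip.measurableSet] with z hz using
      mul_nonneg (posSq_nonneg _) (he0 z hz)
  have hq0 := Measure.eqOn_open_of_ae_eq hzero isOpen_openStrip hqc continuousOn_const hz
  have hpos : 0 < posSq (h z - k) := posSq_pos (by linarith)
  exact hv.dT_eq_zero_of_density (openStrip_subset hz) ((mul_eq_zero.1 hq0).resolve_left hpos.ne')

/-- The maximum principle: in `V`, the kinetic energy of a holomorphic strip is bounded by its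
boundary values. -/
theorem IsMovingStrip.fibreEnergy_le (hv : IsMovingStrip J (range ι) φ ρ v)
    (hψ : IsDarbouxChart Ω ι ψ) (hS : IsSasakianOn J ψ g V) (hV : IsInnerNbhd ι ψ V)
    (hvV : ∀ z ∈ strip, v z ∈ V) {k : ℝ} (hk : 0 ≤ k)
    (hb : ∀ τ, fibreEnergy ψ g (v (τ, 0)) ≤ k) {z : ℝ × ℝ} (hz : z ∈ strip) :
    fibreEnergy ψ g (v z) ≤ k := by
  refine le_of_forall_gt_imp_ge_of_dense fun k' hk' ↦ ?_
  obtain ⟨τ, t⟩ := z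
  have hz2 : t ∈ Icc (0 : ℝ) 1 := hz.2
  have hend := hψ.fibreEnergy_of_mem_range g (hv.boundary_one τ)
  rcases eq_or_lt_of_le hz2.2 with rfl | ht1
  · rw [hend]
    exact hk.trans hk'.le
  refine hv.fibreEnergy_le_of_dT_eq_zero hψ hV.subset_source (hk.trans hk'.le) ⟨hz2.1, ht1⟩
    (fun s hs ↦ hvV _ ⟨mem_univ _, hz2.1.trans hs.1, hs.2⟩) hend fun s hs hks ↦ ?_
  exact hv.dT_eq_zero_of_lt hψ hS hV hvV (hk.trans_lt hk') (fun τ ↦ (hb τ).trans_lt hk')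
    ⟨mem_univ _, hz2.1.trans_lt hs.1, hs.2⟩ hks

/-- A strip which leaves `V` passes, with nonzero derivative, through a point of every shell
`{m₁ < f < m₂}` of `V` below the boundary of `V`. -/
theorem IsMovingStrip.exists_mem_shell (hv : IsMovingStrip J (range ι) φ ρ v)
    (hψ : IsDarbouxChart Ω ι ψ) (hV : IsInnerNbhd ι ψ V) {m₁ m₂ : ℝ} (hm₁ : 0 ≤ m₁)
    (hm : m₁ < m₂) (hfr : ∀ x ∈ frontier V, m₂ ≤ fibreEnergy ψ g x)
    (hout : ∃ z ∈ strip, v z ∉ V) :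
    ∃ z ∈ strip, v z ∈ V ∧ m₁ < fibreEnergy ψ g (v z) ∧ fibreEnergy ψ g (v z) < m₂ ∧
      dT (m := m) v z ≠ 0 := by
  obtain ⟨⟨τ, t₁⟩, ⟨-, ht₁⟩, hout⟩ := hout
  have ht₁ : t₁ ∈ Icc (0 : ℝ) 1 := ht₁
  by_contra! hno
  have hVs := hV.subset_source
  have hend := hψ.fibreEnergy_of_mem_range g (hv.boundary_one τ)
  set W : Set M := V ∩ fibreEnergy ψ g ⁻¹' Iio m₂ with hW
  have hWo : IsOpen W := ((hψ.continuousOn_fibreEnergy g).mono hVs).isOpen_inter_preimage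
    hV.isOpen isOpen_Iio
  have hγ : ContinuousOn (fun t ↦ v (τ, t)) (Icc t₁ 1) :=
    hv.smooth.continuousOn.comp (Continuous.prodMk_right τ).continuousOn
      fun s hs ↦ ⟨mem_univ _, ht₁.1.trans hs.1, hs.2⟩
  -- the last time outside `W`
  set T : Set ℝ := Icc t₁ 1 ∩ (fun t ↦ v (τ, t)) ⁻¹' Wᶜ
  have hTc : IsClosed T := hγ.preimage_isClosed_of_isClosed isClosed_Icc hWo.isClosed_compl
  have hTb : BddAbove T := ⟨1, fun t ht ↦ ht.1.2⟩
  have hs : sSup T ∈ T := hTc.csSup_mem ⟨t₁, left_mem_Icc.2 ht₁.2, fun h ↦ hout h.1⟩ hTb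
  set s := sSup T
  have hs0 : 0 ≤ s := ht₁.1.trans hs.1.1
  have h1W : v (τ, 1) ∈ W := ⟨hV.range_subset (hv.boundary_one τ), by
    rw [mem_preimage, hend]
    exact hm₁.trans_lt hm⟩
  have hs1 : s < 1 := lt_of_le_of_ne hs.1.2 fun h ↦ hs.2 (by rw [h]; exact h1W)
  have hafter : ∀ t ∈ Ioc s 1, v (τ, t) ∈ W := fun t ht ↦ by
    by_contra hn
    exact ht.1.not_ge (le_csSup hTb ⟨⟨hs.1.1.trans ht.1.le, ht.2⟩, hn⟩)
  have hcont : ContinuousWithinAt (fun t ↦ v (τ, t)) (Ioc s 1) s :=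
    (hγ s hs.1).mono fun t ht ↦ ⟨hs.1.1.trans ht.1.le, ht.2⟩
  have hne : (𝓝[Ioc s 1] s).NeBot := by
    rw [nhdsWithin_Ioc_eq_nhdsGT hs1]
    infer_instance
  have hcl : v (τ, s) ∈ closure V := mem_closure_of_tendsto hcont (by
    filter_upwards [self_mem_nhdsWithin] with t ht using (hafter t ht).1)
  have hge : m₂ ≤ fibreEnergy ψ g (v (τ, s)) := by
    by_cases hsV : v (τ, s) ∈ V
    · by_contra! h
      exact hs.2 ⟨hsV, h⟩
    · exact hfr _ (by rw [hV.isOpen.frontier_eq]; exact ⟨hcl, hsV⟩)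
  have hlim : Tendsto (fun t ↦ fibreEnergy ψ g (v (τ, t))) (𝓝[Ioc s 1] s)
      (𝓝 (fibreEnergy ψ g (v (τ, s)))) :=
    ((hψ.continuousOn_fibreEnergy g).continuousAt
      (ψ.open_source.mem_nhds (hV.closure_subset hcl))).tendsto.comp hcont
  have hle : fibreEnergy ψ g (v (τ, s)) ≤ m₁ := by
    refine le_of_tendsto hlim ?_
    filter_upwards [self_mem_nhdsWithin] with t ht
    rcases eq_or_lt_of_le ht.2 with rfl | ht1
    · rw [hend]
      exact hm₁
    refine hv.fibreEnergy_le_of_dT_eq_zero hψ hVs hm₁ ⟨hs0.trans ht.1.le, ht1⟩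
      (fun r hr ↦ (hafter r ⟨ht.1.trans_le hr.1, hr.2⟩).1) hend fun r hr hkr ↦ ?_
    have hrW := hafter r ⟨ht.1.trans hr.1, hr.2.le⟩
    exact hno (τ, r) ⟨mem_univ _, hs0.trans (ht.1.trans hr.1).le, hr.2.le⟩ hrW.1 hkr hrW.2
  linarith

/-- The local area bounds, made uniform over a compact set. -/
theorem exists_area_bound [T2Space M] (J : CompatibleACS Ω) {W K : Set M} (hW : IsOpen W)
    (hK : IsCompact K) (hKW : K ⊆ W) :
    ∃ C : ℝ, 0 < C ∧ ∀ (A : Set M)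
      (φ : ℝ → ℝ → M ≃ₘ⟮𝓘(ℝ, Eucl m), 𝓘(ℝ, Eucl m)⟯ M) (ρ : ℝ → ℝ) (v : ℝ × ℝ → M),
      IsMovingStrip J A φ ρ v → (∀ τ, v (τ, 0) ∉ W) → (∀ τ, v (τ, 1) ∉ W) →
      ∀ z₀ ∈ strip, v z₀ ∈ K → dT (m := m) v z₀ ≠ 0 → C ≤ area Ω v := by
  refine hK.induction_on (p := fun S ↦ ∃ C : ℝ, 0 < C ∧ ∀ (A : Set M)
      (φ : ℝ → ℝ → M ≃ₘ⟮𝓘(ℝ, Eucl m), 𝓘(ℝ, Eucl m)⟯ M) (ρ : ℝ → ℝ) (v : ℝ × ℝ → M),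
      IsMovingStrip J A φ ρ v → (∀ τ, v (τ, 0) ∉ W) → (∀ τ, v (τ, 1) ∉ W) →
      ∀ z₀ ∈ strip, v z₀ ∈ S → dT (m := m) v z₀ ≠ 0 → C ≤ area Ω v) ?_ ?_ ?_ ?_
  · exact ⟨1, one_pos, fun _ _ _ _ _ _ _ _ _ h ↦ h.elim⟩
  · rintro S T hST ⟨C, hC, h⟩
    exact ⟨C, hC, fun A φ ρ v hv h0 h1 z hz hzS ↦ h A φ ρ v hv h0 h1 z hz (hST hzS)⟩
  · rintro S T ⟨C, hC, h⟩ ⟨C', hC', h'⟩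
    refine ⟨min C C', lt_min hC hC', fun A φ ρ v hv h0 h1 z hz hzST hd ↦ ?_⟩
    rcases hzST with hzS | hzT
    · exact (min_le_left _ _).trans (h A φ ρ v hv h0 h1 z hz hzS hd)
    · exact (min_le_right _ _).trans (h' A φ ρ v hv h0 h1 z hz hzT hd)
  · intro x hx
    obtain ⟨N, hN, C, hC, h⟩ := exists_local_area_bound J hW (hKW hx)
    exact ⟨N, mem_nhdsWithin_of_mem_nhds hN, C, hC, h⟩

end Alternatives

end HandleSliding

end

open HandleSliding in
theorem mainTheorem2 {n : ℕ}
    {M : Type*} [TopologicalSpace M] [T2Space M] [SecondCountableTopology M]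
    [ChartedSpace (Eucl (2 * n)) M] [IsManifold 𝓘(ℝ, Eucl (2 * n)) ∞ M]
    {L : Type*} [TopologicalSpace L] [CompactSpace L]
    [ChartedSpace (Eucl n) L] [IsManifold 𝓘(ℝ, Eucl n) ∞ L]
    (Ω : SymplecticForm (2 * n) M) (ι : L → M) (hι : IsLagrangianEmbedding Ω ι)
    (ψ : OpenPartialHomeomorph M (Cotangent n L)) (hψ : IsDarbouxChart Ω ι ψ)
    (V : Set M) (hV : IsInnerNbhd ι ψ V)
    (g : RMetric n L) (J₀ : CompatibleACS Ω) (hJ₀ : IsSasakianOn J₀ ψ g V) :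
    0 < size ψ g V ∧
    ∀ δ : ℝ≥0, (δ : ℝ≥0∞) < size ψ g V →
      ∃ C : ℝ, 0 < C ∧
        ∀ (H : ℝ → ℝ → M → ℝ)
          (φ : ℝ → ℝ → M ≃ₘ⟮𝓘(ℝ, Eucl (2 * n)), 𝓘(ℝ, Eucl (2 * n))⟯ M),
          IsHamiltonianFamily Ω H φ → IsEngulfable φ (range ι) V → maxDBar J₀ φ < δ →
        ∀ ρ : ℝ → ℝ, IsElongation ρ →
        ∀ v : ℝ × ℝ → M, IsMovingStrip J₀ (range ι) φ ρ v →
          (v '' strip ⊆ nbhd J₀ δ (range ι) ∧ nbhd J₀ δ (range ι) ⊆ V ∧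
            ∀ z ∈ strip, distTo J₀ (range ι) (v z) ≤ maxDBar J₀ φ) ∨
          (¬ v '' strip ⊆ V ∧ C ≤ area Ω v) := by
  have : T2Space L :=
    T2Space.of_injective_continuous hι.embedding.isEmbedding.injective
      hι.embedding.isEmbedding.continuous
  have hVs := hV.subset_source
  refine ⟨size_pos hψ hV g, fun δ hδ ↦ ?_⟩
  -- a shell `{s₁ ≤ |p| ≤ s₂}` of `V`, between the `δ`-neighbourhood of `L` and the boundary of `V`
  obtain ⟨s₂, hδs₂, hs₂⟩ := ENNReal.lt_iff_exists_nnreal_btwn.1 hδ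
  obtain ⟨s₁, hδs₁, hs₁₂⟩ := exists_between (ENNReal.coe_lt_coe.1 hδs₂)
  set m₁ : ℝ := (s₁ : ℝ) ^ 2 / 2 with hm₁
  set m₂ : ℝ := (s₂ : ℝ) ^ 2 / 2 with hm₂
  have hm : m₁ < m₂ := by
    have h : (s₁ : ℝ) < s₂ := NNReal.coe_lt_coe.2 hs₁₂
    have h0 := s₁.coe_nonneg
    rw [hm₁, hm₂]
    gcongr
  have hfr : ∀ x ∈ frontier V, m₂ < fibreEnergy ψ g x := by
    intro x hx
    have h1 : (s₂ : ℝ≥0∞) < ENNReal.ofReal (covNorm g (ψ x)) :=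
      hs₂.trans_le (size_le_of_mem_frontier ψ g hx)
    rw [← ENNReal.ofReal_coe_nnreal, ENNReal.ofReal_lt_ofReal_iff_of_nonneg s₂.coe_nonneg,
      covNorm_eq, Real.lt_sqrt s₂.coe_nonneg] at h1
    rw [hm₂]
    linarith
  set W : Set M := V ∩ {x | (δ : ℝ) < covNorm g (ψ x)} with hW
  have hWo : IsOpen W := ((hψ.continuousOn_covNorm g).mono hVs).isOpen_inter_preimage hV.isOpen
    isOpen_Ioi
  set K : Set M := closure V ∩ fibreEnergy ψ g ⁻¹' Icc m₁ m₂ with hK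
  have hKc : IsCompact K := hV.isCompact_closure.of_isClosed_subset
    (((hψ.continuousOn_fibreEnergy g).mono hV.closure_subset).preimage_isClosed_of_isClosed
      isClosed_closure isClosed_Icc) inter_subset_left
  have hKW : K ⊆ W := by
    rintro x ⟨hx, hx1, hx2⟩
    refine ⟨?_, ?_⟩
    · by_contra hn
      exact (hfr x (by rw [hV.isOpen.frontier_eq]; exact ⟨hx, hn⟩)).not_ge hx2
    · have h1 : (δ : ℝ) < s₁ := NNReal.coe_lt_coe.2 hδs₁
      have h2 : (s₁ : ℝ) ≤ covNorm g (ψ x) := by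
        rw [covNorm_eq]
        refine Real.le_sqrt_of_sq_le ?_
        rw [hm₁] at hx1
        linarith
      exact h1.trans_le h2
  obtain ⟨C, hC, harea⟩ := exists_area_bound J₀ hWo hKc hKW
  refine ⟨C, hC, fun H φ _ _ hφδ ρ hρ v hv ↦ ?_⟩
  -- the boundary values lie in `D_δ(L)`
  have hdist : ∀ τ, distTo J₀ (range ι) (v (τ, 0)) ≤ maxDBar J₀ φ := by
    intro τ
    obtain ⟨a, ha, hav⟩ := hv.boundary_zero τ
    rw [← hav]
    refine (iInf₂_le a ha).trans ?_
    refine le_trans ?_ (le_iSup₂_of_le (ρ τ) (hρ.mem_Icc τ) le_rfl)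
    exact le_max_of_le_left (le_iSup (fun x ↦ distJ J₀ (φ (ρ τ) 1 x) x) a)
  have hfin : maxDBar J₀ φ ≠ ⊤ := (hφδ.trans ENNReal.coe_lt_top).ne
  have hcov : ∀ τ, covNorm g (ψ (v (τ, 0))) ≤ (maxDBar J₀ φ).toReal := fun τ ↦
    (ENNReal.ofReal_le_iff_le_toReal hfin).1
      ((hJ₀.mem_and_covNorm_le hψ hV (((hdist τ).trans_lt hφδ).trans hδ)).2.trans (hdist τ))
  by_cases hvV : v '' strip ⊆ V
  · have hvV' : ∀ z ∈ strip, v z ∈ V := fun z hz ↦ hvV (mem_image_of_mem v hz)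
    have hle : ∀ z ∈ strip, distTo J₀ (range ι) (v z) ≤ maxDBar J₀ φ := by
      intro z hz
      have h1 : fibreEnergy ψ g (v z) ≤ (maxDBar J₀ φ).toReal ^ 2 / 2 := by
        refine hv.fibreEnergy_le hψ hJ₀ hV hvV' (by positivity) (fun τ ↦ ?_) hz
        have h2 := hcov τ
        rw [covNorm_eq, Real.sqrt_le_left ENNReal.toReal_nonneg] at h2
        linarith
      have h3 : ENNReal.ofReal (covNorm g (ψ (v z))) ≤ maxDBar J₀ φ := by
        rw [ENNReal.ofReal_le_iff_le_toReal hfin, covNorm_eq,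
          Real.sqrt_le_left ENNReal.toReal_nonneg]
        linarith
      exact (hJ₀.distTo_le_covNorm hψ hV (hvV' z hz) ((h3.trans_lt hφδ).trans hδ)).trans h3
    refine Or.inl ⟨?_, fun x hx ↦ (hJ₀.mem_and_covNorm_le hψ hV (lt_trans hx hδ)).1, hle⟩
    rintro _ ⟨z, hz, rfl⟩
    exact (hle z hz).trans_lt hφδ
  · refine Or.inr ⟨hvV, ?_⟩
    have hout : ∃ z ∈ strip, v z ∉ V := by
      by_contra! h
      exact hvV (image_subset_iff.2 h)
    obtain ⟨z, hz, hzV, h1, h2, hdT⟩ := hv.exists_mem_shell hψ hV (by positivity) hm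
      (fun x hx ↦ (hfr x hx).le) hout
    refine harea _ φ ρ v hv ?_ ?_ z hz ⟨subset_closure hzV, h1.le, h2.le⟩ hdT
    · rintro τ ⟨-, hτ⟩
      have h3 : (maxDBar J₀ φ).toReal < δ := by
        rw [← ENNReal.coe_toReal]
        exact (ENNReal.toReal_lt_toReal hfin ENNReal.coe_ne_top).2 hφδ
      have h4 : (δ : ℝ) < covNorm g (ψ (v (τ, 0))) := hτ
      linarith [hcov τ]
    · rintro τ ⟨-, hτ⟩
      have h4 : (δ : ℝ) < covNorm g (ψ (v (τ, 1))) := hτ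
      rw [hψ.covNorm_of_mem_range g (hv.boundary_one τ)] at h4
      exact h4.not_ge δ.coe_nonneg
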